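/- Let $\mathcal{NS}$ be the Neveu-Schwarz $N=2$ superconformal algebra over $\mathbb C$, with generators $L_m,H_m$ ($m\in\mathbb Z$), $G^\pm_r$ ($r\in\mathbb Z+\frac12$), $C$ central, and relations $[L_m,L_n]=(m-n)L_{m+n}+\frac{C}{12}(m^3-m)\delta_{m+n,0}$, $[H_m,H_n]=\frac C3 m\,\delta_{m+n,0}$, $[L_m,H_n]=-nH_{m+n}$, $[L_m,G^\pm_r]=(\frac m2-r)G^\pm_{m+r}$, $[H_m,G^\pm_r]=\pm G^\pm_{m+r}$, $\{G^+_r,G^-_s\}=2L_{r+s}+(r-s)H_{r+s}+\frac C3(r^2-\frac14)\delta_{r+s,0}$, $\{G^\pm_r,G^\pm_s\}=0$. For $q,c\in\mathbb C$ let $V^{ch}_{q/2,q}$ (the chiral Verma module) be the $\mathcal{NS}$-module induced from a vector of $L_0$-weight $q/2$, $H_0$-weight $q$ and central charge $c$ that is annihilated by all generators of positive mode and by $G^+_{-1/2}$. Let $V^{a}_{-q/2,q}$ (the antichiral Verma module) be defined in the same way with $L_0$-weight $-q/2$ and $G^-_{-1/2}$ in place of $G^+_{-1/2}$. A singular vector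 at level $m$ and with charge $n\in\mathbb Z$ in such a module is a vector that is not proportional to the highest weight vector, is annihilated by all generators of positive mode, and has $L_0$-weight $\Delta+m$ and $H_0$-weight $q+n$, where $(\Delta,q)$ is the weight of the highest weight vector; it is called chiral (antichiral) if it is also annihilated by $G^+_{-1/2}$ (by $G^-_{-1/2}$). Let $\mathcal T$ be the topological $N=2$ superconformal algebra, with generators $\mathcal L_m,\mathcal H_m,\mathcal G_m,\mathcal Q_m$ ($m\in\mathbb Z$), $C$ central, and relations $[\mathcal L_m,\mathcal L_n]=(m-n)\mathcal L_{m+n}$, $[\mathcal H_m,\mathcal H_n]=\frac C3m\,\delta_{m+n,0}$, $[\mathcal L_m,\mathcal G_n]=(m-n)\mathcal G_{m+n}$, $[\mathcal H_m,\mathcal G_n]=\mathcal G_{m+n}$, $[\mathcal L_m,\mathcal Q_n]=-n\mathcal Q_{m+n}$, $[\mathcal H_m,\mathcal Q_n]=-\mathcal Q_{m+n}$, $[\mathcal L_m,\mathcal H_n]=-n\mathcal H_{m+n}+\frac C6(m^2+m)\delta_{m+n,0}$, $\{\mathcal G_m,\mathcal Q_n\}=2\mathcal L_{m+n}-2n\mathcal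 H_{m+n}+\frac C3(m^2+m)\delta_{m+n,0}$, $\{\mathcal G_m,\mathcal G_n\}=\{\mathcal Q_m,\mathcal Q_n\}=0$. Let $V^{GQ}_{0,q}$ (the chiral topological Verma module) be induced from a vector of $\mathcal L_0$-weight $0$, $\mathcal H_0$-weight $q$ and central charge $c$ annihilated by all generators of positive mode and by $\mathcal G_0,\mathcal Q_0$. A $\mathcal G_0$-closed singular vector at level $m$ and with charge $n$ in it is a vector $\psi$, not proportional to the highest weight vector, of $\mathcal L_0$-weight $m$ and $\mathcal H_0$-weight $q+n$, annihilated by all generators of positive mode, with $\mathcal G_0\psi=0$ and $\mathcal Q_0\psi\neq0$. **Theorem.** Let $q,c\in\mathbb C$ with $c\neq3$, let $m\in\mathbb Q$ and $n\in\mathbb Z$. 1. The maximal number of linearly independent singular vectors at level $m$ and with charge $n$ in $V^{ch}_{q/2,q}$ (in $V^{a}_{-q/2,q}$) equals the maximal number of linearly independent $\mathcal G_0$-closed singular vectors at level $m-\frac n2$ and with charge $-n$ in $V^{GQ}_{0,-q}$ (at level $m+\frac n2$ and with charge $n$ in $V^{GQ}_{0,q}$). There are at most $1$ linearly independent $\mathcal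 G_0$-closed singular vectors at level $m$ and with charge $n$ in $V^{GQ}_{0,q}$ if $n\in\{0,1\}$, and none for other $n$. 2. The number of linearly independent singular vectors at level $m$ and with charge $n$ in $V^{ch}_{q/2,q}$ is at most $1$ if $n\in\{-1,0\}$, and it is $0$ for all other $n$. The same limits hold for antichiral singular vectors in $V^{ch}_{q/2,q}$. 3. The number of linearly independent singular vectors at level $m$ and with charge $n$ in $V^{a}_{-q/2,q}$ is at most $1$ if $n\in\{0,1\}$, and it is $0$ for all other $n$. The same limits hold for chiral singular vectors in $V^{a}_{-q/2,q}$. 4. Singular vectors in $V^{ch}_{q/2,q}$ exist only with $n=0$ and $m\in\{1,2,\dots\}$ or with $n=-1$ and $m\in\{\frac12,\frac32,\dots\}$; singular vectors in $V^{a}_{-q/2,q}$ exist only with $n=0$ and $m\in\{1,2,\dots\}$ or with $n=1$ and $m\in\{\frac12,\frac32,\dots\}$. In particular, charged singular vectors have $n=-1$ in chiral Verma modules and $n=1$ in antichiral Verma modules. 5. If $V^{ch}_{q/2,q}$ has an antichiral singular vector at level $m$ and with charge $n$, then $q=-m-\frac n2$; if $V^{a}_{-q/2,q}$ has a chiral singular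 vector at level $m$ and with charge $n$, then $q=m-\frac n2$. 6. There are no chiral singular vectors in $V^{ch}_{q/2,q}$ and no antichiral singular vectors in $V^{a}_{-q/2,q}$. -/

import Mathlib

noncomputable section

/-- Generators of the Neveu-Schwarz `N = 2` superconformal algebra. The fermionic generators have
half-integral modes: `Gp k` is `G⁺_{k+1/2}` and `Gm k` is `G⁻_{k+1/2}`; `C` is the central one. -/
inductive NSGen : Type
  | L (m : ℤ)
  | H (m : ℤ)
  | Gp (k : ℤ)
  | Gm (k : ℤ)
  | C

/-- A generator as an element of the free associative algebra. -/
abbrev nsGen (x : NSGen) : FreeAlgebra ℂ NSGen := FreeAlgebra.ι ℂ x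

/-- The (anti-)commutation relations of the Neveu-Schwarz `N = 2` algebra. With `r = k + 1/2` and
`s = l + 1/2`, the relation `GpGm` reads
`{G⁺_r, G⁻_s} = 2 L_{r+s} + (r - s) H_{r+s} + (C/3) (r² - 1/4) δ_{r+s,0}`. -/
inductive NSRel : FreeAlgebra ℂ NSGen → FreeAlgebra ℂ NSGen → Prop
  | LL (m n : ℤ) : NSRel
      (nsGen (.L m) * nsGen (.L n) - nsGen (.L n) * nsGen (.L m))
      (((m : ℂ) - n) • nsGen (.L (m + n))
        + (if m + n = 0 then ((m : ℂ) ^ 3 - m) / 12 else 0) • nsGen .C)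
  | HH (m n : ℤ) : NSRel
      (nsGen (.H m) * nsGen (.H n) - nsGen (.H n) * nsGen (.H m))
      ((if m + n = 0 then (m : ℂ) / 3 else 0) • nsGen .C)
  | LH (m n : ℤ) : NSRel
      (nsGen (.L m) * nsGen (.H n) - nsGen (.H n) * nsGen (.L m))
      ((-(n : ℂ)) • nsGen (.H (m + n)))
  | LGp (m k : ℤ) : NSRel
      (nsGen (.L m) * nsGen (.Gp k) - nsGen (.Gp k) * nsGen (.L m))
      (((m : ℂ) / 2 - (k + 1 / 2)) • nsGen (.Gp (m + k)))
  | LGm (m k : ℤ) : NSRel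
      (nsGen (.L m) * nsGen (.Gm k) - nsGen (.Gm k) * nsGen (.L m))
      (((m : ℂ) / 2 - (k + 1 / 2)) • nsGen (.Gm (m + k)))
  | HGp (m k : ℤ) : NSRel
      (nsGen (.H m) * nsGen (.Gp k) - nsGen (.Gp k) * nsGen (.H m))
      (nsGen (.Gp (m + k)))
  | HGm (m k : ℤ) : NSRel
      (nsGen (.H m) * nsGen (.Gm k) - nsGen (.Gm k) * nsGen (.H m))
      (-nsGen (.Gm (m + k)))
  | GpGm (k l : ℤ) : NSRel
      (nsGen (.Gp k) * nsGen (.Gm l) + nsGen (.Gm l) * nsGen (.Gp k))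
      ((2 : ℂ) • nsGen (.L (k + l + 1)) + ((k : ℂ) - l) • nsGen (.H (k + l + 1))
        + (if k + l + 1 = 0 then (((k : ℂ) + 1 / 2) ^ 2 - 1 / 4) / 3 else 0) • nsGen .C)
  | GpGp (k l : ℤ) : NSRel (nsGen (.Gp k) * nsGen (.Gp l) + nsGen (.Gp l) * nsGen (.Gp k)) 0
  | GmGm (k l : ℤ) : NSRel (nsGen (.Gm k) * nsGen (.Gm l) + nsGen (.Gm l) * nsGen (.Gm k)) 0
  | central (x : NSGen) : NSRel (nsGen .C * nsGen x) (nsGen x * nsGen .C)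

/-- The universal enveloping algebra of the Neveu-Schwarz `N = 2` superconformal algebra. -/
def NSAlgebra : Type := RingQuot NSRel

instance : Ring NSAlgebra := inferInstanceAs (Ring (RingQuot NSRel))

instance : Algebra ℂ NSAlgebra := inferInstanceAs (Algebra ℂ (RingQuot NSRel))

/-- The canonical projection from the free algebra. -/
def nsProj : FreeAlgebra ℂ NSGen →ₐ[ℂ] NSAlgebra := RingQuot.mkAlgHom ℂ NSRel

/-- A generator as an element of the universal enveloping algebra. -/
def nsOp (x : NSGen) : NSAlgebra := nsProj (nsGen x)

/-- The generators with positive mode. -/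
def nsPositive : Set NSAlgebra :=
  {a | ∃ k : ℤ, (0 < k ∧ (a = nsOp (.L k) ∨ a = nsOp (.H k))) ∨
    (0 ≤ k ∧ (a = nsOp (.Gp k) ∨ a = nsOp (.Gm k)))}

/-- The chirality condition: annihilation by `G⁺_{-1/2}`. -/
def nsChiral : Set NSAlgebra := {nsOp (.Gp (-1))}

/-- The antichirality condition: annihilation by `G⁻_{-1/2}`. -/
def nsAntichiral : Set NSAlgebra := {nsOp (.Gm (-1))}

/-- The left ideal generated by the highest weight conditions with `L₀`-weight `Δ`, `H₀`-weight
`q`, central charge `c`, and by the additional vanishing conditions `N`. -/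
def nsIdeal (Δ q c : ℂ) (N : Set NSAlgebra) : Submodule NSAlgebra NSAlgebra :=
  Submodule.span NSAlgebra
    (nsPositive ∪ N ∪ {nsOp (.L 0) - algebraMap ℂ NSAlgebra Δ,
      nsOp (.H 0) - algebraMap ℂ NSAlgebra q, nsOp .C - algebraMap ℂ NSAlgebra c})

/-- The Verma module induced from a highest weight vector of weight `(Δ, q, c)` satisfying the
additional vanishing conditions `N`. -/
abbrev NSVerma (Δ q c : ℂ) (N : Set NSAlgebra) : Type := NSAlgebra ⧸ nsIdeal Δ q c N

/-- The highest weight vector. -/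
def nsHW (Δ q c : ℂ) (N : Set NSAlgebra) : NSVerma Δ q c N :=
  Submodule.Quotient.mk (p := nsIdeal Δ q c N) 1

/-- `ψ` is a singular vector at level `m` and with charge `n` satisfying the additional vanishing
conditions `A`. (The central element acts as `c` on the whole Verma module.) -/
structure IsNSSingular {Δ q c : ℂ} {N : Set NSAlgebra} (A : Set NSAlgebra) (m : ℚ) (n : ℤ)
    (ψ : NSVerma Δ q c N) : Prop where
  level : nsOp (.L 0) • ψ = (Δ + m) • ψ
  charge : nsOp (.H 0) • ψ = (q + n) • ψ
  positive : ∀ a ∈ nsPositive, a • ψ = 0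
  extra : ∀ a ∈ A, a • ψ = 0
  not_proportional : ¬ ∃ t : ℂ, ψ = t • nsHW Δ q c N

/-- The maximal number of linearly independent singular vectors at level `m` and with charge `n`
that satisfy the additional vanishing conditions `A`. -/
def nsSingularDim (Δ q c : ℂ) (N A : Set NSAlgebra) (m : ℚ) (n : ℤ) : Cardinal :=
  Module.rank ℂ (Submodule.span ℂ {ψ : NSVerma Δ q c N | IsNSSingular A m n ψ})

/-- The chiral Verma module: `G⁺_{-1/2}` annihilates the highest weight vector, `Δ = q/2`. -/
abbrev NSChiralVerma (q c : ℂ) : Type := NSVerma (q / 2) q c nsChiral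

/-- The antichiral Verma module: `G⁻_{-1/2}` annihilates the highest weight vector, `Δ = -q/2`. -/
abbrev NSAntichiralVerma (q c : ℂ) : Type := NSVerma (-q / 2) q c nsAntichiral

/-- Generators of the topological `N = 2` superconformal algebra. -/
inductive TopGen : Type
  | L (m : ℤ)
  | H (m : ℤ)
  | G (m : ℤ)
  | Q (m : ℤ)
  | C

/-- A generator as an element of the free associative algebra. -/
abbrev topGen (x : TopGen) : FreeAlgebra ℂ TopGen := FreeAlgebra.ι ℂ x

/-- The (anti-)commutation relations of the topological `N = 2` algebra. -/
inductive TopRel : FreeAlgebra ℂ TopGen → FreeAlgebra ℂ TopGen → Prop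
  | LL (m n : ℤ) : TopRel
      (topGen (.L m) * topGen (.L n) - topGen (.L n) * topGen (.L m))
      (((m : ℂ) - n) • topGen (.L (m + n)))
  | HH (m n : ℤ) : TopRel
      (topGen (.H m) * topGen (.H n) - topGen (.H n) * topGen (.H m))
      ((if m + n = 0 then (m : ℂ) / 3 else 0) • topGen .C)
  | LG (m n : ℤ) : TopRel
      (topGen (.L m) * topGen (.G n) - topGen (.G n) * topGen (.L m))
      (((m : ℂ) - n) • topGen (.G (m + n)))
  | HG (m n : ℤ) : TopRel
      (topGen (.H m) * topGen (.G n) - topGen (.G n) * topGen (.H m))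
      (topGen (.G (m + n)))
  | LQ (m n : ℤ) : TopRel
      (topGen (.L m) * topGen (.Q n) - topGen (.Q n) * topGen (.L m))
      ((-(n : ℂ)) • topGen (.Q (m + n)))
  | HQ (m n : ℤ) : TopRel
      (topGen (.H m) * topGen (.Q n) - topGen (.Q n) * topGen (.H m))
      (-topGen (.Q (m + n)))
  | LH (m n : ℤ) : TopRel
      (topGen (.L m) * topGen (.H n) - topGen (.H n) * topGen (.L m))
      ((-(n : ℂ)) • topGen (.H (m + n))
        + (if m + n = 0 then ((m : ℂ) ^ 2 + m) / 6 else 0) • topGen .C)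
  | GQ (m n : ℤ) : TopRel
      (topGen (.G m) * topGen (.Q n) + topGen (.Q n) * topGen (.G m))
      ((2 : ℂ) • topGen (.L (m + n)) - (2 * (n : ℂ)) • topGen (.H (m + n))
        + (if m + n = 0 then ((m : ℂ) ^ 2 + m) / 3 else 0) • topGen .C)
  | GG (m n : ℤ) : TopRel (topGen (.G m) * topGen (.G n) + topGen (.G n) * topGen (.G m)) 0
  | QQ (m n : ℤ) : TopRel (topGen (.Q m) * topGen (.Q n) + topGen (.Q n) * topGen (.Q m)) 0
  | central (x : TopGen) : TopRel (topGen .C * topGen x) (topGen x * topGen .C)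

/-- The universal enveloping algebra of the topological `N = 2` superconformal algebra. -/
def TopAlgebra : Type := RingQuot TopRel

instance : Ring TopAlgebra := inferInstanceAs (Ring (RingQuot TopRel))

instance : Algebra ℂ TopAlgebra := inferInstanceAs (Algebra ℂ (RingQuot TopRel))

/-- The canonical projection from the free algebra. -/
def topProj : FreeAlgebra ℂ TopGen →ₐ[ℂ] TopAlgebra := RingQuot.mkAlgHom ℂ TopRel

/-- A generator as an element of the universal enveloping algebra. -/
def topOp (x : TopGen) : TopAlgebra := topProj (topGen x)

/-- The generators with positive mode. -/
def topPositive : Set TopAlgebra :=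
  {a | ∃ k : ℤ, 0 < k ∧
    (a = topOp (.L k) ∨ a = topOp (.H k) ∨ a = topOp (.G k) ∨ a = topOp (.Q k))}

/-- The left ideal generated by the conditions on a chiral highest weight vector: `L₀`-weight `0`,
`H₀`-weight `q`, central charge `c`, annihilated by the positive modes and by `G₀`, `Q₀`. -/
def topChiralIdeal (q c : ℂ) : Submodule TopAlgebra TopAlgebra :=
  Submodule.span TopAlgebra
    (topPositive ∪ {topOp (.G 0), topOp (.Q 0), topOp (.L 0),
      topOp (.H 0) - algebraMap ℂ TopAlgebra q, topOp .C - algebraMap ℂ TopAlgebra c})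

/-- The chiral topological Verma module. -/
abbrev TopChiralVerma (q c : ℂ) : Type := TopAlgebra ⧸ topChiralIdeal q c

/-- The highest weight vector. -/
def topChiralHW (q c : ℂ) : TopChiralVerma q c :=
  Submodule.Quotient.mk (p := topChiralIdeal q c) 1

/-- `ψ` is a `G₀`-closed singular vector at level `m` and with charge `n` in the chiral topological
Verma module: it is annihilated by `G₀` but not by `Q₀`. -/
structure IsTopGSingular {q c : ℂ} (m : ℚ) (n : ℤ) (ψ : TopChiralVerma q c) : Prop where
  level : topOp (.L 0) • ψ = (m : ℂ) • ψ
  charge : topOp (.H 0) • ψ = (q + n) • ψ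
  positive : ∀ a ∈ topPositive, a • ψ = 0
  g_closed : topOp (.G 0) • ψ = 0
  not_q_closed : topOp (.Q 0) • ψ ≠ 0
  not_proportional : ¬ ∃ t : ℂ, ψ = t • topChiralHW q c

/-- The maximal number of linearly independent `G₀`-closed singular vectors at level `m` and with
charge `n` in the chiral topological Verma module. -/
def topGSingularDim (q c : ℂ) (m : ℚ) (n : ℤ) : Cardinal :=
  Module.rank ℂ (Submodule.span ℂ {ψ : TopChiralVerma q c | IsTopGSingular m n ψ})

end

/-! The topological twist `twistEquiv` carries the chiral topological Verma module onto the
antichiral Verma module with `Δ = -q/2`. It turns `G₀` into `G⁺_{1/2}`, a positive mode, and `Q₀`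
into `G⁻_{-1/2}`, the antichirality operator. So the singular vectors of the antichiral module
correspond to the vectors killed by the positive modes and by `G₀` (`IsClosed`), with the level
shifted by half the charge. The mirror automorphism exchanges chiral and antichiral modules. All
bounds on number, charge and level therefore reduce to one claim, `IsClosed.exists_word`: a nonzero
closed vector has a nonzero coefficient at an ordered word `L₋₁ʳ G₋₁ᵉ` with `e ≤ 1`, where `e` is
its charge and `r + e` its level. Two closed vectors of equal weight are then proportional, because
a combination of them can be chosen to lose this one coefficient.

For the claim, give `L₋₁` degree 2, the other `L`, `G`, `Q` degree 1, and `H`, `C` degree 0, and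
pass to leading parts. There `L₋₁` is central and injective, `[L_m, L_n]` and `{G_m, Q_n}` survive
only for `m + n = -1`, where they are multiples of `L₋₁`, and the `H` form a Heisenberg algebra of
level `c/3` acting on the fermions. An annihilator together with its conjugate creator counts, up to
a multiple of `L₋₁`, the occurrences of that creator (`not_mem_of_annihilated`). Hence a vector
without `H` in the kernel of the annihilators contains only `L₋₁`, which is central, and `G₋₁`,
whose conjugate `Q₀` is not among the annihilators (`letters_of_hfree`).

The `H` letters are excluded by subtracting from `H₋ⱼ` the fermionic current quadratic in `G` and
`Q` (`dressedH`). The difference commutes with the fermions and has level `c/3 - 1`, so for `c ≠ 3`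
the positive `H` modes detect every `H` letter (`IsSing.derH_eq_zero`). This is the only source of
the hypothesis `c ≠ 3`.

All of this needs a basis of ordered words. It is obtained by letting the generators act on the span
of these words by a recursion and proving the commutation relations from the Jacobi identity
(`Bracket.rel`). The relation of weight and charge for (anti)chiral singular vectors, and the
absence of chiral ones in chiral modules, come from `{G⁺_r, G⁻_{-r}}` at `r = ±1/2`. -/

noncomputable section

/-! ### Ordered words and the action of a Lie superalgebra on them. -/

/-- A linearly ordered index set of homogeneous generators of a Lie superalgebra, with its odd
generators and with the generators that create states from the vacuum. -/
class PBWIndex (X : Type) extends LinearOrder X where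
  odd : X → Prop
  creator : X → Prop

namespace PBWIndex

variable {X : Type} [PBWIndex X]

/-- An ordered word in the creators, without repetitions of odd letters. -/
def Sorted (M : List X) : Prop :=
  M.Pairwise (fun a b => a < b ∨ a = b ∧ ¬ odd a) ∧ ∀ a ∈ M, creator a

variable (X) in
/-- The vector space with the ordered words as a basis. -/
abbrev Space : Type := {M : List X // Sorted M} →₀ ℂ

open Classical in
/-- The basis vector of an ordered word (zero for other words). -/
def mono (M : List X) : Space X := if h : Sorted M then Finsupp.single ⟨M, h⟩ 1 else 0

open Classical in
/-- The sign of the exchange of two generators. -/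
def sgn (x y : X) : ℂ := if odd x ∧ odd y then -1 else 1

lemma sgn_comm (x y : X) : sgn x y = sgn y x := by
  by_cases h : odd x <;> by_cases h' : odd y <;> simp [sgn, h, h']

lemma sgn_mul_self (x y : X) : sgn x y * sgn x y = 1 := by
  unfold sgn; split_ifs <;> norm_num

lemma sorted_nil : Sorted ([] : List X) := by simp [Sorted]

lemma sorted_cons {x : X} {M : List X} :
    Sorted (x :: M) ↔ (creator x ∧ ∀ a ∈ M, x < a ∨ x = a ∧ ¬ odd x) ∧ Sorted M := by
  simp only [Sorted, List.pairwise_cons, List.mem_cons, forall_eq_or_imp]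
  tauto

lemma mono_of_sorted {M : List X} (h : Sorted M) : mono M = Finsupp.single ⟨M, h⟩ 1 := by
  simp [mono, h]

lemma mono_of_not_sorted {M : List X} (h : ¬ Sorted M) : mono M = 0 := by
  simp [mono, h]

lemma mono_val (w : {M : List X // Sorted M}) : mono w.1 = Finsupp.single w 1 :=
  mono_of_sorted w.2

lemma mono_mem_supported {S : Set {M : List X // Sorted M}} {M : List X}
    (h : ∀ hM : Sorted M, (⟨M, hM⟩ : {M : List X // Sorted M}) ∈ S) :
    mono M ∈ Finsupp.supported ℂ ℂ S := by
  by_cases hM : Sorted M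
  · rw [mono_of_sorted hM]; exact Finsupp.single_mem_supported ℂ _ (h hM)
  · rw [mono_of_not_sorted hM]; exact zero_mem _

/-- Two linear maps agree on a vector if they agree on the words in its support. -/
lemma eq_of_forall_support {E : Type*} [AddCommGroup E] [Module ℂ E] (f g : Space X →ₗ[ℂ] E)
    (u : Space X) (h : ∀ w ∈ u.support, f (mono w.1) = g (mono w.1)) : f u = g u := by
  have hu : u ∈ Finsupp.supported ℂ ℂ (u.support : Set {M : List X // Sorted M}) :=
    Finsupp.mem_supported_support ℂ u
  rw [Finsupp.supported_eq_span_single] at hu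
  have : Submodule.span ℂ ((fun i => Finsupp.single i (1 : ℂ)) ''
      (u.support : Set {M : List X // Sorted M})) ≤ LinearMap.eqLocus f g := by
    rw [Submodule.span_le]
    rintro _ ⟨w, hw, rfl⟩
    have := h w hw
    rw [mono_val] at this
    exact this
  exact this hu

lemma map_eq_zero_of_forall_support {E : Type*} [AddCommGroup E] [Module ℂ E]
    (f : Space X →ₗ[ℂ] E) (u : Space X) (h : ∀ w ∈ u.support, f (mono w.1) = 0) : f u = 0 :=
  eq_of_forall_support f 0 u h

/-- A linear map sends a vector into a submodule if it does so for the words in its support. -/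
lemma map_mem_of_forall_support {E : Type*} [AddCommGroup E] [Module ℂ E]
    (f : Space X →ₗ[ℂ] E) (P : Submodule ℂ E) (u : Space X)
    (h : ∀ w ∈ u.support, f (mono w.1) ∈ P) : f u ∈ P := by
  have := map_eq_zero_of_forall_support (P.mkQ.comp f) u (fun w hw => by simpa using h w hw)
  simpa using this

lemma hom_ext {E : Type*} [AddCommGroup E] [Module ℂ E] {f g : Space X →ₗ[ℂ] E}
    (h : ∀ M, Sorted M → f (mono M) = g (mono M)) : f = g :=
  LinearMap.ext fun u => eq_of_forall_support f g u fun w _ => h w.1 w.2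

lemma mem_of_forall_support (P : Submodule ℂ (Space X)) (u : Space X)
    (h : ∀ w ∈ u.support, mono w.1 ∈ P) : u ∈ P :=
  map_mem_of_forall_support LinearMap.id P u h

variable (X) in
/-- Structure constants of a Lie superalgebra in the basis `X`, with a one-dimensional
representation `wt` of the subalgebra spanned by the generators that are not creators. -/
structure Bracket where
  br : X → X → X →₀ ℂ
  wt : X → ℂ
  symm : ∀ x y, br y x = -sgn x y • br x y
  jacobi : ∀ x y z, Finsupp.linearCombination ℂ (br x) (br y z) =
    Finsupp.linearCombination ℂ (fun w => br w z) (br x y) +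
      sgn x y • Finsupp.linearCombination ℂ (br y) (br x z)
  sgn_br : ∀ x y z w, br y z w ≠ 0 → sgn x w = sgn x y * sgn x z
  br_self : ∀ x, odd x → br x x = 0
  wt_odd : ∀ x, odd x → wt x = 0
  creator_br : ∀ x y z, ¬ creator x → ¬ creator y → br x y z ≠ 0 → ¬ creator z
  wt_br : ∀ x y, ¬ creator x → ¬ creator y → Finsupp.linearCombination ℂ wt (br x y) = 0

namespace Bracket

variable (B : Bracket X)

open Classical in
/-- The action of a generator on a word, by commuting it to its place. -/
def act (x : X) (M : List X) : Space X :=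
  match M with
  | [] => if creator x then mono [x] else B.wt x • mono []
  | y :: N =>
    if Sorted (x :: y :: N) then mono (x :: y :: N)
    -- At this point a repeated letter must be odd, and its square is half its bracket with itself,
    -- hence zero.
    else if x = y then 0
    else (B.br x y).sum (fun z a => a • act z N) +
      sgn x y • (act x N).sum (fun w a =>
        -- The guard only ensures termination: a longer word `w` arises by permuting `x :: N`, and
        -- then `y` can simply be prefixed (`sorted_cons_of_mem_reach`).
        a • if _h : w.1.length ≤ N.length then act y w.1 else mono (y :: w.1))
  termination_by M.length
  decreasing_by all_goals simp; try omega

/-- The operator of a generator. -/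
def op (x : X) : Module.End ℂ (Space X) :=
  Finsupp.linearCombination ℂ (fun w : {M : List X // Sorted M} => B.act x w.1)

/-- The operator of an element of the Lie superalgebra. -/
def opL : (X →₀ ℂ) →ₗ[ℂ] Module.End ℂ (Space X) := Finsupp.linearCombination ℂ B.op

lemma opL_single (x : X) (a : ℂ) : B.opL (Finsupp.single x a) = a • B.op x := by
  simp [opL]

lemma op_mono (x : X) {M : List X} (h : Sorted M) : B.op x (mono M) = B.act x M := by
  simp [op, mono_of_sorted h]

lemma op_mono_of_sorted {x : X} {M : List X} (h : Sorted (x :: M)) :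
    B.op x (mono M) = mono (x :: M) := by
  rw [B.op_mono x (sorted_cons.1 h).2]
  cases M with
  | nil => rw [act, if_pos (sorted_cons.1 h).1.1]
  | cons y N => rw [act, if_pos h]

lemma op_vac {x : X} (h : ¬ creator x) : B.op x (mono []) = B.wt x • mono [] := by
  rw [B.op_mono x sorted_nil, act, if_neg h]

lemma opL_apply (e : X →₀ ℂ) (u : Space X) :
    B.opL e u = e.sum fun z a => a • B.op z u := by
  simp [opL, Finsupp.linearCombination_apply, Finsupp.sum, LinearMap.sum_apply]

/-- The words that can occur in the image of a word under a generator. -/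
def reach (x : X) (M : List X) : Set {M : List X // Sorted M} :=
  {w | w.1.length ≤ M.length ∨ (creator x ∧ w.1.Perm (x :: M))}

lemma length_of_mem_reach {x : X} {M : List X} {w : {M : List X // Sorted M}}
    (h : w ∈ reach x M) : w.1.length ≤ M.length + 1 := by
  rcases h with h | ⟨-, h⟩
  · omega
  · simp [h.length_eq]

/-- Each commutator replaces two letters by one, so length grows only when the new letter is moved
to its place unchanged. The induction runs over a length bound because the recursion also acts on
words produced on the way. -/
lemma act_mem_reach : ∀ (n : ℕ) (M : List X), M.length ≤ n → Sorted M → ∀ x,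
    B.act x M ∈ Finsupp.supported ℂ ℂ (reach x M) := by
  intro n
  induction n with
  | zero =>
    intro M hM _ x
    obtain rfl : M = [] := by simpa using hM
    rw [act]
    split_ifs with h
    · exact mono_mem_supported fun _ => Or.inr ⟨h, List.Perm.refl _⟩
    · exact Submodule.smul_mem _ _ (mono_mem_supported fun _ => Or.inl (by simp))
  | succ n ih =>
    intro M hM hs x
    cases M with
    | nil =>
      rw [act]
      split_ifs with h
      · exact mono_mem_supported fun _ => Or.inr ⟨h, List.Perm.refl _⟩
      · exact Submodule.smul_mem _ _ (mono_mem_supported fun _ => Or.inl (by simp))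
    | cons y N =>
      have hN : N.length ≤ n := by simpa using hM
      have hsN := (sorted_cons.1 hs).2
      rw [act]
      split_ifs with h1 h2
      · exact mono_mem_supported fun _ => Or.inr ⟨(sorted_cons.1 h1).1.1, List.Perm.refl _⟩
      · exact zero_mem _
      · refine add_mem (Submodule.sum_mem _ fun z _ => Submodule.smul_mem _ _ ?_)
          (Submodule.smul_mem _ _ (Submodule.sum_mem _ fun w hw => Submodule.smul_mem _ _ ?_))
        · refine Finsupp.supported_mono ?_ (ih N hN hsN z)
          intro w hw
          exact Or.inl (by simpa using length_of_mem_reach hw)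
        · have hw' : w ∈ reach x N := ih N hN hsN x hw
          split_ifs with h3
          · refine Finsupp.supported_mono ?_ (ih w.1 (h3.trans hN) w.2 y)
            intro v hv
            have := length_of_mem_reach hv
            exact Or.inl (by simp; omega)
          · refine mono_mem_supported fun _ => Or.inr ?_
            rcases hw' with h | ⟨h, hp⟩
            · exact absurd h h3
            · exact ⟨h, (hp.cons y).trans (List.Perm.swap _ _ _)⟩

lemma op_mem_reach (x : X) {M : List X} (hM : Sorted M) {w : {M : List X // Sorted M}}
    (hw : w ∈ (B.op x (mono M)).support) : w ∈ reach x M := by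
  rw [B.op_mono x hM] at hw
  exact B.act_mem_reach _ M le_rfl hM x hw

/-- Since `v` cannot be prefixed to `z :: N` and differs from `z`, it lies above `z` if it is a
creator. A rearrangement of `v :: N` then still admits `z` in front. -/
lemma sorted_cons_of_mem_reach {v z : X} {N : List X} (hs : Sorted (z :: N))
    (hv : ¬ Sorted (v :: z :: N)) (hvz : v ≠ z) {w : {M : List X // Sorted M}}
    (hw : w ∈ reach v N) : w.1.length ≤ N.length ∨ Sorted (z :: w.1) := by
  rcases hw with h | ⟨hc, hp⟩
  · exact Or.inl h
  refine Or.inr (sorted_cons.2 ⟨⟨(sorted_cons.1 hs).1.1, fun a ha => ?_⟩, w.2⟩)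
  rcases List.mem_cons.1 (hp.subset ha) with rfl | ha
  · refine Or.inl (lt_of_le_of_ne (not_lt.1 fun hlt => hv ?_) (Ne.symm hvz))
    refine sorted_cons.2 ⟨⟨hc, fun b hb => Or.inl ?_⟩, hs⟩
    rcases List.mem_cons.1 hb with rfl | hb
    · exact hlt
    · rcases (sorted_cons.1 hs).1.2 b hb with h' | ⟨rfl, -⟩
      · exact hlt.trans h'
      · exact hlt
  · exact (sorted_cons.1 hs).1.2 a ha

/-- The commutation relation of two generators, on a vector. -/
def Rel (x y : X) (u : Space X) : Prop :=
  B.op x (B.op y u) = B.opL (B.br x y) u + sgn x y • B.op y (B.op x u)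

variable {B} in
lemma Rel.swap {x y : X} {u : Space X} (h : B.Rel x y u) : B.Rel y x u := by
  unfold Rel at *
  rw [h, B.symm x y, sgn_comm y x]
  simp only [map_smul, smul_add, smul_smul, sgn_mul_self, one_smul, LinearMap.smul_apply, neg_smul,
    map_neg, LinearMap.neg_apply]
  abel

lemma rel_of_forall_support {x y : X} {u : Space X}
    (h : ∀ w ∈ u.support, B.Rel x y (mono w.1)) : B.Rel x y u :=
  eq_of_forall_support (B.op x * B.op y) (B.opL (B.br x y) + sgn x y • (B.op y * B.op x)) u
    (fun w hw => h w hw)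

lemma br_self_of_even {x : X} (hx : ¬ odd x) : B.br x x = 0 := by
  have h := B.symm x x
  have h1 : sgn x x = 1 := by simp [sgn, hx]
  rw [h1, neg_smul, one_smul] at h
  exact self_eq_neg.1 h

lemma rel_self_of_even {x : X} (hx : ¬ odd x) (u : Space X) : B.Rel x x u := by
  simp [Rel, B.br_self_of_even hx, sgn, hx]

lemma op_op_self_of_sorted {y : X} {N : List X} (h : Sorted (y :: N)) (hy : odd y) :
    B.op y (B.op y (mono N)) = 0 := by
  rw [B.op_mono_of_sorted h, B.op_mono y h, act, if_neg, if_pos rfl]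
  intro h'
  have := (sorted_cons.1 h').1.2 y (by simp)
  simp [hy] at this

/-- Here the recursion defining `act` is the commutation relation itself. It remains only to check
that the termination guard does not change the value. -/
lemma rel_of_not_sorted {x y : X} {N : List X} (h : Sorted (y :: N))
    (h1 : ¬ Sorted (x :: y :: N)) (h2 : x ≠ y) : B.Rel x y (mono N) := by
  have hN := (sorted_cons.1 h).2
  unfold Rel
  rw [B.op_mono_of_sorted h, B.op_mono x h, act, if_neg h1, if_neg h2, opL_apply]
  congr 1
  · simp only [B.op_mono _ hN]
  · congr 1
    rw [B.op_mono x hN]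
    conv_rhs => rw [op, Finsupp.linearCombination_apply]
    refine Finsupp.sum_congr fun w hw => ?_
    congr 1
    split_ifs with h3
    · rfl
    · have hw' : w ∈ reach x N := B.act_mem_reach _ N le_rfl hN x hw
      have hs := (sorted_cons_of_mem_reach h h1 h2 hw').resolve_left h3
      rw [← B.op_mono_of_sorted hs, B.op_mono y w.2]

/-- If `x` can be prefixed as well, then `x < y` and the relation with the roles exchanged is the
unsorted case. -/
lemma rel_of_sorted (x : X) {y : X} {N : List X} (h : Sorted (y :: N)) :
    B.Rel x y (mono N) := by
  have hN := (sorted_cons.1 h).2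
  by_cases h2 : x = y
  · subst h2
    by_cases hx : odd x
    · simp [Rel, B.op_op_self_of_sorted h hx, B.br_self x hx]
    · exact B.rel_self_of_even hx _
  by_cases h1 : Sorted (x :: y :: N)
  · have hxy : x < y := by
      rcases (sorted_cons.1 h1).1.2 y (by simp) with h' | ⟨h', -⟩
      · exact h'
      · exact absurd h' h2
    have hxN : Sorted (x :: N) :=
      sorted_cons.2 ⟨⟨(sorted_cons.1 h1).1.1, fun a ha =>
        (sorted_cons.1 h1).1.2 a (List.mem_cons_of_mem _ ha)⟩, hN⟩
    refine Rel.swap (B.rel_of_not_sorted hxN (fun h' => ?_) (Ne.symm h2))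
    rcases (sorted_cons.1 h').1.2 x (by simp) with h'' | ⟨h'', -⟩
    · exact absurd hxy (not_lt.2 h''.le)
    · exact h2 h''.symm
  · exact B.rel_of_not_sorted h h1 h2

/-- The generators that are not creators span a subalgebra on which `wt` is a character, so they act
on the vacuum consistently. -/
lemma rel_vac {x y : X} (hx : ¬ creator x) (hy : ¬ creator y) : B.Rel x y (mono []) := by
  have h0 : B.opL (B.br x y) (mono []) =
      Finsupp.linearCombination ℂ B.wt (B.br x y) • mono [] := by
    rw [opL_apply, Finsupp.linearCombination_apply, Finsupp.sum, Finsupp.sum, Finset.sum_smul]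
    refine Finset.sum_congr rfl fun z hz => ?_
    rw [B.op_vac (B.creator_br x y z hx hy (Finsupp.mem_support_iff.1 hz)), smul_smul, smul_eq_mul]
  rw [Rel, h0, B.wt_br x y hx hy, B.op_vac hx, B.op_vac hy, map_smul, map_smul, B.op_vac hx,
    B.op_vac hy, smul_smul, smul_smul, smul_smul, zero_smul, zero_add]
  congr 1
  by_cases h : odd x ∧ odd y
  · simp [B.wt_odd x h.1]
  · simp [sgn, h]; ring

lemma opL_linearCombination (f : X → X →₀ ℂ) (e : X →₀ ℂ) (u : Space X) :
    B.opL (Finsupp.linearCombination ℂ f e) u = ∑ w ∈ e.support, e w • B.opL (f w) u := by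
  simp [Finsupp.linearCombination_apply, Finsupp.sum, LinearMap.sum_apply]

/-- The commutation relation of two generators, one of them replaced by a linear combination. -/
lemma op_opL {x y z : X} {u : Space X} (h : ∀ w, B.Rel x w u) :
    B.op x (B.opL (B.br y z) u) =
      B.opL (Finsupp.linearCombination ℂ (B.br x) (B.br y z)) u +
        (sgn x y * sgn x z) • B.opL (B.br y z) (B.op x u) := by
  rw [opL_linearCombination, opL_apply, opL_apply, Finsupp.sum, Finsupp.sum, map_sum,
    Finset.smul_sum, ← Finset.sum_add_distrib]
  refine Finset.sum_congr rfl fun w hw => ?_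
  rw [map_smul, h w, B.sgn_br x y z w (Finsupp.mem_support_iff.1 hw), smul_add,
    smul_comm (B.br y z w)]

lemma opL_op {x y z : X} {u : Space X} (h : ∀ w, B.Rel w z u) :
    B.opL (B.br x y) (B.op z u) =
      B.opL (Finsupp.linearCombination ℂ (fun w => B.br w z) (B.br x y)) u +
        (sgn x z * sgn y z) • B.op z (B.opL (B.br x y) u) := by
  rw [opL_linearCombination, opL_apply, opL_apply, Finsupp.sum, Finsupp.sum, map_sum,
    Finset.smul_sum, ← Finset.sum_add_distrib]
  refine Finset.sum_congr rfl fun w hw => ?_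
  rw [h w, sgn_comm w z, B.sgn_br z x y w (Finsupp.mem_support_iff.1 hw), smul_add, map_smul,
    smul_comm (B.br x y w), sgn_comm z x, sgn_comm z y]

/-- The Jacobi identity propagates commutation relations. -/
lemma rel_op {x y z : X} {u : Space X} (h : ∀ v w, B.Rel v w u) (hx : B.Rel y z (B.op x u))
    (hy : B.Rel x z (B.op y u)) : B.Rel x y (B.op z u) := by
  have e1 := B.op_opL (x := x) (y := y) (z := z) (u := u) (h x)
  have e2 := B.op_opL (x := y) (y := x) (z := z) (u := u) (h y)
  have e3 := B.opL_op (x := x) (y := y) (z := z) (u := u) (fun w => h w z)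
  have e4 := congrArg (fun e => B.opL e u) (B.jacobi x y z)
  simp only [map_add, map_smul, LinearMap.add_apply, LinearMap.smul_apply] at e4
  have e5 := h x y
  have e6 := h y z
  have e7 := h x z
  unfold Rel at e5 e6 e7 hx hy ⊢
  rw [e6, e7]
  simp only [map_add, map_smul]
  rw [e1, e2, e3, e4, hx, hy, e5]
  simp only [map_add, map_smul, smul_add, smul_smul, sgn_comm y x]
  have s1 := sgn_mul_self x y
  have s2 := sgn_mul_self x z
  have s3 := sgn_mul_self y z
  match_scalars
  all_goals first
    | ring1
    | linear_combination (sgn x z) * s1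
    | linear_combination (-sgn x z) * s1
    | linear_combination (sgn y z) * s1
    | linear_combination (-sgn y z) * s1

/-- All commutation relations hold on the space of ordered words. -/
lemma rel_mono : ∀ (n : ℕ) (M : List X), M.length ≤ n → Sorted M →
    ∀ x y, B.Rel x y (mono M) := by
  intro n
  induction n with
  | zero =>
    intro M hM _ x y
    obtain rfl : M = [] := by simpa using hM
    by_cases hy : creator y
    · exact B.rel_of_sorted x (by simp [Sorted, hy])
    by_cases hx : creator x
    · exact (B.rel_of_sorted y (by simp [Sorted, hx])).swap
    exact B.rel_vac hx hy
  | succ n ih =>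
    intro M hM hs
    cases M with
    | nil => exact ih [] (by simp) hs
    | cons z N =>
      have hN : N.length ≤ n := by simpa using hM
      have hsN := (sorted_cons.1 hs).2
      have hu := ih N hN hsN
      rw [← B.op_mono_of_sorted hs]
      have key : ∀ v, ¬ Sorted (v :: z :: N) → v ≠ z → ∀ w ∈ (B.op v (mono N)).support,
          w.1.length ≤ n ∨ Sorted (z :: w.1) := fun v hv hvz w hw =>
        (sorted_cons_of_mem_reach hs hv hvz (B.op_mem_reach v hsN hw)).imp_left (·.trans hN)
      have key2 : ∀ x v, ¬ Sorted (v :: z :: N) → v ≠ z → B.Rel x z (B.op v (mono N)) := by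
        intro x v hv hvz
        refine B.rel_of_forall_support fun w hw => ?_
        rcases key v hv hvz w hw with h | h
        · exact ih w.1 h w.2 x z
        · exact B.rel_of_sorted x h
      -- the relation of a generator with the first letter of the word
      have head : ∀ x, B.Rel x z (B.op z (mono N)) := by
        intro x
        by_cases hz : odd z
        swap
        · have h1 := hu x z
          by_cases hzz : Sorted (z :: z :: N)
          · rw [B.op_mono_of_sorted hs]; exact B.rel_of_sorted x hzz
          · exact absurd (sorted_cons.2 ⟨⟨(sorted_cons.1 hs).1.1, fun a ha => by
              rcases List.mem_cons.1 ha with rfl | ha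
              · exact Or.inr ⟨rfl, hz⟩
              · exact (sorted_cons.1 hs).1.2 a ha⟩, hs⟩) hzz
        have hzz := B.op_op_self_of_sorted hs hz
        by_cases hxz : x = z
        · subst hxz
          simp [Rel, hzz, B.br_self x hz]
        by_cases hx : Sorted (x :: z :: N)
        · have hxlt : x < z := by
            rcases (sorted_cons.1 hx).1.2 z (by simp) with h | ⟨h, -⟩
            · exact h
            · exact absurd h hxz
          refine Rel.swap ?_
          rw [B.op_mono_of_sorted hs]
          exact B.rel_of_sorted z hx
        -- Words of `x N` are either covered by induction, where the relation of `z` with itself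
        -- says `z² = -z²`, or accept `z` as a prefix.
        · have h2 : B.op z (B.op z (B.op x (mono N))) = 0 := by
            refine map_eq_zero_of_forall_support (B.op z * B.op z) _ fun w hw => ?_
            rcases key x hx hxz w hw with h | h
            · have := ih w.1 h w.2 z z
              simp only [Rel, B.br_self z hz, sgn, hz, and_self, if_true, map_zero,
                LinearMap.zero_apply, zero_add, neg_smul, one_smul] at this
              exact self_eq_neg.1 this
            · exact B.op_op_self_of_sorted h hz
          have h3 := hu x z
          have h4 := B.opL_op (x := x) (y := z) (z := z) (u := mono N) (fun w => hu w z)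
          have szz : sgn z z = -1 := by simp [sgn, hz]
          -- For odd `z` with `[z, z] = 0`, the Jacobi identity says that `[[x, z], z]` equals its
          -- own negative.
          have h5 : Finsupp.linearCombination ℂ (fun w => B.br w z) (B.br x z) = 0 := by
            have j := B.jacobi x z z
            have e : Finsupp.linearCombination ℂ (B.br z) (B.br x z) =
                sgn x z • Finsupp.linearCombination ℂ (fun w => B.br w z) (B.br x z) := by
              rw [Finsupp.linearCombination_apply, Finsupp.linearCombination_apply, Finsupp.sum,
                Finsupp.sum, Finset.smul_sum]
              refine Finset.sum_congr rfl fun w hw => ?_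
              rw [B.symm w z, sgn_comm w z, B.sgn_br z x z w (Finsupp.mem_support_iff.1 hw), szz,
                sgn_comm z x, smul_comm, mul_neg, mul_one, neg_neg]
            rw [B.br_self z hz, map_zero, e, smul_smul, sgn_mul_self, one_smul] at j
            exact self_eq_neg.1 (eq_neg_of_add_eq_zero_left j.symm)
          unfold Rel at h3 ⊢
          rw [hzz, map_zero, h4, h5, h3]
          simp [szz, h2]
      intro x y
      by_cases hy : Sorted (y :: z :: N)
      · rw [B.op_mono_of_sorted hs]; exact B.rel_of_sorted x hy
      by_cases hx : Sorted (x :: z :: N)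
      · rw [B.op_mono_of_sorted hs]; exact (B.rel_of_sorted y hx).swap
      by_cases hyz : y = z
      · subst hyz; exact head x
      by_cases hxz : x = z
      · subst hxz; exact (head y).swap
      exact B.rel_op hu (key2 y x hx hxz) (key2 x y hy hyz)

theorem rel (x y : X) (u : Space X) : B.Rel x y u :=
  B.rel_of_forall_support fun w _ => B.rel_mono _ w.1 le_rfl w.2 x y

end Bracket
end PBWIndex
end

/-! ### Induction along the recursion, and universality of the module of words. -/

noncomputable section

namespace PBWIndex

variable {X : Type} [PBWIndex X]

namespace Bracket

/-- Induction along the recursion that defines the action of the generators on words. -/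
theorem reach_induction {P : X → List X → Prop}
    (cons : ∀ x M, Sorted (x :: M) → P x M)
    (vac : ∀ x, ¬ creator x → P x [])
    (self : ∀ y N, odd y → Sorted (y :: N) → (∀ z, P z N) → P y (y :: N))
    (step : ∀ x y N, Sorted (y :: N) → (∀ z, P z N) → (∀ w ∈ reach x N, P y w.1) → P x (y :: N))
    {M : List X} (hM : Sorted M) (x : X) : P x M := by
  have main : ∀ (n : ℕ) (M : List X), M.length ≤ n → Sorted M → ∀ x, P x M := by
    intro n
    induction n with
    | zero =>
      intro M hM _ x
      obtain rfl : M = [] := by simpa using hM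
      by_cases hx : creator x
      · exact cons x [] (by simp [Sorted, hx])
      · exact vac x hx
    | succ n ih =>
      intro M hM hs x
      cases M with
      | nil => exact ih [] (by simp) hs x
      | cons y N =>
        have hN : N.length ≤ n := by simpa using hM
        have hP := ih N hN (sorted_cons.1 hs).2
        by_cases hx : Sorted (x :: y :: N)
        · exact cons x _ hx
        by_cases hxy : x = y
        · subst hxy
          by_cases ho : odd x
          · exact self x N ho hs hP
          · refine absurd (sorted_cons.2 ⟨⟨(sorted_cons.1 hs).1.1, fun a ha => ?_⟩, hs⟩) hx
            rcases List.mem_cons.1 ha with rfl | ha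
            · exact Or.inr ⟨rfl, ho⟩
            · exact (sorted_cons.1 hs).1.2 a ha
        refine step x y N hs hP fun w hw => ?_
        rcases sorted_cons_of_mem_reach hs hx hxy hw with h | h
        · exact ih w.1 (h.trans hN) w.2 y
        · exact cons y w.1 h
  exact main _ M le_rfl hM x

variable (B S : Bracket X)

lemma op_op_self {y : X} (hy : odd y) (u : Space X) : B.op y (B.op y u) = 0 := by
  have := B.rel y y u
  simp only [Rel, B.br_self y hy, sgn, hy, and_self, if_true, map_zero,
    LinearMap.zero_apply, zero_add, neg_smul, one_smul] at this
  exact self_eq_neg.1 this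

lemma op_cons (x : X) {y : X} {N : List X} (h : Sorted (y :: N)) :
    B.op x (mono (y :: N)) =
      B.opL (B.br x y) (mono N) + sgn x y • B.op y (B.op x (mono N)) := by
  rw [← B.op_mono_of_sorted h]; exact B.rel x y _

section Universal

variable {E : Type*} [AddCommGroup E] [Module ℂ E] (t : X → Module.End ℂ E) (e : E)

/-- The map from words to a module with a highest weight vector `e`. -/
def toModule : Space X →ₗ[ℂ] E :=
  Finsupp.linearCombination ℂ fun w : {M : List X // Sorted M} => w.1.foldr (fun x v => t x v) e

lemma toModule_mono {M : List X} (h : Sorted M) :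
    toModule t e (mono M) = M.foldr (fun x v => t x v) e := by
  simp [toModule, mono_of_sorted h]

lemma toModule_opL {f : X →₀ ℂ} {u : Space X}
    (h : ∀ z, toModule t e (B.op z u) = t z (toModule t e u)) :
    toModule t e (B.opL f u) = Finsupp.linearCombination ℂ t f (toModule t e u) := by
  rw [opL_apply, Finsupp.sum, map_sum, Finsupp.linearCombination_apply, Finsupp.sum,
    LinearMap.sum_apply]
  exact Finset.sum_congr rfl fun z _ => by rw [map_smul, h z, LinearMap.smul_apply]

/-- The module of words is universal among the highest weight modules. -/
theorem toModule_op (hrel : ∀ x y u, t x (t y u) =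
      Finsupp.linearCombination ℂ t (B.br x y) u + sgn x y • t y (t x u))
    (he : ∀ x, ¬ creator x → t x e = B.wt x • e) (x : X) (u : Space X) :
    toModule t e (B.op x u) = t x (toModule t e u) := by
  refine eq_of_forall_support (toModule t e ∘ₗ B.op x) (t x ∘ₗ toModule t e) u fun w _ => ?_
  refine reach_induction (P := fun x M => toModule t e (B.op x (mono M)) =
    t x (toModule t e (mono M))) ?_ ?_ ?_ ?_ w.2 x
  · intro x M h
    rw [B.op_mono_of_sorted h, toModule_mono t e h, toModule_mono t e (sorted_cons.1 h).2,
      List.foldr_cons]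
  · intro x hx
    rw [B.op_vac hx, map_smul, toModule_mono t e sorted_nil, List.foldr_nil, he x hx]
  · intro y N hy h _
    rw [← B.op_mono_of_sorted h, B.op_op_self hy, B.op_mono_of_sorted h, toModule_mono t e h,
      map_zero, List.foldr_cons]
    have := hrel y y (N.foldr (fun x v => t x v) e)
    simp only [B.br_self y hy, sgn, hy, and_self, if_true, map_zero,
      LinearMap.zero_apply, zero_add, neg_smul, one_smul] at this
    have h2 : (2 : ℂ) • t y (t y (N.foldr (fun x v => t x v) e)) = 0 := by
      rw [two_smul]; exact eq_neg_iff_add_eq_zero.1 this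
    exact ((smul_eq_zero.1 h2).resolve_left two_ne_zero).symm
  · intro x y N h h1 h2
    have h3 : toModule t e (B.op y (B.op x (mono N))) = t y (toModule t e (B.op x (mono N))) :=
      eq_of_forall_support (toModule t e ∘ₗ B.op y) (t y ∘ₗ toModule t e) _ fun w hw =>
        h2 w (B.op_mem_reach x (sorted_cons.1 h).2 hw)
    rw [B.op_cons x h, map_add, map_smul, h3, h1, B.toModule_opL t e h1, toModule_mono t e h,
      List.foldr_cons, ← toModule_mono t e (sorted_cons.1 h).2, hrel x y]

end Universal

/-! ### Derivations with constant commutators. -/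

section Derivation

/-- The derivation of the module of words that has constant commutators with the generators. -/
def derWord (δ : X → ℂ) : List X → Space X
  | [] => 0
  | y :: N => B.op y (derWord δ N) + δ y • mono N

def der (δ : X → ℂ) : Module.End ℂ (Space X) :=
  Finsupp.linearCombination ℂ fun w : {M : List X // Sorted M} => B.derWord δ w.1

lemma der_mono (δ : X → ℂ) {M : List X} (h : Sorted M) : B.der δ (mono M) = B.derWord δ M := by
  simp [der, mono_of_sorted h]

lemma der_vac (δ : X → ℂ) : B.der δ (mono []) = 0 := by
  rw [B.der_mono δ sorted_nil, derWord]

theorem der_op {δ : X → ℂ} (h1 : ∀ x, ¬ creator x → δ x = 0) (h2 : ∀ x, odd x → δ x = 0)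
    (h3 : ∀ x y, Finsupp.linearCombination ℂ δ (B.br x y) = 0) (x : X) (u : Space X) :
    B.der δ (B.op x u) = B.op x (B.der δ u) + δ x • u := by
  refine eq_of_forall_support (B.der δ * B.op x) (B.op x * B.der δ + δ x • LinearMap.id) u
    fun w _ => ?_
  refine reach_induction (P := fun x M => B.der δ (B.op x (mono M)) =
    B.op x (B.der δ (mono M)) + δ x • mono M) ?_ ?_ ?_ ?_ w.2 x
  · intro x M h
    rw [B.op_mono_of_sorted h, B.der_mono δ h, B.der_mono δ (sorted_cons.1 h).2, derWord]
  · intro x hx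
    rw [B.op_vac hx, map_smul, der_vac, h1 x hx]
    simp
  · intro y N hy h _
    rw [← B.op_mono_of_sorted h, B.op_op_self hy, B.op_mono_of_sorted h, B.der_mono δ h, derWord,
      h2 y hy]
    simp [B.op_op_self hy]
  · intro x y N h hz hw
    have e1 : B.der δ (B.op y (B.op x (mono N))) =
        B.op y (B.der δ (B.op x (mono N))) + δ y • B.op x (mono N) := by
      have := eq_of_forall_support (B.der δ * B.op y) (B.op y * B.der δ + δ y • LinearMap.id)
        (B.op x (mono N)) fun w hw' => by
          simpa only [Module.End.mul_apply, LinearMap.add_apply, LinearMap.smul_apply,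
            LinearMap.id_apply] using hw w (B.op_mem_reach x (sorted_cons.1 h).2 hw')
      simpa only [Module.End.mul_apply, LinearMap.add_apply, LinearMap.smul_apply,
            LinearMap.id_apply] using this
    -- A commutator must have zero constant under the derivation, which is the condition that `δ`
    -- vanishes on brackets.
    have e2 : B.der δ (B.opL (B.br x y) (mono N)) =
        B.opL (B.br x y) (B.der δ (mono N)) := by
      have e3 := congrArg (fun a => a • mono N) (h3 x y)
      simp only [Finsupp.linearCombination_apply, Finsupp.sum, Finset.sum_smul, zero_smul] at e3
      have e5 : ∑ z ∈ (B.br x y).support, B.br x y z • B.der δ (B.op z (mono N)) =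
          ∑ z ∈ (B.br x y).support, B.br x y z • B.op z (B.der δ (mono N)) +
            ∑ z ∈ (B.br x y).support, (B.br x y z • δ z) • mono N := by
        rw [← Finset.sum_add_distrib]
        refine Finset.sum_congr rfl fun z _ => ?_
        rw [hz z, smul_add, smul_smul, smul_eq_mul]
      rw [e3, add_zero] at e5
      rw [opL_apply, opL_apply, Finsupp.sum, Finsupp.sum, map_sum, ← e5]
      exact Finset.sum_congr rfl fun z _ => map_smul _ _ _
    have e4 : B.op x (B.op y (B.der δ (mono N))) = _ := B.rel x y _
    rw [B.op_cons x h, map_add, map_smul, e1, e2, hz x, B.der_mono δ h, derWord,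
      ← B.der_mono δ (sorted_cons.1 h).2, map_add, map_smul,
      map_add (B.op x), map_smul (B.op x), e4, ← B.op_mono_of_sorted h]
    by_cases ho : odd x ∧ odd y
    · rw [h2 x ho.1, h2 y ho.2]; simp
    · have : sgn x y = 1 := by simp [sgn, ho]
      rw [this]; module

end Derivation

/-! ### Degrees of words and leading parts of the action. -/

section Symbol

variable (deg : X → ℕ)

/-- The degree of a word. -/
def wdeg (M : List X) : ℕ := (M.map deg).sum

omit [PBWIndex X] in
lemma wdeg_cons (x : X) (M : List X) : wdeg deg (x :: M) = deg x + wdeg deg M := by simp [wdeg]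

/-- The span of the words of degree less than `d`. -/
def degLT (d : ℕ) : Submodule ℂ (Space X) := Finsupp.supported ℂ ℂ {w | wdeg deg w.1 < d}

/-- The span of the words of degree `d`. -/
def degEQ (d : ℕ) : Submodule ℂ (Space X) := Finsupp.supported ℂ ℂ {w | wdeg deg w.1 = d}

lemma mono_mem_degEQ (M : List X) : mono M ∈ degEQ deg (wdeg deg M) :=
  mono_mem_supported fun _ => rfl

lemma degLT_mono {d d' : ℕ} (h : d ≤ d') : degLT (X := X) deg d ≤ degLT deg d' :=
  Finsupp.supported_mono fun _ hw => lt_of_lt_of_le hw h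

lemma degEQ_le {d d' : ℕ} (h : d < d') : degEQ (X := X) deg d ≤ degLT deg d' :=
  Finsupp.supported_mono fun _ hw => lt_of_eq_of_lt hw h

/-- `S` is the leading part of `B` with respect to a degree of the generators. -/
structure IsSymbol : Prop where
  le : ∀ x y z, B.br x y z ≠ 0 → deg z ≤ deg x + deg y
  eq : ∀ x y z, deg z = deg x + deg y → S.br x y z = B.br x y z
  ne : ∀ x y z, deg z ≠ deg x + deg y → S.br x y z = 0
  wt_zero : ∀ x, deg x = 0 → S.wt x = B.wt x
  wt_pos : ∀ x, deg x ≠ 0 → S.wt x = 0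

-- Top-degree parts compose: a term below the maximal degree on the inner level cannot reach the
-- maximal total degree. This makes the leading part of a bracket satisfy the Jacobi identity.
omit [PBWIndex X] in
lemma filter_linearCombination_br {f : X → X →₀ ℂ} {e : X →₀ ℂ} {D d : ℕ}
    (h1 : ∀ w, e w ≠ 0 → deg w ≤ d) (h2 : ∀ w z, f w z ≠ 0 → deg z ≤ D + deg w) :
    (Finsupp.linearCombination ℂ f e).filter (fun z => deg z = D + d) =
      Finsupp.linearCombination ℂ (fun w => (f w).filter fun z => deg z = D + deg w)
        (e.filter fun w => deg w = d) := by
  ext z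
  rw [Finsupp.linearCombination_apply, Finsupp.linearCombination_apply,
    Finsupp.sum_of_support_subset (e.filter fun w => deg w = d) (s := e.support)
      (by simp [Finsupp.support_filter]) _ (by simp), Finsupp.filter_apply]
  simp only [Finsupp.sum, Finsupp.finsetSum_apply, Finsupp.smul_apply, Finsupp.filter_apply,
    smul_eq_mul]
  split_ifs with hz
  · refine Finset.sum_congr rfl fun w hw => ?_
    by_cases hd : deg w = d
    · simp [hd, hz]
    · have h3 := h1 w (Finsupp.mem_support_iff.1 hw)
      have h4 : f w z = 0 := by
        by_contra h
        have := h2 w z h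
        omega
      simp [h4]
  · refine (Finset.sum_eq_zero fun w hw => ?_).symm
    by_cases hd : deg w = d
    · simp [hd, hz]
    · simp [hd]

/-- The leading part of a bracket with respect to a degree of the generators. -/
def symbol (hle : ∀ x y z, B.br x y z ≠ 0 → deg z ≤ deg x + deg y) : Bracket X where
  br x y := (B.br x y).filter fun z => deg z = deg x + deg y
  wt x := if deg x = 0 then B.wt x else 0
  symm x y := by
    rw [B.symm x y, ← Finsupp.filter_smul, add_comm (deg x)]
  jacobi x y z := by
    have hsymm : ∀ v w z, B.br w v z ≠ 0 → deg z ≤ deg v + deg w := fun v w z h => by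
      rw [add_comm]; exact hle w v z h
    have e1 := filter_linearCombination_br deg (f := B.br x) (e := B.br y z) (hle y z) (hle x)
    have e2 := filter_linearCombination_br deg (f := fun w => B.br w z) (e := B.br x y) (hle x y)
      (hsymm z)
    have e3 := filter_linearCombination_br deg (f := B.br y) (e := B.br x z) (hle x z) (hle y)
    -- The Jacobi identity of the leading part is the component of the original one in the maximal
    -- possible degree.
    have e4 := congrArg (Finsupp.filter fun w => deg w = deg x + (deg y + deg z)) (B.jacobi x y z)
    rw [Finsupp.filter_add, Finsupp.filter_smul, e1, add_left_comm, e3, add_left_comm (deg y),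
      ← add_assoc, add_comm (_ + _), e2] at e4
    simpa only [add_comm (deg z)] using e4
  sgn_br x y z w h := B.sgn_br x y z w fun h' => h (by simp [Finsupp.filter_apply, h'])
  br_self x hx := by rw [B.br_self x hx, Finsupp.filter_zero]
  wt_odd x hx := by rw [B.wt_odd x hx, ite_self]
  creator_br x y z hx hy h := B.creator_br x y z hx hy fun h' => h (by
    simp [Finsupp.filter_apply, h'])
  wt_br x y hx hy := by
    rw [Finsupp.linearCombination_apply,
      Finsupp.sum_of_support_subset (s := (B.br x y).support) _
        (by simp [Finsupp.support_filter]) _ (by simp)]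
    by_cases hd : deg x + deg y = 0
    · rw [← B.wt_br x y hx hy, Finsupp.linearCombination_apply]
      refine Finset.sum_congr rfl fun z hz => ?_
      have := hle x y z (Finsupp.mem_support_iff.1 hz)
      simp [show deg z = 0 by omega, show deg x = 0 by omega,
        show deg y = 0 by omega]
    · refine Finset.sum_eq_zero fun z _ => ?_
      by_cases hz : deg z = deg x + deg y
      · simp [show deg z ≠ 0 by omega]
      · simp [hz]

lemma isSymbol_symbol (hle : ∀ x y z, B.br x y z ≠ 0 → deg z ≤ deg x + deg y) :
    IsSymbol B (B.symbol deg hle) deg where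
  le := hle
  eq x y z h := by simp [symbol, h]
  ne x y z h := by simp [symbol, h]
  wt_zero x h := by simp [symbol, h]
  wt_pos x h := by simp [symbol, h]

variable {B S deg}

/-- Both actions follow the same recursion, and at each step the brackets differ only by terms of
lower degree. The two assertions are proved together because the recursion feeds the exactly graded
action back into the estimate. -/
theorem IsSymbol.op_sub (h : IsSymbol B S deg) {M : List X} (hM : Sorted M) (x : X) :
    B.op x (mono M) - S.op x (mono M) ∈ degLT deg (deg x + wdeg deg M) ∧
      S.op x (mono M) ∈ degEQ deg (deg x + wdeg deg M) := by
  refine reach_induction (P := fun x M => B.op x (mono M) - S.op x (mono M) ∈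
    degLT deg (deg x + wdeg deg M) ∧ S.op x (mono M) ∈ degEQ deg (deg x + wdeg deg M))
    ?_ ?_ ?_ ?_ hM x
  · intro x M hx
    rw [B.op_mono_of_sorted hx, S.op_mono_of_sorted hx, sub_self]
    exact ⟨zero_mem _, mono_mem_supported fun _ => wdeg_cons deg x M⟩
  · intro x hx
    rw [B.op_vac hx, S.op_vac hx]
    by_cases hd : deg x = 0
    · rw [h.wt_zero x hd, sub_self]
      exact ⟨zero_mem _, Submodule.smul_mem _ _ (mono_mem_supported fun _ => by simp [hd, wdeg])⟩
    · rw [h.wt_pos x hd, zero_smul, sub_zero]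
      exact ⟨Submodule.smul_mem _ _ (mono_mem_supported fun _ => by
        simpa [wdeg] using Nat.pos_of_ne_zero hd), zero_mem _⟩
  · intro y N hy hs _
    rw [← B.op_mono_of_sorted hs, B.op_op_self hy, B.op_mono_of_sorted hs,
      ← S.op_mono_of_sorted hs, S.op_op_self hy, sub_zero]
    exact ⟨zero_mem _, zero_mem _⟩
  · intro x y N hs hz hw
    have hN := (sorted_cons.1 hs).2
    rw [B.op_cons x hs, S.op_cons x hs, wdeg_cons]
    have hB : ∀ w ∈ reach x N, B.op y (mono w.1) ∈ degLT deg (deg y + wdeg deg w.1 + 1) := by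
      intro w hw'
      rw [← sub_add_cancel (B.op y (mono w.1)) (S.op y (mono w.1))]
      exact add_mem (degLT_mono deg (by omega) (hw w hw').1) (degEQ_le deg (by omega) (hw w hw').2)
    have hsub : B.op x (mono N) - S.op x (mono N) ∈ Finsupp.supported ℂ ℂ (reach x N) :=
      sub_mem (fun w hw => B.op_mem_reach x hN hw) (fun w hw => S.op_mem_reach x hN hw)
    have d1 : B.opL (B.br x y) (mono N) - S.opL (S.br x y) (mono N) ∈
        degLT deg (deg x + (deg y + wdeg deg N)) := by
      have e : S.opL (S.br x y) (mono N) =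
          ∑ z ∈ (B.br x y).support, S.br x y z • S.op z (mono N) := by
        rw [opL_apply]
        refine Finsupp.sum_of_support_subset _ (fun z hz => ?_) _ (by simp)
        rw [Finsupp.mem_support_iff] at hz ⊢
        by_cases hd : deg z = deg x + deg y
        · rwa [← h.eq x y z hd]
        · exact absurd (h.ne x y z hd) hz
      rw [e, opL_apply, Finsupp.sum, ← Finset.sum_sub_distrib]
      refine Submodule.sum_mem _ fun z hz' => ?_
      have hle := h.le x y z (Finsupp.mem_support_iff.1 hz')
      by_cases hd : deg z = deg x + deg y
      · rw [h.eq x y z hd, ← smul_sub]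
        exact Submodule.smul_mem _ _ (degLT_mono deg (by omega) (hz z).1)
      · rw [h.ne x y z hd, zero_smul, sub_zero]
        refine Submodule.smul_mem _ _ ?_
        rw [← sub_add_cancel (B.op z (mono N)) (S.op z (mono N))]
        exact add_mem (degLT_mono deg (by omega) (hz z).1) (degEQ_le deg (by omega) (hz z).2)
    have d2 : S.opL (S.br x y) (mono N) ∈ degEQ deg (deg x + (deg y + wdeg deg N)) := by
      rw [opL_apply]
      refine Submodule.sum_mem _ fun z hz' => Submodule.smul_mem _ _ ?_
      have hd : deg z = deg x + deg y := by
        by_contra hd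
        exact (Finsupp.mem_support_iff.1 hz') (h.ne x y z hd)
      have := (hz z).2
      rwa [hd, add_assoc] at this
    have d3 : B.op y (B.op x (mono N) - S.op x (mono N)) ∈
        degLT deg (deg x + (deg y + wdeg deg N)) := by
      refine map_mem_of_forall_support _ _ _ fun w hw' => ?_
      have := (hz x).1 hw'
      simp only [Set.mem_ofPred_eq] at this
      exact degLT_mono deg (by omega) (hB w (hsub hw'))
    have d4 : B.op y (S.op x (mono N)) - S.op y (S.op x (mono N)) ∈
        degLT deg (deg x + (deg y + wdeg deg N)) := by
      refine map_mem_of_forall_support (B.op y - S.op y) _ _ fun w hw' => ?_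
      have := (hz x).2 hw'
      simp only [Set.mem_ofPred_eq] at this
      exact degLT_mono deg (by omega) (hw w (S.op_mem_reach x hN hw')).1
    have d5 : S.op y (S.op x (mono N)) ∈ degEQ deg (deg x + (deg y + wdeg deg N)) := by
      refine map_mem_of_forall_support _ _ _ fun w hw' => ?_
      have := (hz x).2 hw'
      simp only [Set.mem_ofPred_eq] at this
      have h' := (hw w (S.op_mem_reach x hN hw')).2
      rwa [this, ← add_assoc, add_comm (deg y), add_assoc] at h'
    refine ⟨?_, add_mem d2 (Submodule.smul_mem _ _ d5)⟩
    have e : B.opL (B.br x y) (mono N) + sgn x y • B.op y (B.op x (mono N)) -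
        (S.opL (S.br x y) (mono N) + sgn x y • S.op y (S.op x (mono N))) =
        (B.opL (B.br x y) (mono N) - S.opL (S.br x y) (mono N)) +
        sgn x y • (B.op y (B.op x (mono N) - S.op x (mono N)) +
          (B.op y (S.op x (mono N)) - S.op y (S.op x (mono N)))) := by
      rw [map_sub]; module
    rw [e]
    exact add_mem d1 (Submodule.smul_mem _ _ (add_mem d3 d4))

variable (deg) in
/-- The part of degree `d` of a vector. -/
def degPart (d : ℕ) : Module.End ℂ (Space X) where
  toFun u := u.filter fun w => wdeg deg w.1 = d
  map_add' _ _ := Finsupp.filter_add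
  map_smul' _ _ := Finsupp.filter_smul

lemma degPart_apply (d : ℕ) (u : Space X) (w : {M : List X // Sorted M}) :
    degPart deg d u w = if wdeg deg w.1 = d then u w else 0 :=
  Finsupp.filter_apply _ _ _

lemma degPart_of_degEQ {d : ℕ} {u : Space X} (hu : u ∈ degEQ deg d) : degPart deg d u = u :=
  (Finsupp.filter_eq_self_iff _ _).2 fun w hw => hu (by simpa using hw)

lemma degPart_of_degLT {d : ℕ} {u : Space X} (hu : u ∈ degLT deg d) : degPart deg d u = 0 :=
  (Finsupp.filter_eq_zero_iff _ _).2 fun w hw => by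
    by_contra h
    have h1 : wdeg deg w.1 < d := hu (by simpa using h)
    omega

/-- The leading part of a vector that is annihilated by a generator is annihilated by the leading
part of the generator. -/
theorem IsSymbol.op_degPart (h : IsSymbol B S deg) {d : ℕ} {u : Space X}
    (hu : u ∈ degLT deg (d + 1)) {x : X} (hx : B.op x u = 0) :
    S.op x (degPart deg d u) = 0 := by
  -- In degree `deg x + d` only the words of `u` of top degree `d` contribute, and only through the
  -- leading part of `x`.
  have key : degPart deg (deg x + d) (B.op x u) = S.op x (degPart deg d u) := by
    refine eq_of_forall_support (degPart deg (deg x + d) * B.op x) (S.op x * degPart deg d) u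
      fun w hw => ?_
    have hw' : wdeg deg w.1 < d + 1 := hu hw
    obtain ⟨h1, h2⟩ := h.op_sub w.2 x
    simp only [Module.End.mul_apply]
    rw [← sub_add_cancel (B.op x (mono w.1)) (S.op x (mono w.1)), map_add]
    rcases Nat.lt_succ_iff_lt_or_eq.1 hw' with hlt | heq
    · rw [degPart_of_degLT (degLT_mono deg (by omega) h1),
        degPart_of_degLT (degEQ_le deg (by omega) h2),
        degPart_of_degLT (mono_mem_supported fun _ => hlt), map_zero, add_zero]
    · subst heq
      rw [degPart_of_degLT h1, degPart_of_degEQ h2,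
        degPart_of_degEQ (mono_mem_degEQ deg w.1), zero_add]
  rw [← key, hx, map_zero]

end Symbol

end Bracket
end PBWIndex
end

/-! ### The topological algebra, its degree and its leading part. -/

noncomputable section

set_option linter.unusedSimpArgs false
set_option linter.unusedTactic false
set_option linter.unreachableTactic false

namespace TopGen

/-- A code for the generators, injective and ordered as needed for the ordered words. -/
def key : TopGen → ℕ ×ₗ ℤ
  -- `L₋₁` precedes everything and the `H` follow immediately. So prefixing `L₋₁` to a word keeps it
  -- ordered, and the letters in front of any `H` commute with all `H` creators in the leading part.
  | L m => toLex (if m = -1 then 0 else 2, m)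
  | H m => toLex (1, m)
  | G m => toLex (3, m)
  | Q m => toLex (4, m)
  | C => toLex (5, 0)

lemma key_injective : Function.Injective key := by
  intro x y h
  cases x <;> cases y <;> simp only [key, toLex_inj, Prod.mk.injEq] at h <;> (try split_ifs at h) <;>
    simp_all

instance : PBWIndex TopGen where
  __ := LinearOrder.lift' key key_injective
  odd
    | G _ => True
    | Q _ => True
    | _ => False
  creator
    | L m => m < 0
    | H m => m < 0
    | G m => m < 0
    | Q m => m < 0
    | C => False

lemma le_iff_key (x y : TopGen) : x ≤ y ↔ key x ≤ key y := Iff.rfl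

open PBWIndex

@[simp] lemma odd_L (m : ℤ) : odd (L m) ↔ False := Iff.rfl
@[simp] lemma odd_H (m : ℤ) : odd (H m) ↔ False := Iff.rfl
@[simp] lemma odd_G (m : ℤ) : odd (G m) ↔ True := Iff.rfl
@[simp] lemma odd_Q (m : ℤ) : odd (Q m) ↔ True := Iff.rfl
@[simp] lemma odd_C : odd C ↔ False := Iff.rfl
@[simp] lemma creator_L (m : ℤ) : creator (L m) ↔ m < 0 := Iff.rfl
@[simp] lemma creator_H (m : ℤ) : creator (H m) ↔ m < 0 := Iff.rfl
@[simp] lemma creator_G (m : ℤ) : creator (G m) ↔ m < 0 := Iff.rfl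
@[simp] lemma creator_Q (m : ℤ) : creator (Q m) ↔ m < 0 := Iff.rfl
@[simp] lemma creator_C : creator C ↔ False := Iff.rfl

/-- The structure constants of the topological `N = 2` algebra. -/
def bracket : TopGen → TopGen → TopGen →₀ ℂ
  | L m, L n => ((m : ℂ) - n) • Finsupp.single (L (m + n)) 1
  | L m, H n => (-(n : ℂ)) • Finsupp.single (H (m + n)) 1
      + (if m + n = 0 then ((m : ℂ) ^ 2 + m) / 6 else 0) • Finsupp.single C 1
  | L m, G n => ((m : ℂ) - n) • Finsupp.single (G (m + n)) 1
  | L m, Q n => (-(n : ℂ)) • Finsupp.single (Q (m + n)) 1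
  | H m, L n => (m : ℂ) • Finsupp.single (H (m + n)) 1
      - (if m + n = 0 then ((n : ℂ) ^ 2 + n) / 6 else 0) • Finsupp.single C 1
  | H m, H n => (if m + n = 0 then (m : ℂ) / 3 else 0) • Finsupp.single C 1
  | H m, G n => Finsupp.single (G (m + n)) 1
  | H m, Q n => -Finsupp.single (Q (m + n)) 1
  | G m, L n => ((m : ℂ) - n) • Finsupp.single (G (m + n)) 1
  | G m, H n => -Finsupp.single (G (m + n)) 1
  | G m, Q n => (2 : ℂ) • Finsupp.single (L (m + n)) 1 - (2 * (n : ℂ)) • Finsupp.single (H (m + n)) 1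
      + (if m + n = 0 then ((m : ℂ) ^ 2 + m) / 3 else 0) • Finsupp.single C 1
  | Q m, L n => (m : ℂ) • Finsupp.single (Q (m + n)) 1
  | Q m, H n => Finsupp.single (Q (m + n)) 1
  | Q m, G n => (2 : ℂ) • Finsupp.single (L (m + n)) 1 - (2 * (m : ℂ)) • Finsupp.single (H (m + n)) 1
      + (if m + n = 0 then ((n : ℂ) ^ 2 + n) / 3 else 0) • Finsupp.single C 1
  | _, _ => 0

lemma bracket_symm (x y : TopGen) : bracket y x = -sgn x y • bracket x y := by
  rcases x with m | m | m | m | _ <;> rcases y with n | n | n | n | _ <;>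
    simp only [bracket, sgn, odd_L, odd_H, odd_G, odd_Q, odd_C, and_self, and_true,
      if_true, if_false, and_false, Int.add_comm, smul_zero] <;>
    first
    | module
    | (split_ifs with h
       · obtain rfl : n = -m := by omega
         push_cast
         module
       · module)

lemma bracket_jacobi (x y z : TopGen) :
    Finsupp.linearCombination ℂ (bracket x) (bracket y z) =
      Finsupp.linearCombination ℂ (fun w => bracket w z) (bracket x y) +
        sgn x y • Finsupp.linearCombination ℂ (bracket y) (bracket x z) := by
  rcases x with m | m | m | m | _ <;> rcases y with n | n | n | n | _ <;>
  rcases z with k | k | k | k | _ <;>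
    simp only [bracket, sgn, odd_L, odd_H, odd_G, odd_Q, odd_C, and_self, and_true,
      if_true, if_false, and_false, smul_zero, map_add, map_sub, map_smul, map_neg,
      map_zero, Finsupp.linearCombination_single, one_smul, add_zero, zero_add, sub_zero,
      Int.add_comm, Int.add_left_comm] <;>
    first
    | (push_cast; module)
    | (split_ifs with h
       · obtain rfl : k = -m - n := by omega
         push_cast
         module
       · push_cast
         module)

lemma odd_bracket (y z w : TopGen) (h : bracket y z w ≠ 0) : odd w ↔ ¬ (odd y ↔ odd z) := by
  rcases y with m | m | m | m | _ <;> rcases z with n | n | n | n | _ <;>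
  rcases w with k | k | k | k | _ <;> simp only [bracket, Finsupp.add_apply, Finsupp.sub_apply, Finsupp.neg_apply, Finsupp.smul_apply,
      Finsupp.single_apply, Finsupp.zero_apply, smul_eq_mul, reduceCtorEq, if_false, mul_zero, add_zero,
      sub_zero, zero_add, sub_self, neg_zero, ne_eq, not_true_eq_false, L.injEq, H.injEq, G.injEq, Q.injEq,
      mul_ite, mul_one, if_true, ite_eq_right_iff, not_forall] at h <;> simp

lemma sgn_bracket (x y z w : TopGen) (h : bracket y z w ≠ 0) : sgn x w = sgn x y * sgn x z := by
  have := odd_bracket y z w h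
  by_cases hx : odd x <;> by_cases hy : odd y <;> by_cases hz : odd z <;> by_cases hw : odd w <;>
    simp_all [sgn]

/-- The weights of the highest weight vector. -/
def weight (q c : ℂ) : TopGen → ℂ
  | H m => if m = 0 then q else 0
  | C => c
  | _ => 0

/-- The topological `N = 2` algebra with the highest weight conditions of the chiral Verma
module. -/
def verma (q c : ℂ) : Bracket TopGen where
  br := bracket
  wt := weight q c
  symm := bracket_symm
  jacobi := bracket_jacobi
  sgn_br := sgn_bracket
  br_self x hx := by cases x <;> simp_all [bracket]
  wt_odd x hx := by cases x <;> simp_all [weight]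
  creator_br x y z hx hy h := by
    rcases x with m | m | m | m | _ <;> rcases y with n | n | n | n | _ <;>
    rcases z with k | k | k | k | _ <;> simp only [bracket, Finsupp.add_apply, Finsupp.sub_apply, Finsupp.neg_apply, Finsupp.smul_apply,
      Finsupp.single_apply, Finsupp.zero_apply, smul_eq_mul, reduceCtorEq, if_false, mul_zero, add_zero,
      sub_zero, zero_add, sub_self, neg_zero, ne_eq, not_true_eq_false, L.injEq, H.injEq, G.injEq, Q.injEq,
      mul_ite, mul_one, if_true, ite_eq_right_iff, not_forall] at h <;>
    simp only [creator_L, creator_H, creator_G, creator_Q, creator_C] at hx hy ⊢ <;> (first | omega | grind)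
  wt_br x y hx hy := by
    rcases x with m | m | m | m | _ <;> rcases y with n | n | n | n | _ <;>
      simp only [bracket, map_add, map_sub, map_smul, map_neg, map_zero, weight,
        Finsupp.linearCombination_single, creator_L, creator_H, creator_G, creator_Q] at hx hy ⊢ <;>
    first
    | (simp; done)
    | (by_cases h : m + n = 0
       · obtain rfl : m = 0 := by omega
         obtain rfl : n = 0 := by omega
         simp
       · simp [h])

/-- A degree of the generators; the leading part of the algebra is a Heisenberg algebra acting on a
Clifford algebra. -/
def degree : TopGen → ℕ
  -- The value 2 lets `[L_m, L_n]` and `{G_m, Q_n}` keep exactly their `L₋₁` terms; degree 0 for `H`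
  -- and `C` keeps the Heisenberg relations and the action on `G` and `Q`.
  | L m => if m = -1 then 2 else 1
  | G _ => 1
  | Q _ => 1
  | H _ => 0
  | C => 0

lemma degree_bracket (x y z : TopGen) (h : bracket x y z ≠ 0) :
    degree z ≤ degree x + degree y := by
  rcases x with m | m | m | m | _ <;> rcases y with n | n | n | n | _ <;>
  rcases z with k | k | k | k | _ <;> simp only [bracket, Finsupp.add_apply, Finsupp.sub_apply, Finsupp.neg_apply, Finsupp.smul_apply,
      Finsupp.single_apply, Finsupp.zero_apply, smul_eq_mul, reduceCtorEq, if_false, mul_zero, add_zero,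
      sub_zero, zero_add, sub_self, neg_zero, ne_eq, not_true_eq_false, L.injEq, H.injEq, G.injEq, Q.injEq,
      mul_ite, mul_one, if_true, ite_eq_right_iff, not_forall] at h <;> simp only [degree] <;>
    (try split_ifs) <;> (first | omega | grind)

/-- The leading part of the topological `N = 2` algebra. -/
def symb (q c : ℂ) : Bracket TopGen := (verma q c).symbol degree degree_bracket

lemma isSymbol (q c : ℂ) : (verma q c).IsSymbol (symb q c) degree :=
  Bracket.isSymbol_symbol _ _ _

lemma symb_br (q c : ℂ) (x y : TopGen) : (symb q c).br x y =
    (bracket x y).filter fun z => degree z = degree x + degree y := rfl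

lemma filter_single (p : TopGen → Prop) [DecidablePred p] (x : TopGen) (a : ℂ) :
    (Finsupp.single x a).filter p = if p x then Finsupp.single x a else 0 := by
  split_ifs with h
  · exact Finsupp.filter_single_of_pos _ h
  · exact Finsupp.filter_single_of_neg _ h

section Relations

variable (q c : ℂ)

/-- The operators of the leading part. -/
def sop (x : TopGen) : Module.End ℂ (Space TopGen) := (symb q c).op x

variable {q c}

lemma sop_rel {x y : TopGen} {e : TopGen →₀ ℂ} (h : (symb q c).br x y = e) (u : Space TopGen) :
    sop q c x (sop q c y u) =
      (symb q c).opL e u + sgn x y • sop q c y (sop q c x u) := by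
  subst h; exact (symb q c).rel x y u

lemma sop_comm {x y : TopGen} (h : (symb q c).br x y = 0) (h' : ¬ (odd x ∧ odd y))
    (u : Space TopGen) : sop q c x (sop q c y u) = sop q c y (sop q c x u) := by
  rw [sop_rel h, map_zero, LinearMap.zero_apply, zero_add, sgn, if_neg h', one_smul]

/-- All brackets with `L₋₁` have degree strictly below `2 + deg y`, so they disappear in the leading
part. -/
lemma L_neg_one_comm (y : TopGen) (u : Space TopGen) :
    sop q c (L (-1)) (sop q c y u) = sop q c y (sop q c (L (-1)) u) := by
  refine sop_comm ?_ (by simp) u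
  rw [symb_br]
  cases y <;> simp only [bracket, Finsupp.filter_add, Finsupp.filter_sub, Finsupp.filter_smul, Finsupp.filter_neg,
    Finsupp.filter_zero, filter_single] <;> simp only [degree] <;>
    split_ifs <;> first | omega | simp

lemma LL {m n : ℤ} (hm : m ≠ -1) (hn : n ≠ -1) (u : Space TopGen) :
    sop q c (L m) (sop q c (L n) u) =
      (if m + n = -1 then ((m : ℂ) - n) else 0) • sop q c (L (-1)) u +
        sop q c (L n) (sop q c (L m) u) := by
  have h : (symb q c).br (L m) (L n) =
      Finsupp.single (L (-1)) (if m + n = -1 then ((m : ℂ) - n) else 0) := by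
    rw [symb_br]
    simp only [bracket, Finsupp.filter_add, Finsupp.filter_sub, Finsupp.filter_smul, Finsupp.filter_neg,
    Finsupp.filter_zero, filter_single]
    by_cases h : m + n = -1 <;> simp [degree, hm, hn, h]
  rw [sop_rel h, Bracket.opL_single, LinearMap.smul_apply]
  simp [sgn, sop]

lemma LH (m n : ℤ) (u : Space TopGen) :
    sop q c (L m) (sop q c (H n) u) = sop q c (H n) (sop q c (L m) u) := by
  refine sop_comm ?_ (by simp) u
  rw [symb_br]
  simp only [bracket, Finsupp.filter_add, Finsupp.filter_sub, Finsupp.filter_smul, Finsupp.filter_neg,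
    Finsupp.filter_zero, filter_single]
  simp only [degree]
  split_ifs <;> first | omega | simp

lemma LG (m n : ℤ) (u : Space TopGen) :
    sop q c (L m) (sop q c (G n) u) = sop q c (G n) (sop q c (L m) u) := by
  refine sop_comm ?_ (by simp) u
  rw [symb_br]
  simp only [bracket, Finsupp.filter_add, Finsupp.filter_sub, Finsupp.filter_smul, Finsupp.filter_neg,
    Finsupp.filter_zero, filter_single]
  simp only [degree]
  split_ifs <;> first | omega | simp

lemma LQ (m n : ℤ) (u : Space TopGen) :
    sop q c (L m) (sop q c (Q n) u) = sop q c (Q n) (sop q c (L m) u) := by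
  refine sop_comm ?_ (by simp) u
  rw [symb_br]
  simp only [bracket, Finsupp.filter_add, Finsupp.filter_sub, Finsupp.filter_smul, Finsupp.filter_neg,
    Finsupp.filter_zero, filter_single]
  simp only [degree]
  split_ifs <;> first | omega | simp

lemma sop_C (u : Space TopGen) : sop q c C u = c • u := by
  refine eq_of_forall_support (sop q c C) (c • LinearMap.id) u fun w _ => ?_
  have : ∀ M, Sorted M → sop q c C (mono M) = c • mono M := by
    intro M
    induction M with
    | nil =>
      intro _
      rw [sop, (symb q c).op_vac (by simp)]
      simp [symb, Bracket.symbol, degree, verma, weight]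
    | cons y N ih =>
      intro h
      have h1 : sop q c y (mono N) = mono (y :: N) := (symb q c).op_mono_of_sorted h
      rw [← h1, sop_comm _ (by simp), ih (sorted_cons.1 h).2, map_smul]
      rw [symb_br]; cases y <;> exact Finsupp.filter_zero _
  exact this w.1 w.2

lemma HH (m n : ℤ) (u : Space TopGen) :
    sop q c (H m) (sop q c (H n) u) =
      (if m + n = 0 then (m : ℂ) * c / 3 else 0) • u + sop q c (H n) (sop q c (H m) u) := by
  have h : (symb q c).br (H m) (H n) =
      Finsupp.single C (if m + n = 0 then (m : ℂ) / 3 else 0) := by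
    rw [symb_br]
    simp only [bracket, Finsupp.filter_add, Finsupp.filter_sub, Finsupp.filter_smul, Finsupp.filter_neg,
    Finsupp.filter_zero, filter_single]
    split_ifs <;> simp_all [degree]
  rw [sop_rel h, Bracket.opL_single, LinearMap.smul_apply, ← sop, sop_C, smul_smul]
  simp only [sgn, odd_H, and_self, if_false, one_smul]
  split_ifs <;> congr 2 <;> ring

lemma HG (m n : ℤ) (u : Space TopGen) :
    sop q c (H m) (sop q c (G n) u) = sop q c (G (m + n)) u + sop q c (G n) (sop q c (H m) u) := by
  have h : (symb q c).br (H m) (G n) = Finsupp.single (G (m + n)) 1 := by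
    rw [symb_br]
    simp only [bracket, Finsupp.filter_add, Finsupp.filter_sub, Finsupp.filter_smul, Finsupp.filter_neg,
    Finsupp.filter_zero, filter_single]
    simp [degree]
  rw [sop_rel h, Bracket.opL_single, LinearMap.smul_apply]
  simp [sgn, sop]

lemma HQ (m n : ℤ) (u : Space TopGen) :
    sop q c (H m) (sop q c (Q n) u) = -sop q c (Q (m + n)) u + sop q c (Q n) (sop q c (H m) u) := by
  have h : (symb q c).br (H m) (Q n) = Finsupp.single (Q (m + n)) (-1) := by
    rw [symb_br]
    simp only [bracket, Finsupp.filter_add, Finsupp.filter_sub, Finsupp.filter_smul, Finsupp.filter_neg,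
    Finsupp.filter_zero, filter_single]
    simp [degree]
  rw [sop_rel h, Bracket.opL_single, LinearMap.smul_apply]
  simp [sgn, sop]

lemma GQ (m n : ℤ) (u : Space TopGen) :
    sop q c (G m) (sop q c (Q n) u) =
      (if m + n = -1 then (2 : ℂ) else 0) • sop q c (L (-1)) u -
        sop q c (Q n) (sop q c (G m) u) := by
  have h : (symb q c).br (G m) (Q n) =
      Finsupp.single (L (-1)) (if m + n = -1 then (2 : ℂ) else 0) := by
    rw [symb_br]
    simp only [bracket, Finsupp.filter_add, Finsupp.filter_sub, Finsupp.filter_smul, Finsupp.filter_neg,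
    Finsupp.filter_zero, filter_single]
    by_cases h : m + n = -1 <;> simp [degree, h]
  rw [sop_rel h, Bracket.opL_single, LinearMap.smul_apply]
  simp [sgn, sop, sub_eq_add_neg]

lemma GG (m n : ℤ) (u : Space TopGen) :
    sop q c (G m) (sop q c (G n) u) = -sop q c (G n) (sop q c (G m) u) := by
  have h : (symb q c).br (G m) (G n) = 0 := by
    rw [symb_br]
    exact Finsupp.filter_zero _
  rw [sop_rel h]
  simp [sgn]

lemma QQ (m n : ℤ) (u : Space TopGen) :
    sop q c (Q m) (sop q c (Q n) u) = -sop q c (Q n) (sop q c (Q m) u) := by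
  have h : (symb q c).br (Q m) (Q n) = 0 := by
    rw [symb_br]
    exact Finsupp.filter_zero _
  rw [sop_rel h]
  simp [sgn]

lemma sop_vac {x : TopGen} (hx : ¬ creator x) (h : ∀ m, x ≠ H m) (hC : x ≠ C) :
    sop q c x (mono []) = 0 := by
  rw [sop, (symb q c).op_vac hx]
  cases x <;> simp_all [symb, Bracket.symbol, verma, weight]

lemma H_vac {k : ℤ} (hk : 0 < k) : sop q c (H k) (mono []) = 0 := by
  rw [sop, (symb q c).op_vac (by simpa using hk.le)]
  simp [symb, Bracket.symbol, verma, weight, hk.ne']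

end Relations

end TopGen
end

/-! ### Number operators and annihilated vectors of the leading part. -/

noncomputable section

namespace TopGen

open PBWIndex

variable {q c : ℂ}

/-- The functional that picks the coefficient of `H (-j)`. -/
def coeffH (j : ℕ) : TopGen → ℂ
  | H m => if m = -(j : ℤ) then 1 else 0
  | _ => 0

/-- Differentiation with respect to `H (-j)`. -/
def derH (q c : ℂ) (j : ℕ) : Module.End ℂ (Space TopGen) := (symb q c).der (coeffH j)

/-- No bracket of the leading part has an `H` component, so the coefficient functional of `H (-j)`
kills all brackets and defines a derivation. -/
lemma derH_op {j : ℕ} (hj : 1 ≤ j) (x : TopGen) (u : Space TopGen) :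
    derH q c j (sop q c x u) = sop q c x (derH q c j u) + coeffH j x • u := by
  refine (symb q c).der_op ?_ ?_ ?_ x u
  · intro x hx
    cases x <;> simp [coeffH] at hx ⊢
    omega
  · intro x hx
    cases x <;> simp [coeffH] at hx ⊢
  · intro x y
    rw [Finsupp.linearCombination_apply]
    refine Finset.sum_eq_zero fun z _ => ?_
    cases z with
    | H m =>
      have : (symb q c).br x y (H m) = 0 := by
        rw [symb_br, Finsupp.filter_apply]
        split_ifs with h
        · rcases x with k | k | k | k | _ <;> rcases y with l | l | l | l | _ <;>
            simp only [degree, bracket, Finsupp.add_apply, Finsupp.sub_apply,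
              Finsupp.smul_apply, Finsupp.single_apply, Finsupp.zero_apply, smul_eq_mul,
              reduceCtorEq, if_false, mul_zero, add_zero, sub_zero] at h ⊢ <;>
            split_ifs at h
        · rfl
      simp [this]
    | _ => simp [coeffH]

lemma derH_vac (j : ℕ) : derH q c j (mono []) = 0 := (symb q c).der_vac _

lemma sop_mono {x : TopGen} {M : List TopGen} (h : Sorted (x :: M)) :
    sop q c x (mono M) = mono (x :: M) := (symb q c).op_mono_of_sorted h

lemma derH_mono_eq_zero {j : ℕ} (hj : 1 ≤ j) {M : List TopGen} (hM : Sorted M)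
    (h : H (-j) ∉ M) : derH q c j (mono M) = 0 := by
  induction M with
  | nil => exact derH_vac j
  | cons y N ih =>
    rw [← sop_mono (q := q) (c := c) hM, derH_op hj, ih (sorted_cons.1 hM).2 (fun h' => h (by simp [h'])), map_zero,
      zero_add]
    cases y with
    | H m =>
      have : m ≠ -(j : ℤ) := fun h' => h (by simp [h'])
      simp [coeffH, this]
    | _ => simp [coeffH]

lemma not_mem_H_of_sorted {y : TopGen} {N : List TopGen} (h : Sorted (y :: N))
    (h1 : y ≠ L (-1)) (h2 : ∀ m, y ≠ H m) (m : ℤ) : H m ∉ N := by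
  intro hm
  have hle : key y ≤ key (H m) := by
    rcases (sorted_cons.1 h).1.2 _ hm with h' | ⟨h', -⟩
    · exact (le_iff_key _ _).1 h'.le
    · exact absurd h' (h2 m)
  cases y with
  | L k =>
    have : k ≠ -1 := fun h => h1 (by rw [h])
    simp [key, this, Prod.Lex.le_iff] at hle
  | H k => exact h2 k rfl
  | G k => simp [key, Prod.Lex.le_iff] at hle
  | Q k => simp [key, Prod.Lex.le_iff] at hle
  | C => simp [key, Prod.Lex.le_iff] at hle

/-- Multiplication after differentiation is the number operator of the letter. The letters that may
precede an `H` commute with `H (-j)`, and behind any other letter there are none. -/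
lemma H_derH_mono {j : ℕ} (hj : 1 ≤ j) {M : List TopGen} (hM : Sorted M) :
    sop q c (H (-j)) (derH q c j (mono M)) = ((M.count (H (-j)) : ℕ) : ℂ) • mono M := by
  induction M with
  | nil => simp [derH_vac]
  | cons y N ih =>
    have hN := (sorted_cons.1 hM).2
    by_cases h : y = L (-1) ∨ ∃ m, y = H m
    · have hcomm : ∀ u, sop q c (H (-j)) (sop q c y u) = sop q c y (sop q c (H (-j)) u) := by
        intro u
        rcases h with rfl | ⟨m, rfl⟩
        · exact (L_neg_one_comm _ u).symm
        · have := (sorted_cons.1 hM).1.1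
          rw [creator_H] at this
          rw [HH, if_neg (by omega), zero_smul, zero_add]
      rw [← sop_mono (q := q) (c := c) hM, derH_op hj, map_add, hcomm, ih hN, map_smul, map_smul]
      by_cases hy : y = H (-j)
      · subst hy
        rw [List.count_cons_self]
        simp [coeffH]
        module
      · rw [List.count_cons_of_ne hy]
        have : coeffH j y = 0 := by
          cases y with
          | H m =>
            have : m ≠ -(j : ℤ) := fun h' => hy (by rw [h'])
            simp [coeffH, this]
          | _ => simp [coeffH]
        rw [this, zero_smul, add_zero]
    · push Not at h
      have h1 : H (-j) ∉ y :: N := by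
        rw [List.mem_cons, not_or]
        exact ⟨(h.2 _).symm, not_mem_H_of_sorted hM h.1 h.2 _⟩
      rw [derH_mono_eq_zero hj hM h1, List.count_eq_zero.2 h1]
      simp

/-- The diagonal operator with given eigenvalues on words. -/
def diag (a : List TopGen → ℂ) : Module.End ℂ (Space TopGen) :=
  Finsupp.lsum ℂ fun w => a w.1 • Finsupp.lsingle w

lemma diag_mono (a : List TopGen → ℂ) {M : List TopGen} (hM : Sorted M) :
    diag a (mono M) = a M • mono M := by
  simp [diag, mono_of_sorted hM]

lemma diag_apply (a : List TopGen → ℂ) (u : Space TopGen) (w : {M : List TopGen // Sorted M}) :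
    diag a u w = a w.1 * u w := by
  have := eq_of_forall_support (Finsupp.lapply w ∘ₗ diag a) (a w.1 • Finsupp.lapply w) u
    fun v _ => by
      rw [LinearMap.comp_apply, diag_mono a v.2]
      simp only [LinearMap.smul_apply, map_smul, mono_val,
        Finsupp.lapply_apply, Finsupp.single_apply, smul_eq_mul]
      split_ifs with h
      · rw [h]
      · simp
  simpa using this

lemma eigenvalue_eq_zero {a : List TopGen → ℂ} {u : Space TopGen} (h : diag a u = 0)
    {w : {M : List TopGen // Sorted M}} (hw : w ∈ u.support) : a w.1 = 0 := by
  have h1 := diag_apply a u w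
  rw [h, Finsupp.zero_apply] at h1
  exact (mul_eq_zero.1 h1.symm).resolve_right (Finsupp.mem_support_iff.1 hw)

lemma sorted_L_neg_one {M : List TopGen} (h : Sorted M) : Sorted (L (-1) :: M) := by
  refine sorted_cons.2 ⟨⟨by simp, fun a ha => ?_⟩, h⟩
  have hle : L (-1) ≤ a := by
    rw [le_iff_key]
    cases a with
    | L m =>
      by_cases hm : m = -1
      · rw [hm]
      · simp [key, hm, Prod.Lex.le_iff]
    | _ => simp [key, Prod.Lex.le_iff]
  rcases hle.lt_or_eq with h' | h'
  · exact Or.inl h'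
  · exact Or.inr ⟨h', by simp⟩

/-- `L₋₁` is even and the smallest letter, so it acts by prefixing, which is injective on words. -/
lemma L_neg_one_injective {u : Space TopGen} (h : sop q c (L (-1)) u = 0) : u = 0 := by
  let f : {M : List TopGen // Sorted M} → {M : List TopGen // Sorted M} :=
    fun w => ⟨L (-1) :: w.1, sorted_L_neg_one w.2⟩
  have hf : Function.Injective f := fun a b hab => by
    simpa [f, Subtype.ext_iff] using hab
  have : sop q c (L (-1)) = Finsupp.lmapDomain ℂ ℂ f := hom_ext fun M hM => by
    rw [sop_mono (sorted_L_neg_one hM), mono_of_sorted (sorted_L_neg_one hM), mono_of_sorted hM]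
    simp [f]
  rw [this] at h
  exact Finsupp.mapDomain_injective hf (by simpa using h)

/-- If `x` commutes to a multiple of `L (-1)` with `y` and supercommutes with the letters different
from `y`, then the words in a vector annihilated by `x` do not contain `y`. -/
lemma not_mem_of_annihilated {x y : TopGen} {κ : ℂ} (hκ : κ ≠ 0) (hodd : odd x ↔ odd y)
    (hxy : ∀ u, sop q c x (sop q c y u) =
      κ • sop q c (L (-1)) u + sgn x y • sop q c y (sop q c x u))
    (hz : ∀ z, creator z → (∀ m, z ≠ H m) → z ≠ y → ∀ u,
      sop q c x (sop q c z u) = sgn x z • sop q c z (sop q c x u))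
    (hz' : ∀ z, creator z → (∀ m, z ≠ H m) → ∀ u,
      sop q c y (sop q c z u) = sgn y z • sop q c z (sop q c y u))
    (hvac : sop q c x (mono []) = 0) {u : Space TopGen}
    (hH : ∀ w ∈ u.support, ∀ m, H m ∉ w.1) (hu : sop q c x u = 0)
    {w : {M : List TopGen // Sorted M}} (hw : w ∈ u.support) : y ∉ w.1 := by
  -- The product `y x` is the number operator of `y`, scaled by `κ L₋₁`. Since `L₋₁` is injective,
  -- `x u = 0` forces the count of `y` to vanish on every word in the support.
  have key : ∀ M : List TopGen, Sorted M → (∀ m, H m ∉ M) →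
      sop q c y (sop q c x (mono M)) = sop q c (L (-1)) (diag (fun M => κ * M.count y) (mono M)) := by
    intro M
    induction M with
    | nil => intro h _; rw [hvac, diag_mono _ h]; simp
    | cons z N ih =>
      intro h hH
      have hN := (sorted_cons.1 h).2
      have hcz := (sorted_cons.1 h).1.1
      have hzH : ∀ m, z ≠ H m := fun m h' => hH m (by simp [h'])
      have ih' := ih hN fun m h' => hH m (by simp [h'])
      have hs : ∀ u, sop q c y (sop q c x (sop q c z u)) = sop q c z (sop q c y (sop q c x u)) +
          (if z = y then κ else 0) • sop q c (L (-1)) (sop q c z u) := by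
        intro u
        have hsxy : sgn x z = sgn y z := by
          by_cases h1 : odd x <;> by_cases h2 : odd z <;> by_cases h3 : odd y <;> simp_all [sgn]
        have hss : sgn x z * sgn y z = 1 := by rw [hsxy, sgn_mul_self]
        by_cases hzy : z = y
        · subst hzy
          rw [hxy, if_pos rfl, map_add, map_smul, map_smul, L_neg_one_comm, hsxy, ← hz' z hcz hzH,
            add_comm]
        · rw [hz z hcz hzH hzy, map_smul, hz' z hcz hzH, smul_smul, hss, one_smul, if_neg hzy,
            zero_smul, add_zero]
      rw [diag_mono _ hN] at ih'
      rw [diag_mono _ h, ← sop_mono (q := q) (c := c) h, hs, ih', map_smul, map_smul, map_smul,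
        ← L_neg_one_comm, ← add_smul]
      congr 1
      split_ifs with hzy
      · rw [hzy, List.count_cons_self]; push_cast; ring
      · rw [List.count_cons_of_ne hzy]; ring
  have h1 := eq_of_forall_support (sop q c y ∘ₗ sop q c x)
    (sop q c (L (-1)) ∘ₗ diag (fun M => κ * M.count y)) u fun w hw => key w.1 w.2 (hH w hw)
  simp only [LinearMap.comp_apply, hu, map_zero] at h1
  have h2 := eigenvalue_eq_zero (L_neg_one_injective h1.symm) hw
  simpa [hκ, List.count_eq_zero] using h2

lemma GH (m n : ℤ) (u : Space TopGen) :
    sop q c (G m) (sop q c (H n) u) = sop q c (H n) (sop q c (G m) u) - sop q c (G (n + m)) u := by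
  rw [HG]; abel

lemma QH (m n : ℤ) (u : Space TopGen) :
    sop q c (Q m) (sop q c (H n) u) = sop q c (H n) (sop q c (Q m) u) + sop q c (Q (n + m)) u := by
  rw [HQ]; abel

lemma QG (m n : ℤ) (u : Space TopGen) :
    sop q c (Q n) (sop q c (G m) u) = (if m + n = -1 then (2 : ℂ) else 0) • sop q c (L (-1)) u -
      sop q c (G m) (sop q c (Q n) u) := by
  rw [GQ]; abel

/-- The annihilation conditions on the leading part of a `G₀`-closed singular vector. -/
structure IsSing (q c : ℂ) (u : Space TopGen) : Prop where
  killL : ∀ k : ℕ, 1 ≤ k → sop q c (L k) u = 0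
  killH : ∀ k : ℕ, 1 ≤ k → sop q c (H k) u = 0
  killG : ∀ k : ℕ, sop q c (G k) u = 0
  killQ : ∀ k : ℕ, 1 ≤ k → sop q c (Q k) u = 0

/-- Vectors without `H` in the kernel of the annihilators only involve `L (-1)` and `G (-1)`. -/
lemma letters_of_hfree {u : Space TopGen} (hL : ∀ k : ℕ, 1 ≤ k → sop q c (L k) u = 0)
    (hG : ∀ k : ℕ, sop q c (G k) u = 0) (hQ : ∀ k : ℕ, 1 ≤ k → sop q c (Q k) u = 0)
    (hH : ∀ w ∈ u.support, ∀ m, H m ∉ w.1) {w : {M : List TopGen // Sorted M}}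
    (hw : w ∈ u.support) {a : TopGen} (ha : a ∈ w.1) : a = L (-1) ∨ a = G (-1) := by
  have hca := w.2.2 a ha
  cases a with
  | H m => exact absurd ha (hH w hw m)
  | C => simp at hca
  | L m =>
    rw [creator_L] at hca
    by_contra hne
    have hm : m ≠ -1 := fun h => hne (by simp [h])
    -- Conjugate modes add up to `-1`, and `[L_k, L_{-k-1}]` contributes the factor `2k + 1`.
    obtain ⟨k, hk, rfl⟩ : ∃ k : ℕ, 1 ≤ k ∧ m = -k - 1 := ⟨(-m - 1).toNat, by omega, by omega⟩
    refine not_mem_of_annihilated (q := q) (c := c) (x := L k) (y := L (-k - 1)) (κ := 2 * k + 1)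
      (by exact_mod_cast (by omega : 2 * k + 1 ≠ 0)) (by simp) (fun u => ?_) (fun z hz hzH hzy u => ?_)
      (fun z hz hzH u => ?_) (sop_vac (by simp) (by simp) (by simp)) hH (hL k hk) hw ha
    · rw [LL (by omega) (by omega), if_pos (by omega)]
      simp only [sgn, odd_L, and_self, if_false, one_smul]
      push_cast
      congr 2; ring
    · have hs : sgn (L (k : ℤ)) z = 1 := by simp [sgn]
      rw [hs, one_smul]
      cases z with
      | L n =>
        by_cases hn : n = -1
        · rw [hn, L_neg_one_comm]
        · have : n ≠ -k - 1 := fun h => hzy (by rw [h])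
          rw [LL (by omega) hn, if_neg (by omega), zero_smul, zero_add]
      | H n => exact absurd rfl (hzH n)
      | G n => exact LG _ _ _
      | Q n => exact LQ _ _ _
      | C => simp at hz
    · have hs : sgn (L (-k - 1 : ℤ)) z = 1 := by simp [sgn]
      rw [hs, one_smul]
      cases z with
      | L n =>
        by_cases hn : n = -1
        · rw [hn, L_neg_one_comm]
        · rw [creator_L] at hz
          rw [LL (by omega) hn, if_neg (by omega), zero_smul, zero_add]
      | H n => exact absurd rfl (hzH n)
      | G n => exact LG _ _ _
      | Q n => exact LQ _ _ _
      | C => simp at hz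
  | G m =>
    rw [creator_G] at hca
    by_contra hne
    have hm : m ≠ -1 := fun h => hne (by simp [h])
    -- The conjugate of `G_{-k-1}` is `Q_k`, available only for `k ≥ 1`; this is why `G₋₁` survives.
    obtain ⟨k, hk, rfl⟩ : ∃ k : ℕ, 1 ≤ k ∧ m = -k - 1 := ⟨(-m - 1).toNat, by omega, by omega⟩
    refine not_mem_of_annihilated (q := q) (c := c) (x := Q k) (y := G (-k - 1)) (κ := 2)
      two_ne_zero (by simp) (fun u => ?_) (fun z hz hzH hzy u => ?_)
      (fun z hz hzH u => ?_) (sop_vac (by simp) (by simp) (by simp)) hH (hQ k hk) hw ha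
    · rw [QG, if_pos (by omega)]
      simp [sgn, sub_eq_add_neg]
    · cases z with
      | L n => simp [sgn, LQ]
      | H n => exact absurd rfl (hzH n)
      | G n =>
        have : n ≠ -k - 1 := fun h => hzy (by rw [h])
        have h := GQ (q := q) (c := c) n k u
        rw [if_neg (by omega), zero_smul, zero_sub] at h
        simp [sgn, h]
      | Q n => simp [sgn, QQ (k : ℤ) n]
      | C => simp at hz
    · cases z with
      | L n => simp [sgn, LG]
      | H n => exact absurd rfl (hzH n)
      | G n => simp [sgn, GG (-k - 1 : ℤ) n]
      | Q n =>
        rw [creator_Q] at hz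
        rw [GQ, if_neg (by omega)]
        simp [sgn]
      | C => simp at hz
  | Q m =>
    rw [creator_Q] at hca
    exfalso
    -- Here `k = 0` is allowed, because `G₀` is one of the annihilators; so no `Q` survives.
    obtain ⟨k, rfl⟩ : ∃ k : ℕ, m = -k - 1 := ⟨(-m - 1).toNat, by omega⟩
    refine not_mem_of_annihilated (q := q) (c := c) (x := G k) (y := Q (-k - 1)) (κ := 2)
      two_ne_zero (by simp) (fun u => ?_) (fun z hz hzH hzy u => ?_)
      (fun z hz hzH u => ?_) (sop_vac (by simp) (by simp) (by simp)) hH (hG k) hw ha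
    · rw [GQ, if_pos (by omega)]
      simp [sgn, sub_eq_add_neg]
    · cases z with
      | L n => simp [sgn, LG]
      | H n => exact absurd rfl (hzH n)
      | G n => simp [sgn, GG (k : ℤ) n]
      | Q n =>
        have : n ≠ -k - 1 := fun h => hzy (by rw [h])
        rw [GQ, if_neg (by omega)]
        simp [sgn]
      | C => simp at hz
    · cases z with
      | L n => simp [sgn, LQ]
      | H n => exact absurd rfl (hzH n)
      | G n =>
        rw [creator_G] at hz
        have h := GQ (q := q) (c := c) n (-k - 1) u
        rw [if_neg (by omega), zero_smul, zero_sub] at h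
        simp [sgn, h]
      | Q n => simp [sgn, QQ (-k - 1 : ℤ) n]
      | C => simp at hz

/-- `G_k` anticommutes with `G₋₁`, while `[H_k, G₋₁] = G_{k-1}` still has a nonnegative mode for `k
≥ 1` and kills the remaining word. The two assertions need a joint induction. -/
lemma annihilates_letters {M : List TopGen} (hM : Sorted M)
    (h : ∀ a ∈ M, a = L (-1) ∨ a = G (-1)) (k : ℕ) :
    sop q c (G k) (mono M) = 0 ∧ (1 ≤ k → sop q c (H k) (mono M) = 0) := by
  induction M generalizing k with
  | nil => exact ⟨sop_vac (by simp) (by simp) (by simp), fun hk => H_vac (by omega)⟩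
  | cons y N ih =>
    have hN := ih (sorted_cons.1 hM).2 fun a ha => h a (List.mem_cons_of_mem _ ha)
    rw [← sop_mono (q := q) (c := c) hM]
    rcases h y (by simp) with rfl | rfl
    · rw [← L_neg_one_comm, ← L_neg_one_comm, (hN k).1]
      exact ⟨map_zero _, fun hk => by rw [(hN k).2 hk, map_zero]⟩
    · rw [GG, (hN k).1, HG]
      refine ⟨by simp, fun hk => ?_⟩
      have h1 : (k : ℤ) + -1 = (k - 1 : ℕ) := by omega
      rw [(hN k).2 hk, map_zero, add_zero, h1, (hN (k - 1)).1]

lemma hfree_of_derH {u : Space TopGen} (h : ∀ j, 1 ≤ j → derH q c j u = 0)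
    {w : {M : List TopGen // Sorted M}} (hw : w ∈ u.support) (m : ℤ) : H m ∉ w.1 := by
  intro hm
  have hc := w.2.2 _ hm
  rw [creator_H] at hc
  obtain ⟨j, hj, rfl⟩ : ∃ j : ℕ, 1 ≤ j ∧ m = -j := ⟨(-m).toNat, by omega, by omega⟩
  have h1 := eq_of_forall_support (sop q c (H (-j)) ∘ₗ derH q c j)
    (diag fun M => (M.count (H (-j)) : ℕ)) u fun w _ => by
      rw [diag_mono _ w.2]; exact H_derH_mono hj w.2
  rw [LinearMap.comp_apply, h j hj, map_zero] at h1
  have h2 := eigenvalue_eq_zero h1.symm hw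
  rw [Nat.cast_eq_zero, List.count_eq_zero] at h2
  exact h2 hm

/-- None of the annihilators is an `H (-j)`, so each commutes with the derivation. -/
lemma IsSing.isSing_derH {u : Space TopGen} (hu : IsSing q c u) {j : ℕ} (hj : 1 ≤ j) :
    IsSing q c (derH q c j u) := by
  have key : ∀ x, coeffH j x = 0 → sop q c x u = 0 → sop q c x (derH q c j u) = 0 := by
    intro x hx h
    have := derH_op (q := q) (c := c) hj x u
    rw [h, map_zero, hx, zero_smul, add_zero] at this
    exact this.symm
  exact ⟨fun k hk => key _ rfl (hu.killL k hk),
    fun k hk => key _ (if_neg (by omega)) (hu.killH k hk),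
    fun k => key _ rfl (hu.killG k), fun k hk => key _ rfl (hu.killQ k hk)⟩

/-! ### Elimination of the `H` letters for `c ≠ 3`. -/

/-- `2 L (-1)` times the operator `H (-j)`, corrected so as to commute with the annihilators. -/
def dressedH (q c : ℂ) (j : ℕ) (u : Space TopGen) : Space TopGen :=
  (2 : ℂ) • sop q c (L (-1)) (sop q c (H (-j)) u) -
    -- These are the terms of the normally ordered fermionic current of mode `-j` that survive on a
    -- singular vector: for `a > j` the mode of `Q` is positive, and nonnegative modes of `G`,
    -- ordered to the right, kill it.
    ∑ a ∈ Finset.range (j + 1), sop q c (G (-(a + 1))) (sop q c (Q (a - j)) u)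

/-- The commutator of `G_k` with `H₋ⱼ` produces `-2 L₋₁ G_{k-j}`, and the single term of the current
whose `Q` is conjugate to `G_k` produces the same. For `k ≥ j` both are absent. `Q_dressedH` is the
analogous cancellation. -/
lemma G_dressedH {u : Space TopGen} (hu : IsSing q c u) (j k : ℕ) :
    sop q c (G k) (dressedH q c j u) = 0 := by
  have h2 : ∀ a : ℕ, sop q c (G k) (sop q c (G (-(a + 1))) (sop q c (Q (a - j)) u)) =
      -(if (k : ℤ) + (a - j) = -1 then (2 : ℂ) else 0) •
        sop q c (G (-(a + 1))) (sop q c (L (-1)) u) := by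
    intro a
    rw [GG, GQ, hu.killG, map_zero, sub_zero, map_smul, neg_smul]
  rw [dressedH, map_sub, map_smul, ← L_neg_one_comm, GH, hu.killG, map_zero, zero_sub, map_sum,
    Finset.sum_congr rfl fun a _ => h2 a, map_neg]
  by_cases hjk : k < j
  · obtain ⟨i, rfl⟩ : ∃ i, j = k + 1 + i := ⟨j - k - 1, by omega⟩
    rw [Finset.sum_eq_single i, if_pos (by push_cast; ring), ← L_neg_one_comm,
      show (-((k + 1 + i : ℕ) : ℤ) + k) = -(i + 1) by push_cast; ring]
    · module
    · intro a _ ha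
      rw [if_neg (by omega), neg_zero, zero_smul]
    · intro hi
      exact absurd (Finset.mem_range.2 (by omega)) hi
  · rw [Finset.sum_eq_zero fun a _ => by rw [if_neg (by omega), neg_zero, zero_smul],
      show (-(j : ℤ) + k) = (k - j : ℕ) by omega, hu.killG]
    simp

lemma Q_dressedH {u : Space TopGen} (hu : IsSing q c u) (j : ℕ) {k : ℕ} (hk : 1 ≤ k) :
    sop q c (Q k) (dressedH q c j u) = 0 := by
  have h2 : ∀ a : ℕ, sop q c (Q k) (sop q c (G (-(a + 1))) (sop q c (Q (a - j)) u)) =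
      (if (a : ℤ) = k then (2 : ℂ) else 0) • sop q c (L (-1)) (sop q c (Q (a - j)) u) := by
    intro a
    rw [QG, QQ, hu.killQ k hk, map_zero, neg_zero, map_zero, sub_zero]
    congr 1
    exact if_congr (by omega) rfl rfl
  rw [dressedH, map_sub, map_smul, ← L_neg_one_comm, QH, hu.killQ k hk, map_zero, zero_add, map_sum,
    Finset.sum_congr rfl fun a _ => h2 a]
  by_cases hjk : k ≤ j
  · rw [Finset.sum_eq_single k, if_pos rfl, show (-(j : ℤ) + k) = k - j by ring, sub_self]
    · intro a _ ha
      rw [if_neg (by omega), zero_smul]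
    · intro hi
      exact absurd (Finset.mem_range.2 (by omega)) hi
  · rw [Finset.sum_eq_zero fun a ha => by
      rw [Finset.mem_range] at ha
      rw [if_neg (by omega), zero_smul],
      show (-(j : ℤ) + k) = (k - j : ℕ) by omega, hu.killQ _ (by omega)]
    simp

lemma L_dressedH {u : Space TopGen} (hu : IsSing q c u) (j : ℕ) {k : ℕ} (hk : 1 ≤ k) :
    sop q c (L k) (dressedH q c j u) = 0 := by
  rw [dressedH, map_sub, map_smul, ← L_neg_one_comm, LH, hu.killL k hk, map_sum,
    Finset.sum_eq_zero fun a _ => by rw [LG, LQ, hu.killL k hk, map_zero, map_zero]]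
  simp

/-- The Heisenberg relation contributes `k c/3` and the central term of the fermionic current
contributes `-k`, both times `2 L₋₁`. The other terms of the current cancel after shifting the
summation index by `k`. -/
lemma H_dressedH {u : Space TopGen} (hu : IsSing q c u) (j : ℕ) {k : ℕ} (hk : 1 ≤ k) :
    sop q c (H k) (dressedH q c j u) =
      (if j = k then 2 * (k : ℂ) * (c / 3 - 1) else 0) • sop q c (L (-1)) u := by
  have h2 : ∀ a : ℕ, sop q c (H k) (sop q c (G (-(a + 1))) (sop q c (Q (a - j)) u)) =
      sop q c (G (k - a - 1)) (sop q c (Q (a - j)) u) -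
        sop q c (G (-(a + 1))) (sop q c (Q (k + a - j)) u) := by
    intro a
    rw [HG, HQ, hu.killH k hk, map_zero, add_zero, map_neg, ← sub_eq_add_neg,
      show (k : ℤ) + -(a + 1) = k - a - 1 by ring, show (k : ℤ) + (a - j) = k + a - j by ring]
  have h3 : ∀ a : ℕ, a < k → sop q c (G (k - a - 1)) (sop q c (Q (a - j)) u) =
      (if j = k then (2 : ℂ) else 0) • sop q c (L (-1)) u := by
    intro a ha
    rw [GQ, show (k : ℤ) - a - 1 = (k - a - 1 : ℕ) by omega, hu.killG, map_zero, sub_zero]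
    congr 1
    exact if_congr (by omega) rfl rfl
  have h4 : ∀ a : ℕ, j < k + a → sop q c (G (-(a + 1))) (sop q c (Q (k + a - j)) u) = 0 := by
    intro a ha
    rw [show (k : ℤ) + a - j = (k + a - j : ℕ) by omega, hu.killQ _ (by omega), map_zero]
  rw [dressedH, map_sub, map_smul, ← L_neg_one_comm, HH, hu.killH k hk, map_zero, add_zero, map_sum,
    Finset.sum_congr rfl fun a _ => h2 a, Finset.sum_sub_distrib, map_smul]
  by_cases hjk : k ≤ j
  · obtain ⟨i, rfl⟩ : ∃ i, j = k + i := ⟨j - k, by omega⟩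
    have e1 : ∑ a ∈ Finset.range (k + i + 1),
        sop q c (G (k - a - 1)) (sop q c (Q (a - (k + i : ℕ))) u) =
        (k : ℂ) • (if k + i = k then (2 : ℂ) else 0) • sop q c (L (-1)) u +
          ∑ a ∈ Finset.range (i + 1), sop q c (G (-(a + 1))) (sop q c (Q (k + a - (k + i : ℕ))) u) := by
      rw [add_assoc, Finset.sum_range_add]
      congr 1
      · rw [Finset.sum_congr rfl fun a ha => h3 a (Finset.mem_range.1 ha), Finset.sum_const,
          Finset.card_range, ← Nat.cast_smul_eq_nsmul ℂ]
      · refine Finset.sum_congr rfl fun a _ => ?_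
        push_cast
        rw [show (k : ℤ) - (k + a) - 1 = -(a + 1) by ring]
    have e2 : ∑ a ∈ Finset.range (k + i + 1),
        sop q c (G (-(a + 1))) (sop q c (Q (k + a - (k + i : ℕ))) u) =
          ∑ a ∈ Finset.range (i + 1), sop q c (G (-(a + 1))) (sop q c (Q (k + a - (k + i : ℕ))) u) := by
      rw [show k + i + 1 = (i + 1) + k by ring, Finset.sum_range_add,
        Finset.sum_eq_zero (s := Finset.range k) fun a _ => h4 (i + 1 + a) (by omega), add_zero]
    rw [e1, e2, add_sub_cancel_right]
    by_cases hi : i = 0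
    · subst hi
      simp only [add_zero, if_true, add_neg_cancel]
      module
    · rw [if_neg (by omega), if_neg (by omega), if_neg (by omega)]
      simp
  · rw [Finset.sum_eq_zero fun a ha => by
      rw [Finset.mem_range] at ha
      rw [h3 a (by omega), if_neg (by omega), zero_smul],
      Finset.sum_eq_zero fun a ha => h4 a (by omega), if_neg (by omega), if_neg (by omega)]
    simp

/-- The current contains no `H`, so only the explicit `H (-j)` is differentiated. -/
lemma derH_dressedH {u : Space TopGen} {i j : ℕ} (hi : 1 ≤ i) (h : derH q c i u = 0) :
    derH q c i (dressedH q c j u) = (if i = j then (2 : ℂ) else 0) • sop q c (L (-1)) u := by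
  rw [dressedH, map_sub, map_smul, derH_op hi, derH_op hi, h, map_sum, Finset.sum_eq_zero]
  · by_cases hij : i = j
    · simp [coeffH, hij]
    · simp [coeffH, hij, Ne.symm hij]
  · intro a _
    rw [derH_op hi, derH_op hi, h]
    simp [coeffH]

/-- The vectors that are annihilated by products of `s + 1` derivatives. -/
def derHNil (q c : ℂ) : ℕ → Submodule ℂ (Space TopGen)
  | 0 => ⨅ j : ℕ, ⨅ _ : 1 ≤ j, LinearMap.ker (derH q c j)
  | s + 1 => ⨅ j : ℕ, ⨅ _ : 1 ≤ j, (derHNil q c s).comap (derH q c j)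

lemma mem_derHNil_zero {u : Space TopGen} :
    u ∈ derHNil q c 0 ↔ ∀ j, 1 ≤ j → derH q c j u = 0 := by
  simp [derHNil]

lemma mem_derHNil_succ {s : ℕ} {u : Space TopGen} :
    u ∈ derHNil q c (s + 1) ↔ ∀ j, 1 ≤ j → derH q c j u ∈ derHNil q c s := by
  simp [derHNil]

lemma derHNil_mono_succ (s : ℕ) : derHNil q c s ≤ derHNil q c (s + 1) := by
  induction s with
  | zero =>
    intro u hu
    rw [mem_derHNil_succ]
    intro j hj
    rw [mem_derHNil_zero.1 hu j hj]
    exact zero_mem _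
  | succ s ih =>
    intro u hu
    rw [mem_derHNil_succ] at hu ⊢
    exact fun j hj => ih (hu j hj)

lemma derHNil_mono {s t : ℕ} (h : s ≤ t) : derHNil q c s ≤ derHNil q c t :=
  monotone_nat_of_le_succ derHNil_mono_succ h

lemma sop_mem_derHNil {s : ℕ} {u : Space TopGen} (hu : u ∈ derHNil q c s) (x : TopGen) :
    sop q c x u ∈ derHNil q c (s + 1) := by
  induction s generalizing u with
  | zero =>
    rw [mem_derHNil_succ]
    intro j hj
    rw [derH_op hj, mem_derHNil_zero.1 hu j hj, map_zero, zero_add]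
    exact Submodule.smul_mem _ _ hu
  | succ s ih =>
    rw [mem_derHNil_succ]
    intro j hj
    rw [derH_op hj]
    exact add_mem (ih (mem_derHNil_succ.1 hu j hj)) (Submodule.smul_mem _ _ hu)

/-- Each letter absorbs at most one derivative, so the length of the longest word is a sufficient
order. This starts the induction on the degree in the `H`. -/
lemma exists_mem_derHNil (u : Space TopGen) : ∃ s, u ∈ derHNil q c s := by
  have h1 : ∀ M : List TopGen, Sorted M → mono M ∈ derHNil q c M.length := by
    intro M
    induction M with
    | nil => intro _; exact mem_derHNil_zero.2 fun j _ => derH_vac j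
    | cons y N ih =>
      intro h
      rw [← sop_mono (q := q) (c := c) h]
      exact sop_mem_derHNil (ih (sorted_cons.1 h).2) y
  refine ⟨u.support.sup fun w => w.1.length, mem_of_forall_support _ u fun w hw => ?_⟩
  exact derHNil_mono (Finset.le_sup (f := fun w : {M : List TopGen // Sorted M} => w.1.length) hw)
    (h1 w.1 w.2)

lemma exists_derH_eq_zero (u : Space TopGen) :
    ∃ J : ℕ, ∀ j, 1 ≤ j → J < j → derH q c j u = 0 := by
  let f : TopGen → ℕ
    | H m => m.natAbs
    | _ => 0
  refine ⟨u.support.sup fun w => (w.1.map f).sum, fun j hj hJ => ?_⟩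
  refine map_eq_zero_of_forall_support _ u fun w hw => derH_mono_eq_zero hj w.2 fun hm => ?_
  have h1 := Finset.le_sup (f := fun w : {M : List TopGen // Sorted M} => (w.1.map f).sum) hw
  have h2 : f (H (-j)) ≤ (w.1.map f).sum := List.le_sum_of_mem (List.mem_map_of_mem hm)
  have h3 : f (H (-j)) = j := by simp [f]
  omega

/-- For `c ≠ 3` the vectors in the kernel of the annihilators do not involve `H`. -/
theorem IsSing.derH_eq_zero (hc : c ≠ 3) {u : Space TopGen} (hu : IsSing q c u) {j : ℕ}
    (hj : 1 ≤ j) : derH q c j u = 0 := by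
  obtain ⟨s, hs⟩ := exists_mem_derHNil (q := q) (c := c) u
  induction s generalizing u j with
  | zero => exact mem_derHNil_zero.1 hs j hj
  | succ s ih =>
    -- The derivatives of `u` are again singular and of lower order in `H`, so by induction they
    -- contain no `H`: `u` is at most linear in the `H`.
    have hdd : ∀ i j, 1 ≤ i → 1 ≤ j → derH q c i (derH q c j u) = 0 := fun i j hi hj =>
      ih (hu.isSing_derH hj) hi (mem_derHNil_succ.1 hs j hj)
    obtain ⟨J, hJ⟩ := exists_derH_eq_zero (q := q) (c := c) u
    by_cases hjJ : J < j
    · exact hJ j hj hjJ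
    -- Replacing the linear part in each `H (-i)` by its dressed version and subtracting removes all
    -- `H`, while preserving annihilation by `L`, `G` and `Q`. The factor `2 L₋₁` matches the one in
    -- `dressedH`, which avoids dividing by `L₋₁`.
    set v := (2 : ℂ) • sop q c (L (-1)) u -
      ∑ i ∈ Finset.Icc 1 J, dressedH q c i (derH q c i u) with hv
    have hsing : ∀ i ∈ Finset.Icc 1 J, IsSing q c (derH q c i u) := fun i hi =>
      hu.isSing_derH (Finset.mem_Icc.1 hi).1
    have hvd : ∀ i, 1 ≤ i → derH q c i v = 0 := by
      intro i hi
      rw [hv, map_sub, map_smul, derH_op hi, map_sum,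
        Finset.sum_congr rfl fun k hk => derH_dressedH hi (hdd i k hi (Finset.mem_Icc.1 hk).1)]
      by_cases hiJ : i ≤ J
      · rw [Finset.sum_eq_single i]
        · simp [coeffH]
        · intro k _ hk
          rw [if_neg (Ne.symm hk), zero_smul]
        · intro h
          exact absurd (Finset.mem_Icc.2 ⟨hi, hiJ⟩) h
      · rw [Finset.sum_eq_zero fun k hk => by
          rw [Finset.mem_Icc] at hk
          rw [if_neg (by omega), zero_smul], hJ i hi (by omega)]
        simp [coeffH]
    have hkill : ∀ x, sop q c x u = 0 →
        sop q c x v = -∑ i ∈ Finset.Icc 1 J, sop q c x (dressedH q c i (derH q c i u)) := by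
      intro x hx
      rw [hv, map_sub, map_smul, ← L_neg_one_comm, hx, map_zero, smul_zero, zero_sub, map_sum]
    have hkill' : ∀ x, sop q c x u = 0 →
        (∀ i ∈ Finset.Icc 1 J, sop q c x (dressedH q c i (derH q c i u)) = 0) →
        sop q c x v = 0 := by
      intro x hx h
      rw [hkill x hx, Finset.sum_eq_zero h, neg_zero]
    have hHsum : ∀ k : ℕ, 1 ≤ k → sop q c (H k) v = -∑ i ∈ Finset.Icc 1 J,
        (if i = k then 2 * (k : ℂ) * (c / 3 - 1) else 0) • sop q c (L (-1)) (derH q c i u) := by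
      intro k hk
      rw [hkill _ (hu.killH k hk), Finset.sum_congr rfl fun i hi => H_dressedH (hsing i hi) i hk]
    -- the vector `v` only involves `L (-1)` and `G (-1)`
    have hletters : ∀ w ∈ v.support, ∀ a ∈ w.1, a = L (-1) ∨ a = G (-1) :=
      fun w hw a ha => letters_of_hfree
        (fun k hk => hkill' _ (hu.killL k hk) fun i hi => L_dressedH (hsing i hi) i hk)
        (fun k => hkill' _ (hu.killG k) fun i hi => G_dressedH (hsing i hi) i k)
        (fun k hk => hkill' _ (hu.killQ k hk) fun i hi => Q_dressedH (hsing i hi) i hk)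
        (fun w hw m => hfree_of_derH hvd hw m) hw ha
    -- On words in `L₋₁` and `G₋₁` the positive `H` modes vanish, whereas `hHsum` gives `-2j(c/3 -
    -- 1) L₋₁` applied to the derivative of `u`. Comparing the two kills that derivative.
    have hHv : sop q c (H j) v = 0 := map_eq_zero_of_forall_support _ v fun w hw =>
      (annihilates_letters w.2 (hletters w hw) j).2 hj
    have := hHsum j hj
    rw [hHv, Finset.sum_eq_single j, if_pos rfl, ← smul_neg, ← map_neg] at this
    · have hne : 2 * (j : ℂ) * (c / 3 - 1) ≠ 0 := by
        refine mul_ne_zero (mul_ne_zero two_ne_zero (by exact_mod_cast (by omega : j ≠ 0))) ?_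
        intro h
        exact hc (by linear_combination 3 * h)
      have h5 := L_neg_one_injective ((smul_eq_zero.1 this.symm).resolve_left hne)
      exact neg_eq_zero.1 h5
    · intro i _ hi
      rw [if_neg hi, zero_smul]
    · intro h
      exact absurd (Finset.mem_Icc.2 ⟨hj, not_lt.1 hjJ⟩) h

theorem IsSing.letters_of_ne (hc : c ≠ 3) {u : Space TopGen} (hu : IsSing q c u)
    {w : {M : List TopGen // Sorted M}} (hw : w ∈ u.support) {a : TopGen} (ha : a ∈ w.1) :
    a = L (-1) ∨ a = G (-1) :=
  letters_of_hfree hu.killL hu.killG hu.killQ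
    (fun _ hw m => hfree_of_derH (fun _ hj => hu.derH_eq_zero hc hj) hw m) hw ha

end TopGen
end

/-! ### The enveloping algebra acting on ordered words. -/

noncomputable section

set_option linter.unusedSimpArgs false

namespace TopGen

open PBWIndex

lemma topProj_rel {a b : FreeAlgebra ℂ TopGen} (h : TopRel a b) : topProj a = topProj b :=
  RingQuot.mkAlgHom_rel ℂ h

/-- The commutation relations of the generators in the enveloping algebra. -/
lemma topOp_mul (x y : TopGen) : topOp x * topOp y =
    Finsupp.linearCombination ℂ topOp (bracket x y) + sgn x y • (topOp y * topOp x) := by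
  have symm : ∀ x y, (topOp x * topOp y =
      Finsupp.linearCombination ℂ topOp (bracket x y) + sgn x y • (topOp y * topOp x)) →
      topOp y * topOp x =
        Finsupp.linearCombination ℂ topOp (bracket y x) + sgn y x • (topOp x * topOp y) := by
    intro x y h
    rw [h, bracket_symm x y, map_smul, smul_add, smul_smul, sgn_comm y x, sgn_mul_self]
    module
  have C' : ∀ x, topOp C * topOp x =
      Finsupp.linearCombination ℂ topOp (bracket C x) + sgn C x • (topOp x * topOp C) := by
    intro x
    have h := topProj_rel (TopRel.central x)
    rw [map_mul, map_mul] at h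
    have h1 : bracket C x = 0 := by cases x <;> rfl
    have h2 : sgn C x = 1 := by simp [sgn]
    rw [h1, h2, map_zero, zero_add, one_smul]
    exact h
  have LL' : ∀ m n, topOp (L m) * topOp (L n) = Finsupp.linearCombination ℂ topOp
      (bracket (L m) (L n)) + sgn (L m) (L n) • (topOp (L n) * topOp (L m)) := fun m n => by
    have h := topProj_rel (TopRel.LL m n)
    simp only [map_sub, map_add, map_mul, map_smul, sub_eq_iff_eq_add] at h
    simp only [bracket, map_add, map_sub, map_neg, map_smul, map_zero, Finsupp.linearCombination_single, one_smul, sgn, odd_L,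
      odd_H, odd_G, odd_Q, and_self, and_true, and_false, if_true, if_false, neg_one_smul, zero_add,
      ← sub_eq_add_neg]
    exact h
  have LH' : ∀ m n, topOp (L m) * topOp (H n) = Finsupp.linearCombination ℂ topOp
      (bracket (L m) (H n)) + sgn (L m) (H n) • (topOp (H n) * topOp (L m)) := fun m n => by
    have h := topProj_rel (TopRel.LH m n)
    simp only [map_sub, map_add, map_mul, map_smul, sub_eq_iff_eq_add] at h
    simp only [bracket, map_add, map_sub, map_neg, map_smul, map_zero, Finsupp.linearCombination_single, one_smul, sgn, odd_L,
      odd_H, odd_G, odd_Q, and_self, and_true, and_false, if_true, if_false, neg_one_smul, zero_add,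
      ← sub_eq_add_neg]
    exact h
  have LG' : ∀ m n, topOp (L m) * topOp (G n) = Finsupp.linearCombination ℂ topOp
      (bracket (L m) (G n)) + sgn (L m) (G n) • (topOp (G n) * topOp (L m)) := fun m n => by
    have h := topProj_rel (TopRel.LG m n)
    simp only [map_sub, map_add, map_mul, map_smul, sub_eq_iff_eq_add] at h
    simp only [bracket, map_add, map_sub, map_neg, map_smul, map_zero, Finsupp.linearCombination_single, one_smul, sgn, odd_L,
      odd_H, odd_G, odd_Q, and_self, and_true, and_false, if_true, if_false, neg_one_smul, zero_add,
      ← sub_eq_add_neg]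
    exact h
  have LQ' : ∀ m n, topOp (L m) * topOp (Q n) = Finsupp.linearCombination ℂ topOp
      (bracket (L m) (Q n)) + sgn (L m) (Q n) • (topOp (Q n) * topOp (L m)) := fun m n => by
    have h := topProj_rel (TopRel.LQ m n)
    simp only [map_sub, map_add, map_mul, map_smul, sub_eq_iff_eq_add] at h
    simp only [bracket, map_add, map_sub, map_neg, map_smul, map_zero, Finsupp.linearCombination_single, one_smul, sgn, odd_L,
      odd_H, odd_G, odd_Q, and_self, and_true, and_false, if_true, if_false, neg_one_smul, zero_add,
      ← sub_eq_add_neg]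
    exact h
  have HH' : ∀ m n, topOp (H m) * topOp (H n) = Finsupp.linearCombination ℂ topOp
      (bracket (H m) (H n)) + sgn (H m) (H n) • (topOp (H n) * topOp (H m)) := fun m n => by
    have h := topProj_rel (TopRel.HH m n)
    simp only [map_sub, map_add, map_mul, map_smul, sub_eq_iff_eq_add] at h
    simp only [bracket, map_add, map_sub, map_neg, map_smul, map_zero, Finsupp.linearCombination_single, one_smul, sgn, odd_L,
      odd_H, odd_G, odd_Q, and_self, and_true, and_false, if_true, if_false, neg_one_smul, zero_add,
      ← sub_eq_add_neg]
    exact h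
  have HG' : ∀ m n, topOp (H m) * topOp (G n) = Finsupp.linearCombination ℂ topOp
      (bracket (H m) (G n)) + sgn (H m) (G n) • (topOp (G n) * topOp (H m)) := fun m n => by
    have h := topProj_rel (TopRel.HG m n)
    simp only [map_sub, map_add, map_mul, map_smul, sub_eq_iff_eq_add] at h
    simp only [bracket, map_add, map_sub, map_neg, map_smul, map_zero, Finsupp.linearCombination_single, one_smul, sgn, odd_L,
      odd_H, odd_G, odd_Q, and_self, and_true, and_false, if_true, if_false, neg_one_smul, zero_add,
      ← sub_eq_add_neg]
    exact h
  have HQ' : ∀ m n, topOp (H m) * topOp (Q n) = Finsupp.linearCombination ℂ topOp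
      (bracket (H m) (Q n)) + sgn (H m) (Q n) • (topOp (Q n) * topOp (H m)) := fun m n => by
    have h := topProj_rel (TopRel.HQ m n)
    simp only [map_sub, map_neg, map_mul, map_smul, sub_eq_iff_eq_add] at h
    simp only [bracket, map_add, map_sub, map_neg, map_smul, map_zero, Finsupp.linearCombination_single, one_smul, sgn, odd_L,
      odd_H, odd_G, odd_Q, and_self, and_true, and_false, if_true, if_false, neg_one_smul, zero_add,
      ← sub_eq_add_neg]
    exact h
  have GG' : ∀ m n, topOp (G m) * topOp (G n) = Finsupp.linearCombination ℂ topOp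
      (bracket (G m) (G n)) + sgn (G m) (G n) • (topOp (G n) * topOp (G m)) := fun m n => by
    have h := topProj_rel (TopRel.GG m n)
    simp only [map_sub, map_add, map_mul, map_smul, map_zero, ← eq_sub_iff_add_eq] at h
    simp only [bracket, map_add, map_sub, map_neg, map_smul, map_zero, Finsupp.linearCombination_single, one_smul, sgn, odd_L,
      odd_H, odd_G, odd_Q, and_self, and_true, and_false, if_true, if_false, neg_one_smul, zero_add,
      ← sub_eq_add_neg]
    exact h
  have QQ' : ∀ m n, topOp (Q m) * topOp (Q n) = Finsupp.linearCombination ℂ topOp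
      (bracket (Q m) (Q n)) + sgn (Q m) (Q n) • (topOp (Q n) * topOp (Q m)) := fun m n => by
    have h := topProj_rel (TopRel.QQ m n)
    simp only [map_sub, map_add, map_mul, map_smul, map_zero, ← eq_sub_iff_add_eq] at h
    simp only [bracket, map_add, map_sub, map_neg, map_smul, map_zero, Finsupp.linearCombination_single, one_smul, sgn, odd_L,
      odd_H, odd_G, odd_Q, and_self, and_true, and_false, if_true, if_false, neg_one_smul, zero_add,
      ← sub_eq_add_neg]
    exact h
  have GQ' : ∀ m n, topOp (G m) * topOp (Q n) = Finsupp.linearCombination ℂ topOp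
      (bracket (G m) (Q n)) + sgn (G m) (Q n) • (topOp (Q n) * topOp (G m)) := fun m n => by
    have h := topProj_rel (TopRel.GQ m n)
    simp only [map_sub, map_add, map_mul, map_smul] at h
    rw [← eq_sub_iff_add_eq] at h
    simp only [bracket, map_add, map_sub, map_neg, map_smul, map_zero, Finsupp.linearCombination_single, one_smul, sgn, odd_L,
      odd_H, odd_G, odd_Q, and_self, and_true, and_false, if_true, if_false, neg_one_smul, zero_add,
      ← sub_eq_add_neg]
    exact h
  rcases x with m | m | m | m | _ <;> rcases y with n | n | n | n | _ <;>
    first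
    | exact LL' _ _ | exact LH' _ _ | exact LG' _ _ | exact LQ' _ _ | exact HH' _ _
    | exact HG' _ _ | exact HQ' _ _ | exact GG' _ _ | exact GQ' _ _ | exact QQ' _ _ | exact C' _
    | exact symm _ _ (LH' _ _) | exact symm _ _ (LG' _ _) | exact symm _ _ (LQ' _ _)
    | exact symm _ _ (HG' _ _) | exact symm _ _ (HQ' _ _) | exact symm _ _ (GQ' _ _)
    | exact symm _ _ (C' _)

lemma verma_mul (q c : ℂ) (x y : TopGen) : (verma q c).op x * (verma q c).op y =
    (verma q c).opL (bracket x y) + sgn x y • ((verma q c).op y * (verma q c).op x) :=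
  LinearMap.ext fun u => (verma q c).rel x y u

/-- The homomorphism from the enveloping algebra with given values on the generators. -/
def topLift {A : Type*} [Ring A] [Algebra ℂ A] (t : TopGen → A)
    (h : ∀ a b, TopRel a b → FreeAlgebra.lift ℂ t a = FreeAlgebra.lift ℂ t b) :
    TopAlgebra →ₐ[ℂ] A :=
  RingQuot.liftAlgHom ℂ (s := TopRel) ⟨FreeAlgebra.lift ℂ t, fun {a b} => h a b⟩

lemma topLift_topOp {A : Type*} [Ring A] [Algebra ℂ A] {t : TopGen → A}
    (h : ∀ a b, TopRel a b → FreeAlgebra.lift ℂ t a = FreeAlgebra.lift ℂ t b) (x : TopGen) :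
    topLift t h (topOp x) = t x :=
  (RingQuot.liftAlgHom_mkAlgHom_apply ℂ _ _ _).trans (FreeAlgebra.lift_ι_apply _ _)

/-- The action of the enveloping algebra on the space of ordered words. -/
def vermaAction (q c : ℂ) : TopAlgebra →ₐ[ℂ] Module.End ℂ (Space TopGen) :=
  topLift (verma q c).op (by
    intro a b h
    cases h with
    | LL m n =>
      simp only [map_sub, map_add, map_mul, map_smul, FreeAlgebra.lift_ι_apply, topGen]
      rw [verma_mul]
      simp only [bracket, map_add, map_sub, map_neg, map_smul, map_zero, Bracket.opL_single, one_smul, sgn, odd_L,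
        odd_H, odd_G, odd_Q, and_self, and_true, and_false, if_true, if_false, neg_one_smul, zero_add,
        ← sub_eq_add_neg]
      module
    | HH m n =>
      simp only [map_sub, map_add, map_mul, map_smul, FreeAlgebra.lift_ι_apply, topGen]
      rw [verma_mul]
      simp only [bracket, map_add, map_sub, map_neg, map_smul, map_zero, Bracket.opL_single, one_smul, sgn, odd_L,
        odd_H, odd_G, odd_Q, and_self, and_true, and_false, if_true, if_false, neg_one_smul, zero_add,
        ← sub_eq_add_neg]
      module
    | LG m n =>
      simp only [map_sub, map_add, map_mul, map_smul, FreeAlgebra.lift_ι_apply, topGen]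
      rw [verma_mul]
      simp only [bracket, map_add, map_sub, map_neg, map_smul, map_zero, Bracket.opL_single, one_smul, sgn, odd_L,
        odd_H, odd_G, odd_Q, and_self, and_true, and_false, if_true, if_false, neg_one_smul, zero_add,
        ← sub_eq_add_neg]
      module
    | HG m n =>
      simp only [map_sub, map_add, map_mul, map_smul, FreeAlgebra.lift_ι_apply, topGen]
      rw [verma_mul]
      simp only [bracket, map_add, map_sub, map_neg, map_smul, map_zero, Bracket.opL_single, one_smul, sgn, odd_L,
        odd_H, odd_G, odd_Q, and_self, and_true, and_false, if_true, if_false, neg_one_smul, zero_add,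
        ← sub_eq_add_neg]
      module
    | LQ m n =>
      simp only [map_sub, map_add, map_mul, map_smul, FreeAlgebra.lift_ι_apply, topGen]
      rw [verma_mul]
      simp only [bracket, map_add, map_sub, map_neg, map_smul, map_zero, Bracket.opL_single, one_smul, sgn, odd_L,
        odd_H, odd_G, odd_Q, and_self, and_true, and_false, if_true, if_false, neg_one_smul, zero_add,
        ← sub_eq_add_neg]
      module
    | HQ m n =>
      simp only [map_sub, map_neg, map_mul, map_smul, FreeAlgebra.lift_ι_apply, topGen]
      rw [verma_mul]
      simp only [bracket, map_add, map_sub, map_neg, map_smul, map_zero, Bracket.opL_single, one_smul, sgn, odd_L,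
        odd_H, odd_G, odd_Q, and_self, and_true, and_false, if_true, if_false, neg_one_smul, zero_add,
        ← sub_eq_add_neg]
      module
    | LH m n =>
      simp only [map_sub, map_add, map_mul, map_smul, FreeAlgebra.lift_ι_apply, topGen]
      rw [verma_mul]
      simp only [bracket, map_add, map_sub, map_neg, map_smul, map_zero, Bracket.opL_single, one_smul, sgn, odd_L,
        odd_H, odd_G, odd_Q, and_self, and_true, and_false, if_true, if_false, neg_one_smul, zero_add,
        ← sub_eq_add_neg]
      module
    | GQ m n =>
      simp only [map_sub, map_add, map_mul, map_smul, FreeAlgebra.lift_ι_apply, topGen]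
      rw [verma_mul]
      simp only [bracket, map_add, map_sub, map_neg, map_smul, map_zero, Bracket.opL_single, one_smul, sgn, odd_L,
        odd_H, odd_G, odd_Q, and_self, and_true, and_false, if_true, if_false, neg_one_smul, zero_add,
        ← sub_eq_add_neg]
      module
    | GG m n =>
      simp only [map_sub, map_add, map_mul, map_zero, FreeAlgebra.lift_ι_apply, topGen]
      rw [verma_mul]
      simp only [bracket, map_add, map_sub, map_neg, map_smul, map_zero, Bracket.opL_single, one_smul, sgn, odd_L,
        odd_H, odd_G, odd_Q, and_self, and_true, and_false, if_true, if_false, neg_one_smul, zero_add,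
        ← sub_eq_add_neg]
      module
    | QQ m n =>
      simp only [map_sub, map_add, map_mul, map_zero, FreeAlgebra.lift_ι_apply, topGen]
      rw [verma_mul]
      simp only [bracket, map_add, map_sub, map_neg, map_smul, map_zero, Bracket.opL_single, one_smul, sgn, odd_L,
        odd_H, odd_G, odd_Q, and_self, and_true, and_false, if_true, if_false, neg_one_smul, zero_add,
        ← sub_eq_add_neg]
      module
    | central x =>
      simp only [map_mul, FreeAlgebra.lift_ι_apply, topGen]
      rw [verma_mul]
      have h1 : bracket C x = 0 := by cases x <;> rfl
      simp [h1, sgn])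

lemma vermaAction_topOp (q c : ℂ) (x : TopGen) : vermaAction q c (topOp x) = (verma q c).op x := by
  rw [vermaAction, topLift_topOp]

lemma topAlgebra_induction {P : TopAlgebra → Prop} (hC : ∀ r : ℂ, P (algebraMap ℂ TopAlgebra r))
    (hx : ∀ x, P (topOp x)) (hmul : ∀ a b, P a → P b → P (a * b))
    (hadd : ∀ a b, P a → P b → P (a + b)) (a : TopAlgebra) : P a := by
  obtain ⟨b, rfl⟩ : ∃ b, topProj b = a := RingQuot.mkAlgHom_surjective ℂ TopRel a
  induction b with
  | grade0 r => simpa using hC r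
  | grade1 x => exact hx x
  | mul a b ha hb => rw [map_mul]; exact hmul _ _ ha hb
  | add a b ha hb => rw [map_add]; exact hadd _ _ ha hb

end TopGen
end

/-! ### The chiral topological Verma module and its closed vectors. -/

noncomputable section

namespace TopGen

open PBWIndex

variable {q c : ℂ}

lemma smul_hw_eq_zero {a : TopAlgebra} (h : a ∈ topChiralIdeal q c) : a • topChiralHW q c = 0 := by
  rw [topChiralHW, ← Submodule.Quotient.mk_smul, smul_eq_mul, mul_one]
  exact (Submodule.Quotient.mk_eq_zero _).2 h

lemma smul_hw_of_sub_mem {a : TopAlgebra} {r : ℂ}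
    (h : a - algebraMap ℂ TopAlgebra r ∈ topChiralIdeal q c) :
    a • topChiralHW q c = r • topChiralHW q c := by
  have := smul_hw_eq_zero h
  rwa [sub_smul, algebraMap_smul, sub_eq_zero] at this

lemma topOp_smul_hw {x : TopGen} (hx : ¬ creator x) :
    topOp x • topChiralHW q c = weight q c x • topChiralHW q c := by
  have pos : ∀ a ∈ topPositive, a • topChiralHW q c = 0 := fun a ha =>
    smul_hw_eq_zero (Submodule.subset_span (Or.inl ha))
  have zer : ∀ m : ℤ, ¬ m < 0 → m = 0 ∨ 0 < m := fun m hm => by omega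
  cases x with
  | L m =>
    rw [show weight q c (L m) = 0 from rfl, zero_smul]
    rcases zer m hx with rfl | h
    · exact smul_hw_eq_zero (Submodule.subset_span (by simp))
    · exact pos _ ⟨m, h, by simp⟩
  | H m =>
    rcases zer m hx with rfl | h
    · rw [weight, if_pos rfl]
      exact smul_hw_of_sub_mem (Submodule.subset_span (by simp))
    · rw [weight, if_neg h.ne', zero_smul]
      exact pos _ ⟨m, h, by simp⟩
  | G m =>
    rw [show weight q c (G m) = 0 from rfl, zero_smul]
    rcases zer m hx with rfl | h
    · exact smul_hw_eq_zero (Submodule.subset_span (by simp))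
    · exact pos _ ⟨m, h, by simp⟩
  | Q m =>
    rw [show weight q c (Q m) = 0 from rfl, zero_smul]
    rcases zer m hx with rfl | h
    · exact smul_hw_eq_zero (Submodule.subset_span (by simp))
    · exact pos _ ⟨m, h, by simp⟩
  | C => exact smul_hw_of_sub_mem (Submodule.subset_span (by simp [weight]))

lemma vermaAction_vac {a : TopAlgebra} (h : a ∈ topChiralIdeal q c) :
    vermaAction q c a (mono []) = 0 := by
  have pos : ∀ x : TopGen, ¬ creator x → weight q c x = 0 →
      vermaAction q c (topOp x) (mono []) = 0 := fun x h1 h2 => by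
    rw [vermaAction_topOp, (verma q c).op_vac h1]
    exact (congrArg (· • _) h2).trans (zero_smul _ _)
  have scal : ∀ x : TopGen, ¬ creator x →
      vermaAction q c (topOp x - algebraMap ℂ TopAlgebra (weight q c x)) (mono []) = 0 :=
    fun x h1 => by
      rw [map_sub, AlgHom.commutes, LinearMap.sub_apply, Module.algebraMap_end_apply,
        vermaAction_topOp, (verma q c).op_vac h1, sub_eq_zero]
      rfl
  induction h using Submodule.span_induction with
  | mem a ha =>
    rcases ha with ⟨k, hk, rfl | rfl | rfl | rfl⟩ | rfl | rfl | rfl | rfl | rfl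
    · exact pos _ (by simpa using hk.le) rfl
    · exact pos _ (by simpa using hk.le) (by simp [weight, hk.ne'])
    · exact pos _ (by simpa using hk.le) rfl
    · exact pos _ (by simpa using hk.le) rfl
    · exact pos _ (by simp) rfl
    · exact pos _ (by simp) rfl
    · exact pos _ (by simp) rfl
    · simpa [weight] using scal (H 0) (by simp)
    · simpa [weight] using scal C (by simp)
  | zero => simp
  | add a b _ _ ha hb => rw [map_add, LinearMap.add_apply, ha, hb, add_zero]
  | smul r a _ ha => rw [smul_eq_mul, map_mul, Module.End.mul_apply, ha, map_zero]

/-- The expansion of a vector of the chiral Verma module in ordered words. -/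
def toSpace (q c : ℂ) : TopChiralVerma q c →ₗ[ℂ] Space TopGen :=
  (((topChiralIdeal q c).restrictScalars ℂ).liftQ
    ((LinearMap.applyₗ (mono [])).comp (vermaAction q c).toLinearMap)
    fun _ h => vermaAction_vac h).comp
  (Submodule.Quotient.restrictScalarsEquiv ℂ (topChiralIdeal q c)).symm.toLinearMap

lemma toSpace_mk (a : TopAlgebra) :
    toSpace q c (Submodule.Quotient.mk a) = vermaAction q c a (mono []) := rfl

lemma toSpace_smul (a : TopAlgebra) (ψ : TopChiralVerma q c) :
    toSpace q c (a • ψ) = vermaAction q c a (toSpace q c ψ) := by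
  obtain ⟨b, rfl⟩ := Submodule.Quotient.mk_surjective _ ψ
  rw [← Submodule.Quotient.mk_smul, toSpace_mk, toSpace_mk, smul_eq_mul, map_mul,
    Module.End.mul_apply]

lemma toSpace_topOp (x : TopGen) (ψ : TopChiralVerma q c) :
    toSpace q c (topOp x • ψ) = (verma q c).op x (toSpace q c ψ) := by
  rw [toSpace_smul, vermaAction_topOp]

lemma toSpace_hw : toSpace q c (topChiralHW q c) = mono [] := by
  rw [topChiralHW, toSpace_mk, map_one, Module.End.one_apply]

/-- The vector of the chiral Verma module with a given expansion in ordered words. -/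
def ofSpace (q c : ℂ) : Space TopGen →ₗ[ℂ] TopChiralVerma q c :=
  Bracket.toModule (fun x => Algebra.lsmul ℂ ℂ (TopChiralVerma q c) (topOp x)) (topChiralHW q c)

lemma ofSpace_op (x : TopGen) (u : Space TopGen) :
    ofSpace q c ((verma q c).op x u) = topOp x • ofSpace q c u := by
  refine (verma q c).toModule_op _ _ (fun x y u => ?_) (fun x hx => topOp_smul_hw hx) x u
  simp only [Algebra.lsmul_coe]
  rw [← mul_smul, topOp_mul, add_smul, smul_assoc, mul_smul]
  congr 1
  rw [Finsupp.linearCombination_apply, Finsupp.linearCombination_apply, Finsupp.sum, Finsupp.sum,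
    Finset.sum_smul, LinearMap.sum_apply]
  exact Finset.sum_congr rfl fun z _ => smul_assoc _ _ _

lemma ofSpace_vermaAction (a : TopAlgebra) (u : Space TopGen) :
    ofSpace q c (vermaAction q c a u) = a • ofSpace q c u := by
  induction a using topAlgebra_induction generalizing u with
  | hC r => rw [AlgHom.commutes, Module.algebraMap_end_apply, map_smul, algebraMap_smul]
  | hx x => rw [vermaAction_topOp, ofSpace_op]
  | hmul a b ha hb => rw [map_mul, Module.End.mul_apply, ha, hb, mul_smul]
  | hadd a b ha hb => rw [map_add, LinearMap.add_apply, map_add, ha, hb, add_smul]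

/-- Both maps intertwine the actions and match the highest weight vectors, and the module is cyclic.
One-sided invertibility suffices: it shows that a vector is determined by its expansion. -/
lemma ofSpace_toSpace (ψ : TopChiralVerma q c) : ofSpace q c (toSpace q c ψ) = ψ := by
  obtain ⟨a, rfl⟩ := Submodule.Quotient.mk_surjective _ ψ
  rw [toSpace_mk, ofSpace_vermaAction]
  have : ofSpace q c (mono []) = topChiralHW q c := by
    rw [ofSpace, Bracket.toModule_mono _ _ sorted_nil, List.foldr_nil]
  rw [this, topChiralHW, ← Submodule.Quotient.mk_smul, smul_eq_mul, mul_one]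

lemma toSpace_injective : Function.Injective (toSpace q c) :=
  Function.LeftInverse.injective ofSpace_toSpace

/-- Even generators of mode zero act diagonally on words. -/
lemma op_eq_diag {x : TopGen} (hx : ¬ creator x) (hx' : ¬ odd x) {a : TopGen → ℤ}
    (h : ∀ y, creator y → bracket x y = (a y : ℂ) • Finsupp.single y 1) :
    (verma q c).op x = diag fun M => weight q c x + ((M.map a).sum : ℤ) := by
  refine hom_ext fun M hM => ?_
  rw [diag_mono _ hM]
  induction M with
  | nil =>
    rw [(verma q c).op_vac hx]
    simp only [List.map_nil, List.sum_nil, Int.cast_zero, add_zero]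
    rfl
  | cons y N ih =>
    have hs := sorted_cons.1 hM
    have hb : (verma q c).br x y = (a y : ℂ) • Finsupp.single y 1 := h y hs.1.1
    have hsgn : sgn x y = 1 := by simp [sgn, hx']
    rw [(verma q c).op_cons x hM, hb, hsgn, ih hs.2, map_smul, Bracket.opL_single, map_smul,
      one_smul, one_smul, LinearMap.smul_apply, (verma q c).op_mono_of_sorted hM, ← add_smul]
    simp only [List.map_cons, List.sum_cons]
    push_cast
    congr 1
    ring

/-- The level of a generator. -/
def level : TopGen → ℤ
  | L m => -m
  | H m => -m
  | G m => -m
  | Q m => -m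
  | C => 0

/-- The charge of a generator. -/
def charge : TopGen → ℤ
  | G _ => 1
  | Q _ => -1
  | _ => 0

lemma op_L_zero : (verma q c).op (L 0) = diag fun M => (((M.map level).sum : ℤ) : ℂ) := by
  rw [op_eq_diag (a := level) (by simp) (by simp)]
  · simp [weight]
  · intro y hy
    cases y with
    | C => exact hy.elim
    | _ => simp [bracket, level]

lemma op_H_zero : (verma q c).op (H 0) = diag fun M => q + ((M.map charge).sum : ℤ) := by
  rw [op_eq_diag (a := charge) (by simp) (by simp)]
  · simp [weight]
  · intro y hy
    cases y with
    | L m =>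
      have : m ≠ 0 := ne_of_lt hy
      simp [bracket, charge, this]
    | C => exact hy.elim
    | _ => simp [bracket, charge]

/-- A vector of given level and charge annihilated by the positive modes and by `G₀`. -/
structure IsClosed (m : ℚ) (n : ℤ) (ψ : TopChiralVerma q c) : Prop where
  level : topOp (.L 0) • ψ = (m : ℂ) • ψ
  charge : topOp (.H 0) • ψ = (q + n) • ψ
  positive : ∀ a ∈ topPositive, a • ψ = 0
  g_closed : topOp (.G 0) • ψ = 0

namespace IsClosed

variable {m : ℚ} {n : ℤ} {ψ φ : TopChiralVerma q c}

lemma sub_smul (h : IsClosed m n ψ) (h' : IsClosed m n φ) (t : ℂ) :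
    IsClosed m n (ψ - t • φ) where
  level := by rw [smul_sub, smul_comm, h.level, h'.level]; module
  charge := by rw [smul_sub, smul_comm, h.charge, h'.charge]; module
  positive a ha := by rw [smul_sub, smul_comm, h.positive a ha, h'.positive a ha]; simp
  g_closed := by rw [smul_sub, smul_comm, h.g_closed, h'.g_closed]; simp

lemma level_eq (h : IsClosed m n ψ) {w : {M : List TopGen // Sorted M}}
    (hw : toSpace q c ψ w ≠ 0) : (((w.1.map TopGen.level).sum : ℤ) : ℂ) = m := by
  have h1 := congrArg (fun φ => toSpace q c φ w) h.level
  simp only [toSpace_topOp, op_L_zero, diag_apply, map_smul, Finsupp.smul_apply, smul_eq_mul] at h1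
  exact mul_right_cancel₀ hw h1

lemma charge_eq (h : IsClosed m n ψ) {w : {M : List TopGen // Sorted M}}
    (hw : toSpace q c ψ w ≠ 0) : (w.1.map TopGen.charge).sum = n := by
  have h1 := congrArg (fun φ => toSpace q c φ w) h.charge
  simp only [toSpace_topOp, op_H_zero, diag_apply, map_smul, Finsupp.smul_apply, smul_eq_mul] at h1
  exact_mod_cast add_left_cancel (mul_right_cancel₀ hw h1)

/-- Annihilation passes to leading parts; mode zero of `G` is supplied by closedness, the other
modes by positivity. -/
lemma isSing_degPart (h : IsClosed m n ψ) {d : ℕ}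
    (hd : toSpace q c ψ ∈ Bracket.degLT degree (d + 1)) :
    IsSing q c (Bracket.degPart degree d (toSpace q c ψ)) := by
  have key : ∀ x, topOp x • ψ = 0 →
      sop q c x (Bracket.degPart degree d (toSpace q c ψ)) = 0 := fun x hx =>
    (isSymbol q c).op_degPart hd (by rw [← toSpace_topOp, hx, map_zero])
  constructor
  · exact fun k hk => key _ (h.positive _ ⟨k, by omega, by simp⟩)
  · exact fun k hk => key _ (h.positive _ ⟨k, by omega, by simp⟩)
  · intro k
    rcases Nat.eq_zero_or_pos k with rfl | hk
    · exact key _ h.g_closed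
    · exact key _ (h.positive _ ⟨k, by omega, by simp⟩)
  · exact fun k hk => key _ (h.positive _ ⟨k, by omega, by simp⟩)

end IsClosed

/-- Words in `L (-1)` and `G (-1)`. -/
lemma eq_replicate_append {M : List TopGen} (hM : Sorted M)
    (h : ∀ a ∈ M, a = L (-1) ∨ a = G (-1)) :
    ∃ r e : ℕ, e ≤ 1 ∧ M = List.replicate r (L (-1)) ++ List.replicate e (G (-1)) := by
  induction M with
  | nil => exact ⟨0, 0, by simp, rfl⟩
  | cons y N ih =>
    have hs := sorted_cons.1 hM
    obtain ⟨r, e, he, hN⟩ := ih hs.2 fun a ha => h a (by simp [ha])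
    rcases h y (by simp) with rfl | rfl
    · exact ⟨r + 1, e, he, by rw [hN]; rfl⟩
    · refine ⟨0, 1, le_rfl, ?_⟩
      have hG : ∀ a ∈ N, False := fun a ha => by
        rcases h a (by simp [ha]) with rfl | rfl
        · rcases hs.1.2 _ ha with h1 | ⟨h1, -⟩
          · have := (le_iff_key _ _).1 h1.le
            simp [key, Prod.Lex.le_iff] at this
          · cases h1
        · rcases hs.1.2 _ ha with h1 | ⟨-, h1⟩
          · exact h1.false
          · simp at h1
      rw [List.eq_nil_iff_forall_not_mem.2 hG]
      rfl

/-- The expansion of a nonzero closed vector involves the word `L (-1) ^ r G (-1) ^ e` determined by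
its level and charge. -/
theorem IsClosed.exists_word (hc : c ≠ 3) {m : ℚ} {n : ℤ} {ψ : TopChiralVerma q c}
    (h : IsClosed m n ψ) (h0 : ψ ≠ 0) : ∃ (r e : ℕ) (w : {M : List TopGen // Sorted M}),
      e ≤ 1 ∧ m = r + e ∧ n = e ∧ toSpace q c ψ w ≠ 0 ∧
        w.1 = List.replicate r (L (-1)) ++ List.replicate e (G (-1)) := by
  set u := toSpace q c ψ with hu
  have hu0 : u ≠ 0 := fun h' => h0 (toSpace_injective (by rw [← hu, h', map_zero]))
  -- A word of maximal degree occurs in the leading part, which involves only `L₋₁` and `G₋₁`. Level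
  -- and charge then determine the two exponents.
  obtain ⟨v, hv, hmax⟩ := u.support.exists_max_image (fun w => Bracket.wdeg degree w.1)
    (Finsupp.support_nonempty_iff.2 hu0)
  set d := Bracket.wdeg degree v.1 with hd
  have hlt : u ∈ Bracket.degLT degree (d + 1) := fun w hw => Nat.lt_succ_of_le (hmax w hw)
  have hv' : v ∈ (Bracket.degPart degree d u).support := by
    rw [Finsupp.mem_support_iff, Bracket.degPart_apply, if_pos hd.symm]
    exact Finsupp.mem_support_iff.1 hv
  obtain ⟨r, e, he, hre⟩ := eq_replicate_append v.2 fun a ha =>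
    (h.isSing_degPart hlt).letters_of_ne hc hv' ha
  have hvne := Finsupp.mem_support_iff.1 hv
  refine ⟨r, e, v, he, ?_, ?_, hvne, hre⟩
  · have h1 := h.level_eq hvne
    rw [hre] at h1
    simp only [List.map_append, List.map_replicate, List.sum_append, List.sum_replicate,
      TopGen.level, neg_neg, nsmul_eq_mul, mul_one] at h1
    exact_mod_cast h1.symm
  · have h1 := h.charge_eq hvne
    rw [hre] at h1
    simpa [TopGen.charge] using h1.symm

/-- The exponents `r` and `e` depend only on level and charge. The multiple of `φ` is chosen to
cancel the coefficient of that word, so the difference cannot be a nonzero closed vector. -/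
theorem IsClosed.proportional (hc : c ≠ 3) {m : ℚ} {n : ℤ} {ψ φ : TopChiralVerma q c}
    (h : IsClosed m n ψ) (h' : IsClosed m n φ) (h0 : φ ≠ 0) : ∃ t : ℂ, ψ = t • φ := by
  obtain ⟨r, e, w, -, hm, hn, hw, hre⟩ := h'.exists_word hc h0
  refine ⟨toSpace q c ψ w / toSpace q c φ w, sub_eq_zero.1 ?_⟩
  by_contra hne
  obtain ⟨r', e', w', -, hm', hn', hw', hre'⟩ := (h.sub_smul h' _).exists_word hc hne
  have he : e' = e := by omega
  have hr : r' = r := by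
    rw [hm, he] at hm'
    exact_mod_cast (add_right_cancel hm').symm
  rw [he, hr, ← hre] at hre'
  rw [Subtype.ext hre', map_sub, map_smul, Finsupp.sub_apply, Finsupp.smul_apply, smul_eq_mul,
    div_mul_cancel₀ _ hw, sub_self] at hw'
  exact hw' rfl

lemma isClosed_hw : IsClosed 0 0 (topChiralHW q c) where
  level := by rw [topOp_smul_hw (by simp)]; simp [weight]
  charge := by rw [topOp_smul_hw (by simp)]; simp [weight]
  positive a ha := smul_hw_eq_zero (Submodule.subset_span (Or.inl ha))
  g_closed := smul_hw_eq_zero (Submodule.subset_span (by simp))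

lemma topChiralHW_ne_zero : topChiralHW q c ≠ 0 := fun h => by
  have := toSpace_hw (q := q) (c := c)
  rw [h, map_zero, mono_of_sorted sorted_nil] at this
  exact one_ne_zero (Finsupp.single_eq_zero.1 this.symm)

/-- The possible charges and levels. -/
theorem IsClosed.charge_level (hc : c ≠ 3) {m : ℚ} {n : ℤ} {ψ : TopChiralVerma q c}
    (h : IsClosed m n ψ) (h0 : ¬ ∃ t : ℂ, ψ = t • topChiralHW q c) :
    (n = 0 ∨ n = 1) ∧ ∃ k : ℕ, 0 < k ∧ m = k := by
  obtain ⟨r, e, w, he, hm, hn, -, -⟩ := h.exists_word hc fun h' => h0 ⟨0, by rw [h', zero_smul]⟩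
  refine ⟨by omega, r + e, ?_, by push_cast; exact hm⟩
  by_contra hre
  obtain rfl : r = 0 := by omega
  obtain rfl : e = 0 := by omega
  obtain rfl : m = 0 := by simpa using hm
  obtain rfl : n = 0 := by simpa using hn
  -- At level and charge zero the highest weight vector itself is closed, so it is the only
  -- candidate.
  exact h0 (h.proportional hc isClosed_hw topChiralHW_ne_zero)

/-- Nonvanishing of `Q₀ψ` is automatic: `{G₀, Q₀} = 2 L₀` acts by twice the level, which is
positive. -/
lemma IsClosed.isTopGSingular (hc : c ≠ 3) {m : ℚ} {n : ℤ} {ψ : TopChiralVerma q c}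
    (h : IsClosed m n ψ) (h0 : ¬ ∃ t : ℂ, ψ = t • topChiralHW q c) : IsTopGSingular m n ψ where
  level := h.level
  charge := h.charge
  positive := h.positive
  g_closed := h.g_closed
  not_q_closed hQ := by
    obtain ⟨-, k, hk, rfl⟩ := h.charge_level hc h0
    have h1 := topProj_rel (TopRel.GQ 0 0)
    have h2 := congrArg (· • ψ) h1
    simp only [Int.cast_zero, mul_zero, zero_smul, sub_zero, add_zero, zero_pow two_ne_zero, zero_div,
      if_true, map_add, map_mul, map_smul] at h2
    change (topOp (G 0) * topOp (Q 0) + topOp (Q 0) * topOp (G 0)) • ψ = ((2 : ℂ) • topOp (L 0)) • ψ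
      at h2
    rw [add_smul, mul_smul, mul_smul, hQ, h.g_closed, smul_zero, smul_zero, add_zero, smul_assoc,
      h.level, smul_smul] at h2
    refine (smul_eq_zero.1 h2.symm).elim (fun h3 => ?_) fun h3 => h0 ⟨0, by rw [h3, zero_smul]⟩
    simp [hk.ne'] at h3
  not_proportional := h0

lemma isTopGSingular_iff (hc : c ≠ 3) {m : ℚ} {n : ℤ} {ψ : TopChiralVerma q c} :
    IsTopGSingular m n ψ ↔ IsClosed m n ψ ∧ ¬ ∃ t : ℂ, ψ = t • topChiralHW q c :=
  ⟨fun h => ⟨⟨h.level, h.charge, h.positive, h.g_closed⟩, h.not_proportional⟩,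
    fun h => h.1.isTopGSingular hc h.2⟩

theorem topGSingularDim_le (hc : c ≠ 3) (m : ℚ) (n : ℤ) :
    topGSingularDim q c m n ≤ if n = 0 ∨ n = 1 then 1 else 0 := by
  rw [topGSingularDim]
  by_cases hex : ∃ ψ : TopChiralVerma q c, IsTopGSingular m n ψ
  · obtain ⟨φ, hφ⟩ := hex
    have hφ' := (isTopGSingular_iff hc).1 hφ
    rw [if_pos (hφ'.1.charge_level hc hφ'.2).1]
    refine (Submodule.rank_mono (t := Submodule.span ℂ {φ}) (Submodule.span_le.2 ?_)).trans
      ((rank_span_le _).trans (by simp))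
    intro ψ hψ
    obtain ⟨t, rfl⟩ := ((isTopGSingular_iff hc).1 hψ).1.proportional hc hφ'.1
      fun h => hφ'.2 ⟨0, by rw [h, zero_smul]⟩
    exact Submodule.smul_mem _ _ (Submodule.mem_span_singleton_self φ)
  · have : {ψ : TopChiralVerma q c | IsTopGSingular m n ψ} = ∅ :=
      Set.eq_empty_iff_forall_notMem.2 fun ψ hψ => hex ⟨ψ, hψ⟩
    rw [this, Submodule.span_empty, rank_bot]
    exact zero_le

end TopGen
end

/-! ### Transport of cyclic modules along isomorphisms of algebras. -/

noncomputable section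

section Quotients

variable {A B : Type*} [Ring A] [Algebra ℂ A] [Ring B] [Algebra ℂ B]

lemma map_mem_of_mem_span (e : A →ₐ[ℂ] B) {S : Set A} {J : Submodule B B}
    (h : ∀ a ∈ S, e a ∈ J) {a : A} (ha : a ∈ Submodule.span A S) : e a ∈ J := by
  induction ha using Submodule.span_induction with
  | mem a ha => exact h a ha
  | zero => rw [map_zero]; exact J.zero_mem
  | add a b _ _ ha hb => rw [map_add]; exact J.add_mem ha hb
  | smul r a _ ha => rw [smul_eq_mul, map_mul]; exact J.smul_mem _ ha

/-- The map of cyclic modules induced by a homomorphism of algebras. -/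
def quotientMap (e : A →ₐ[ℂ] B) {I : Submodule A A} {J : Submodule B B} (h : ∀ a ∈ I, e a ∈ J) :
    (A ⧸ I) →ₛₗ[(e : A →+* B)] B ⧸ J :=
  I.mapQ J (e : A →+* B).toSemilinearMap h

/-- The isomorphism of cyclic modules induced by an isomorphism of algebras. -/
def quotientEquiv (e : A ≃ₐ[ℂ] B) {I : Submodule A A} {J : Submodule B B} (h : ∀ a ∈ I, e a ∈ J)
    (h' : ∀ b ∈ J, e.symm b ∈ I) : (A ⧸ I) ≃ₗ[ℂ] B ⧸ J where
  toFun := quotientMap e.toAlgHom h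
  map_add' := map_add _
  map_smul' t x := by
    rw [← algebraMap_smul A t x, map_smulₛₗ, RingHom.id_apply, ← algebraMap_smul B t]
    congr 1
    exact e.commutes t
  invFun := quotientMap e.symm.toAlgHom h'
  left_inv x := by
    obtain ⟨a, rfl⟩ := Submodule.Quotient.mk_surjective _ x
    exact congrArg Submodule.Quotient.mk (e.symm_apply_apply a)
  right_inv x := by
    obtain ⟨a, rfl⟩ := Submodule.Quotient.mk_surjective _ x
    exact congrArg Submodule.Quotient.mk (e.apply_symm_apply a)

variable (e : A ≃ₐ[ℂ] B) {I : Submodule A A} {J : Submodule B B} (h : ∀ a ∈ I, e a ∈ J)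
  (h' : ∀ b ∈ J, e.symm b ∈ I)

lemma quotientEquiv_smul (a : A) (x : A ⧸ I) :
    quotientEquiv e h h' (a • x) = e a • quotientEquiv e h h' x :=
  map_smulₛₗ (quotientMap e.toAlgHom h) a x

lemma quotientEquiv_mk_one :
    quotientEquiv e h h' (Submodule.Quotient.mk 1) = Submodule.Quotient.mk 1 :=
  congrArg Submodule.Quotient.mk (map_one e)

end Quotients

/-- The elements of an algebra that annihilate a vector. -/
def annihilating {A V : Type*} [Ring A] [Algebra ℂ A] [AddCommGroup V] [Module A V] (v : V) :
    Submodule ℂ A :=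
  (LinearMap.ker (LinearMap.toSpanSingleton A V v)).restrictScalars ℂ

lemma mem_annihilating {A V : Type*} [Ring A] [Algebra ℂ A] [AddCommGroup V] [Module A V] {v : V}
    {a : A} : a ∈ annihilating v ↔ a • v = 0 := Iff.rfl

lemma rank_span_eq {V W : Type} [AddCommGroup V] [Module ℂ V] [AddCommGroup W] [Module ℂ W]
    (f : V ≃ₗ[ℂ] W) {S : Set V} {T : Set W} (h : ∀ x, f x ∈ T ↔ x ∈ S) :
    Module.rank ℂ (Submodule.span ℂ T) = Module.rank ℂ (Submodule.span ℂ S) := by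
  have : T = f '' S := by
    ext y
    obtain ⟨x, rfl⟩ := f.surjective y
    rw [h, f.injective.mem_set_image]
  rw [this, ← LinearEquiv.coe_coe, ← Submodule.map_span]
  exact f.rank_map_eq _

section NSAlgebra

lemma nsProj_rel {a b : FreeAlgebra ℂ NSGen} (h : NSRel a b) : nsProj a = nsProj b :=
  RingQuot.mkAlgHom_rel ℂ h

lemma nsProj_gen (x : NSGen) : nsProj (nsGen x) = nsOp x := rfl

lemma topProj_gen (x : TopGen) : topProj (topGen x) = topOp x := rfl

/-- The homomorphism from the enveloping algebra with given values on the generators. -/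
def nsLift {A : Type*} [Ring A] [Algebra ℂ A] (t : NSGen → A)
    (h : ∀ a b, NSRel a b → FreeAlgebra.lift ℂ t a = FreeAlgebra.lift ℂ t b) :
    NSAlgebra →ₐ[ℂ] A :=
  RingQuot.liftAlgHom ℂ (s := NSRel) ⟨FreeAlgebra.lift ℂ t, fun {a b} => h a b⟩

lemma nsLift_nsOp {A : Type*} [Ring A] [Algebra ℂ A] {t : NSGen → A}
    (h : ∀ a b, NSRel a b → FreeAlgebra.lift ℂ t a = FreeAlgebra.lift ℂ t b) (x : NSGen) :
    nsLift t h (nsOp x) = t x :=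
  (RingQuot.liftAlgHom_mkAlgHom_apply ℂ _ _ _).trans (FreeAlgebra.lift_ι_apply _ _)

lemma nsAlgebra_hom_ext {A : Type*} [Ring A] [Algebra ℂ A] {f g : NSAlgebra →ₐ[ℂ] A}
    (h : ∀ x, f (nsOp x) = g (nsOp x)) : f = g :=
  RingQuot.ringQuot_ext' ℂ _ _ (FreeAlgebra.hom_ext (funext h))

lemma topAlgebra_hom_ext {A : Type*} [Ring A] [Algebra ℂ A] {f g : TopAlgebra →ₐ[ℂ] A}
    (h : ∀ x, f (topOp x) = g (topOp x)) : f = g :=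
  RingQuot.ringQuot_ext' ℂ _ _ (FreeAlgebra.hom_ext (funext h))

end NSAlgebra
end

/-! ### The topological twist and the mirror automorphism. -/

noncomputable section

set_option linter.unusedSimpArgs false

/-- The images of the topological generators under the topological twist. -/
def twistGen : TopGen → NSAlgebra
  | .L m => nsOp (.L m) + (((m : ℂ) + 1) / 2) • nsOp (.H m)
  | .H m => nsOp (.H m)
  | .G m => nsOp (.Gp m)
  -- The index `m - 1` encodes the half-integral mode `m - 1/2`; in particular `Q₀` becomes
  -- `G⁻_{-1/2}`.
  | .Q m => nsOp (.Gm (m - 1))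
  | .C => nsOp .C

/-- The images of the Neveu-Schwarz generators under the inverse of the topological twist. -/
def untwistGen : NSGen → TopAlgebra
  | .L m => topOp (.L m) - (((m : ℂ) + 1) / 2) • topOp (.H m)
  | .H m => topOp (.H m)
  | .Gp k => topOp (.G k)
  | .Gm k => topOp (.Q (k + 1))
  | .C => topOp .C

/-- The images of the Neveu-Schwarz generators under the mirror automorphism. -/
def mirrorGen : NSGen → NSAlgebra
  | .L m => nsOp (.L m)
  | .H m => -nsOp (.H m)
  | .Gp k => nsOp (.Gm k)
  | .Gm k => nsOp (.Gp k)
  | .C => nsOp .C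

section Relations

lemma nsOp_LL (m n : ℤ) : nsOp (.L m) * nsOp (.L n) - nsOp (.L n) * nsOp (.L m) =
    ((m : ℂ) - n) • nsOp (.L (m + n))
      + (if m + n = 0 then ((m : ℂ) ^ 3 - m) / 12 else 0) • nsOp .C := by
  simpa only [map_add, map_sub, map_mul, map_smul, nsProj_gen] using nsProj_rel (.LL m n)

lemma nsOp_HH (m n : ℤ) : nsOp (.H m) * nsOp (.H n) - nsOp (.H n) * nsOp (.H m) =
    (if m + n = 0 then (m : ℂ) / 3 else 0) • nsOp .C := by
  simpa only [map_add, map_sub, map_mul, map_smul, nsProj_gen] using nsProj_rel (.HH m n)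

lemma nsOp_LH (m n : ℤ) : nsOp (.L m) * nsOp (.H n) - nsOp (.H n) * nsOp (.L m) =
    (-(n : ℂ)) • nsOp (.H (m + n)) := by
  simpa only [map_add, map_sub, map_mul, map_smul, nsProj_gen] using nsProj_rel (.LH m n)

lemma nsOp_LGp (m k : ℤ) : nsOp (.L m) * nsOp (.Gp k) - nsOp (.Gp k) * nsOp (.L m) =
    ((m : ℂ) / 2 - (k + 1 / 2)) • nsOp (.Gp (m + k)) := by
  simpa only [map_add, map_sub, map_mul, map_smul, nsProj_gen] using nsProj_rel (.LGp m k)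

lemma nsOp_LGm (m k : ℤ) : nsOp (.L m) * nsOp (.Gm k) - nsOp (.Gm k) * nsOp (.L m) =
    ((m : ℂ) / 2 - (k + 1 / 2)) • nsOp (.Gm (m + k)) := by
  simpa only [map_add, map_sub, map_mul, map_smul, nsProj_gen] using nsProj_rel (.LGm m k)

lemma nsOp_HGp (m k : ℤ) : nsOp (.H m) * nsOp (.Gp k) - nsOp (.Gp k) * nsOp (.H m) =
    nsOp (.Gp (m + k)) := by
  simpa only [map_add, map_sub, map_mul, map_smul, nsProj_gen] using nsProj_rel (.HGp m k)

lemma nsOp_HGm (m k : ℤ) : nsOp (.H m) * nsOp (.Gm k) - nsOp (.Gm k) * nsOp (.H m) =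
    -nsOp (.Gm (m + k)) := by
  simpa only [map_neg, map_sub, map_mul, map_smul, nsProj_gen] using nsProj_rel (.HGm m k)

lemma nsOp_GpGm (k l : ℤ) : nsOp (.Gp k) * nsOp (.Gm l) + nsOp (.Gm l) * nsOp (.Gp k) =
    (2 : ℂ) • nsOp (.L (k + l + 1)) + ((k : ℂ) - l) • nsOp (.H (k + l + 1))
      + (if k + l + 1 = 0 then (((k : ℂ) + 1 / 2) ^ 2 - 1 / 4) / 3 else 0) • nsOp .C := by
  simpa only [map_add, map_sub, map_mul, map_smul, nsProj_gen] using nsProj_rel (.GpGm k l)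

lemma nsOp_GpGp (k l : ℤ) : nsOp (.Gp k) * nsOp (.Gp l) + nsOp (.Gp l) * nsOp (.Gp k) = 0 := by
  simpa only [map_add, map_sub, map_mul, map_zero, nsProj_gen] using nsProj_rel (.GpGp k l)

lemma nsOp_GmGm (k l : ℤ) : nsOp (.Gm k) * nsOp (.Gm l) + nsOp (.Gm l) * nsOp (.Gm k) = 0 := by
  simpa only [map_add, map_sub, map_mul, map_zero, nsProj_gen] using nsProj_rel (.GmGm k l)

lemma nsOp_central (x : NSGen) : nsOp .C * nsOp x = nsOp x * nsOp .C := by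
  simpa only [map_mul, nsProj_gen] using nsProj_rel (.central x)

lemma topOp_LL (m n : ℤ) : topOp (.L m) * topOp (.L n) - topOp (.L n) * topOp (.L m) =
    ((m : ℂ) - n) • topOp (.L (m + n)) := by
  simpa only [map_add, map_sub, map_mul, map_smul, topProj_gen] using
    TopGen.topProj_rel (.LL m n)

lemma topOp_HH (m n : ℤ) : topOp (.H m) * topOp (.H n) - topOp (.H n) * topOp (.H m) =
    (if m + n = 0 then (m : ℂ) / 3 else 0) • topOp .C := by
  simpa only [map_add, map_sub, map_mul, map_smul, topProj_gen] using
    TopGen.topProj_rel (.HH m n)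

lemma topOp_LG (m n : ℤ) : topOp (.L m) * topOp (.G n) - topOp (.G n) * topOp (.L m) =
    ((m : ℂ) - n) • topOp (.G (m + n)) := by
  simpa only [map_add, map_sub, map_mul, map_smul, topProj_gen] using
    TopGen.topProj_rel (.LG m n)

lemma topOp_HG (m n : ℤ) : topOp (.H m) * topOp (.G n) - topOp (.G n) * topOp (.H m) =
    topOp (.G (m + n)) := by
  simpa only [map_add, map_sub, map_mul, map_smul, topProj_gen] using
    TopGen.topProj_rel (.HG m n)

lemma topOp_LQ (m n : ℤ) : topOp (.L m) * topOp (.Q n) - topOp (.Q n) * topOp (.L m) =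
    (-(n : ℂ)) • topOp (.Q (m + n)) := by
  simpa only [map_add, map_sub, map_mul, map_smul, topProj_gen] using
    TopGen.topProj_rel (.LQ m n)

lemma topOp_HQ (m n : ℤ) : topOp (.H m) * topOp (.Q n) - topOp (.Q n) * topOp (.H m) =
    -topOp (.Q (m + n)) := by
  simpa only [map_neg, map_sub, map_mul, map_smul, topProj_gen] using
    TopGen.topProj_rel (.HQ m n)

lemma topOp_LH (m n : ℤ) : topOp (.L m) * topOp (.H n) - topOp (.H n) * topOp (.L m) =
    (-(n : ℂ)) • topOp (.H (m + n))
      + (if m + n = 0 then ((m : ℂ) ^ 2 + m) / 6 else 0) • topOp .C := by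
  simpa only [map_add, map_sub, map_mul, map_smul, topProj_gen] using
    TopGen.topProj_rel (.LH m n)

lemma topOp_GQ (m n : ℤ) : topOp (.G m) * topOp (.Q n) + topOp (.Q n) * topOp (.G m) =
    (2 : ℂ) • topOp (.L (m + n)) - (2 * (n : ℂ)) • topOp (.H (m + n))
      + (if m + n = 0 then ((m : ℂ) ^ 2 + m) / 3 else 0) • topOp .C := by
  simpa only [map_add, map_sub, map_mul, map_smul, topProj_gen] using
    TopGen.topProj_rel (.GQ m n)

lemma topOp_GG (m n : ℤ) : topOp (.G m) * topOp (.G n) + topOp (.G n) * topOp (.G m) = 0 := by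
  simpa only [map_add, map_sub, map_mul, map_zero, topProj_gen] using
    TopGen.topProj_rel (.GG m n)

lemma topOp_QQ (m n : ℤ) : topOp (.Q m) * topOp (.Q n) + topOp (.Q n) * topOp (.Q m) = 0 := by
  simpa only [map_add, map_sub, map_mul, map_zero, topProj_gen] using
    TopGen.topProj_rel (.QQ m n)

lemma topOp_central (x : TopGen) : topOp .C * topOp x = topOp x * topOp .C := by
  simpa only [map_mul, topProj_gen] using TopGen.topProj_rel (.central x)

end Relations

/-- The topological twist. -/
def twist : TopAlgebra →ₐ[ℂ] NSAlgebra := TopGen.topLift twistGen (by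
  intro a b h
  cases h <;> simp only [map_add, map_sub, map_neg, map_mul, map_smul, map_zero, topGen,
    FreeAlgebra.lift_ι_apply, twistGen, mul_add, add_mul, smul_mul_assoc, mul_smul_comm]
  case LL m n =>
    have h4 := nsOp_LH n m
    rw [add_comm n m] at h4
    -- The bracket of the twisted generators expanded bilinearly; its central terms cancel exactly
    -- because the twist uses the coefficient `(m + 1)/2`.
    have key := congr($(nsOp_LL m n) + (((n : ℂ) + 1) / 2) • $(nsOp_LH m n)
      - (((m : ℂ) + 1) / 2) • $h4
      + (((m : ℂ) + 1) / 2 * (((n : ℂ) + 1) / 2)) • $(nsOp_HH m n))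
    refine Eq.trans ?_ (key.trans ?_)
    · module
    · push_cast
      split_ifs with h
      · obtain rfl : n = -m := by omega
        push_cast
        module
      · module
  case HH m n => exact nsOp_HH m n
  case LG m n =>
    have key := congr($(nsOp_LGp m n) + (((m : ℂ) + 1) / 2) • $(nsOp_HGp m n))
    refine Eq.trans ?_ (key.trans ?_) <;> module
  case HG m n => exact nsOp_HGp m n
  case LQ m n =>
    have key := congr($(nsOp_LGm m (n - 1)) + (((m : ℂ) + 1) / 2) • $(nsOp_HGm m (n - 1)))
    rw [← add_sub_assoc] at key
    refine Eq.trans ?_ (key.trans ?_)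
    · module
    · push_cast; module
  case HQ m n => rw [add_sub_assoc]; exact nsOp_HGm m (n - 1)
  case LH m n =>
    have key := congr($(nsOp_LH m n) + (((m : ℂ) + 1) / 2) • $(nsOp_HH m n))
    refine Eq.trans ?_ (key.trans ?_)
    · module
    · split_ifs <;> module
  case GQ m n =>
    rw [nsOp_GpGm, show m + (n - 1) + 1 = m + n by ring]
    push_cast
    split_ifs with h
    · obtain rfl : n = -m := by omega
      push_cast
      module
    · module
  case GG m n => exact nsOp_GpGp m n
  case QQ m n => exact nsOp_GmGm _ _
  case central x =>
    cases x <;> simp only [twistGen, mul_add, add_mul, smul_mul_assoc, mul_smul_comm, nsOp_central])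

/-- The inverse of the topological twist. -/
def untwist : NSAlgebra →ₐ[ℂ] TopAlgebra := nsLift untwistGen (by
  intro a b h
  cases h <;> simp only [map_add, map_sub, map_neg, map_mul, map_smul, map_zero, nsGen,
    FreeAlgebra.lift_ι_apply, untwistGen, mul_sub, sub_mul, smul_mul_assoc, mul_smul_comm]
  case LL m n =>
    have h4 := topOp_LH n m
    rw [add_comm n m] at h4
    have key := congr($(topOp_LL m n) - (((n : ℂ) + 1) / 2) • $(topOp_LH m n)
      + (((m : ℂ) + 1) / 2) • $h4
      + (((m : ℂ) + 1) / 2 * (((n : ℂ) + 1) / 2)) • $(topOp_HH m n))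
    refine Eq.trans ?_ (key.trans ?_)
    · module
    · push_cast
      split_ifs with h
      · obtain rfl : n = -m := by omega
        push_cast
        module
      · module
  case HH m n => exact topOp_HH m n
  case LGp m n =>
    have key := congr($(topOp_LG m n) - (((m : ℂ) + 1) / 2) • $(topOp_HG m n))
    refine Eq.trans ?_ (key.trans ?_) <;> module
  case HGp m n => exact topOp_HG m n
  case LGm m n =>
    have key := congr($(topOp_LQ m (n + 1)) - (((m : ℂ) + 1) / 2) • $(topOp_HQ m (n + 1)))
    rw [← add_assoc] at key
    refine Eq.trans ?_ (key.trans ?_)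
    · module
    · push_cast; module
  case HGm m n => rw [add_assoc]; exact topOp_HQ m (n + 1)
  case LH m n =>
    have key := congr($(topOp_LH m n) - (((m : ℂ) + 1) / 2) • $(topOp_HH m n))
    refine Eq.trans ?_ (key.trans ?_)
    · module
    · split_ifs <;> module
  case GpGm m n =>
    rw [topOp_GQ, ← add_assoc]
    push_cast
    split_ifs with h
    · obtain rfl : n = -m - 1 := by omega
      push_cast
      module
    · module
  case GpGp m n => exact topOp_GG m n
  case GmGm m n => exact topOp_QQ _ _
  case central x =>
    cases x <;> simp only [untwistGen, mul_sub, sub_mul, smul_mul_assoc, mul_smul_comm,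
      topOp_central])

/-- The mirror automorphism. -/
def mirror : NSAlgebra →ₐ[ℂ] NSAlgebra := nsLift mirrorGen (by
  intro a b h
  cases h <;> simp only [map_add, map_sub, map_neg, map_mul, map_smul, map_zero, nsGen,
    FreeAlgebra.lift_ι_apply, mirrorGen, mul_neg, neg_mul, neg_neg]
  case LL m n => exact nsOp_LL m n
  case HH m n => exact nsOp_HH m n
  case LH m n =>
    rw [smul_neg, ← nsOp_LH]
    abel
  case LGp m n => exact nsOp_LGm m n
  case HGp m n =>
    rw [← neg_eq_iff_eq_neg.2 (nsOp_HGm m n)]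
    abel
  case LGm m n => exact nsOp_LGp m n
  case HGm m n =>
    rw [← nsOp_HGp m n]
    abel
  case GpGm m n =>
    have h := nsOp_GpGm n m
    rw [add_comm n m] at h
    rw [add_comm, h]
    split_ifs with h
    · obtain rfl : n = -m - 1 := by omega
      push_cast
      module
    · module
  case GpGp m n => exact nsOp_GmGm m n
  case GmGm m n => exact nsOp_GpGp _ _
  case central x => cases x <;> simp only [mirrorGen, mul_neg, neg_mul, nsOp_central])

lemma twist_topOp (x : TopGen) : twist (topOp x) = twistGen x := TopGen.topLift_topOp _ x

lemma untwist_nsOp (x : NSGen) : untwist (nsOp x) = untwistGen x := nsLift_nsOp _ x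

lemma mirror_nsOp (x : NSGen) : mirror (nsOp x) = mirrorGen x := nsLift_nsOp _ x

/-- The topological and the Neveu-Schwarz algebra are isomorphic. -/
def twistEquiv : TopAlgebra ≃ₐ[ℂ] NSAlgebra :=
  AlgEquiv.ofAlgHom twist untwist
    (nsAlgebra_hom_ext fun x => by
      cases x <;> simp [untwist_nsOp, untwistGen, twist_topOp, twistGen])
    (topAlgebra_hom_ext fun x => by
      cases x <;> simp [untwist_nsOp, untwistGen, twist_topOp, twistGen])

/-- The mirror automorphism as an isomorphism. -/
def mirrorEquiv : NSAlgebra ≃ₐ[ℂ] NSAlgebra :=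
  AlgEquiv.ofAlgHom mirror mirror
    (nsAlgebra_hom_ext fun x => by cases x <;> simp [mirror_nsOp, mirrorGen])
    (nsAlgebra_hom_ext fun x => by cases x <;> simp [mirror_nsOp, mirrorGen])

end

/-! ### Singular vectors of antichiral Verma modules, via the twist. -/

noncomputable section

open TopGen (IsClosed)

/-- A twisted positive mode is a combination of positive modes. An arbitrary complex subspace `S` is
allowed so that the lemma serves both for the defining ideal and for the annihilator of a vector. -/
lemma twist_mem {S : Submodule ℂ NSAlgebra} (h : nsPositive ⊆ S) {a : TopAlgebra}
    (ha : a ∈ topPositive ∪ {topOp (.G 0)}) : twist a ∈ S := by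
  have hL : ∀ k : ℤ, 0 < k → nsOp (.L k) ∈ S := fun k hk => h ⟨k, by simp [hk]⟩
  have hH : ∀ k : ℤ, 0 < k → nsOp (.H k) ∈ S := fun k hk => h ⟨k, by simp [hk]⟩
  have hGp : ∀ k : ℤ, 0 ≤ k → nsOp (.Gp k) ∈ S := fun k hk => h ⟨k, by simp [hk]⟩
  have hGm : ∀ k : ℤ, 0 ≤ k → nsOp (.Gm k) ∈ S := fun k hk => h ⟨k, by simp [hk]⟩
  rcases ha with ⟨k, hk, rfl | rfl | rfl | rfl⟩ | rfl <;> rw [twist_topOp]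
  · exact S.add_mem (hL k hk) (S.smul_mem _ (hH k hk))
  · exact hH k hk
  · exact hGp k hk.le
  · exact hGm (k - 1) (by omega)
  · exact hGp 0 le_rfl

lemma untwist_mem {S : Submodule ℂ TopAlgebra} (h : topPositive ∪ {topOp (.G 0)} ⊆ (S : Set _))
    {a : NSAlgebra} (ha : a ∈ nsPositive) : untwist a ∈ S := by
  have hL : ∀ k : ℤ, 0 < k → topOp (.L k) ∈ S := fun k hk => h (Or.inl ⟨k, by simp [hk]⟩)
  have hH : ∀ k : ℤ, 0 < k → topOp (.H k) ∈ S := fun k hk => h (Or.inl ⟨k, by simp [hk]⟩)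
  have hG : ∀ k : ℤ, 0 ≤ k → topOp (.G k) ∈ S := fun k hk => by
    rcases hk.eq_or_lt with rfl | hk
    · exact h (Or.inr rfl)
    · exact h (Or.inl ⟨k, by simp [hk]⟩)
  have hQ : ∀ k : ℤ, 0 < k → topOp (.Q k) ∈ S := fun k hk => h (Or.inl ⟨k, by simp [hk]⟩)
  rcases ha with ⟨k, ⟨hk, rfl | rfl⟩ | ⟨hk, rfl | rfl⟩⟩ <;> rw [untwist_nsOp]
  · exact S.sub_mem (hL k hk) (S.smul_mem _ (hH k hk))
  · exact hH k hk
  · exact hG k hk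
  · exact hQ (k + 1) (by omega)

lemma mirror_mem {S : Submodule ℂ NSAlgebra} (h : nsPositive ⊆ S) {a : NSAlgebra}
    (ha : a ∈ nsPositive) : mirror a ∈ S := by
  rcases ha with ⟨k, ⟨hk, rfl | rfl⟩ | ⟨hk, rfl | rfl⟩⟩ <;> rw [mirror_nsOp]
  · exact h ⟨k, by simp [mirrorGen, hk]⟩
  · exact S.neg_mem (h ⟨k, by simp [hk]⟩)
  · exact h ⟨k, by simp [mirrorGen, hk]⟩
  · exact h ⟨k, by simp [mirrorGen, hk]⟩

section Antichiral

variable {Δ q c : ℂ}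

lemma nsPositive_subset (Δ q c : ℂ) (N : Set NSAlgebra) :
    nsPositive ⊆ ((nsIdeal Δ q c N).restrictScalars ℂ : Set NSAlgebra) :=
  fun _ ha => Submodule.subset_span (Or.inl (Or.inl ha))

/-- The condition `Δ = -q/2` says that `L₀ + H₀/2`, the image of the topological `L₀`, kills the
highest weight vector. Keeping it as an equation allows `Δ = q/2` with charge `-q`, as the mirror
requires. -/
lemma twist_mem_ideal (hΔ : Δ = -q / 2) (a : TopAlgebra) (ha : a ∈ topChiralIdeal q c) :
    twist a ∈ nsIdeal Δ q c nsAntichiral := by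
  have hL : nsOp (.L 0) - algebraMap ℂ NSAlgebra Δ ∈ nsIdeal Δ q c nsAntichiral :=
    Submodule.subset_span (by simp)
  have hH : nsOp (.H 0) - algebraMap ℂ NSAlgebra q ∈ nsIdeal Δ q c nsAntichiral :=
    Submodule.subset_span (by simp)
  have hC : nsOp .C - algebraMap ℂ NSAlgebra c ∈ nsIdeal Δ q c nsAntichiral :=
    Submodule.subset_span (by simp)
  refine map_mem_of_mem_span twist (fun a ha => ?_) ha
  rcases ha with ha | rfl | rfl | rfl | rfl | rfl
  · exact twist_mem (nsPositive_subset Δ q c _) (Or.inl ha)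
  · exact twist_mem (nsPositive_subset Δ q c _) (Or.inr rfl)
  · rw [twist_topOp]
    exact Submodule.subset_span (Or.inl (Or.inr rfl))
  · rw [twist_topOp]
    have h := Submodule.add_mem ((nsIdeal Δ q c nsAntichiral).restrictScalars ℂ) hL
      (Submodule.smul_mem _ (1 / 2 : ℂ) hH)
    rw [Submodule.restrictScalars_mem] at h
    convert h using 1
    simp only [twistGen, Int.cast_zero, zero_add, Algebra.algebraMap_eq_smul_one, hΔ]
    module
  · rw [map_sub, AlgHom.commutes, twist_topOp]; exact hH
  · rw [map_sub, AlgHom.commutes, twist_topOp]; exact hC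

lemma untwist_mem_ideal (hΔ : Δ = -q / 2) (a : NSAlgebra) (ha : a ∈ nsIdeal Δ q c nsAntichiral) :
    untwist a ∈ topChiralIdeal q c := by
  have hL : topOp (.L 0) ∈ topChiralIdeal q c := Submodule.subset_span (by simp)
  have hH : topOp (.H 0) - algebraMap ℂ TopAlgebra q ∈ topChiralIdeal q c :=
    Submodule.subset_span (by simp)
  have hC : topOp .C - algebraMap ℂ TopAlgebra c ∈ topChiralIdeal q c :=
    Submodule.subset_span (by simp)
  refine map_mem_of_mem_span untwist (fun a ha => ?_) ha
  rcases ha with (ha | rfl) | rfl | rfl | rfl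
  · refine untwist_mem (S := (topChiralIdeal q c).restrictScalars ℂ) ?_ ha
    rintro b (hb | rfl)
    · exact Submodule.subset_span (Or.inl hb)
    · exact Submodule.subset_span (by simp)
  · rw [untwist_nsOp]
    exact Submodule.subset_span (by simp [untwistGen])
  · rw [map_sub, AlgHom.commutes, untwist_nsOp]
    have h := Submodule.sub_mem ((topChiralIdeal q c).restrictScalars ℂ) hL
      (Submodule.smul_mem _ (1 / 2 : ℂ) hH)
    rw [Submodule.restrictScalars_mem] at h
    convert h using 1
    simp only [untwistGen, Int.cast_zero, zero_add, Algebra.algebraMap_eq_smul_one, hΔ]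
    module
  · rw [map_sub, AlgHom.commutes, untwist_nsOp]; exact hH
  · rw [map_sub, AlgHom.commutes, untwist_nsOp]; exact hC

/-- The chiral topological Verma module is the twisted antichiral Verma module. -/
def vermaTwist (c : ℂ) (hΔ : Δ = -q / 2) : TopChiralVerma q c ≃ₗ[ℂ] NSVerma Δ q c nsAntichiral :=
  quotientEquiv twistEquiv (twist_mem_ideal hΔ) (untwist_mem_ideal hΔ)

lemma vermaTwist_smul (hΔ : Δ = -q / 2) (a : TopAlgebra) (ψ : TopChiralVerma q c) :
    vermaTwist c hΔ (a • ψ) = twist a • vermaTwist c hΔ ψ :=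
  quotientEquiv_smul twistEquiv (twist_mem_ideal hΔ) (untwist_mem_ideal hΔ) a ψ

lemma vermaTwist_untwist_smul (hΔ : Δ = -q / 2) (a : NSAlgebra) (ψ : TopChiralVerma q c) :
    vermaTwist c hΔ (untwist a • ψ) = a • vermaTwist c hΔ ψ := by
  rw [vermaTwist_smul]
  congr 1
  exact twistEquiv.apply_symm_apply a

lemma vermaTwist_hw (hΔ : Δ = -q / 2) :
    vermaTwist c hΔ (topChiralHW q c) = nsHW Δ q c nsAntichiral :=
  quotientEquiv_mk_one twistEquiv (twist_mem_ideal hΔ) (untwist_mem_ideal hΔ)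

/-- The topological `L₀` is `L₀ + H₀/2`, so a vector of charge `n` gains `n/2` in level. Closedness
under `G₀` is annihilation by `G⁺_{1/2}`. -/
lemma isClosed_of_vermaTwist (hΔ : Δ = -q / 2) {m : ℚ} {n : ℤ} {ψ : TopChiralVerma q c}
    (h : IsNSSingular ∅ m n (vermaTwist c hΔ ψ)) : IsClosed (m + n / 2) n ψ := by
  have key : topPositive ∪ {topOp (.G 0)} ⊆ ((annihilating ψ : Submodule ℂ TopAlgebra) : Set TopAlgebra) := fun a ha => by
    refine mem_annihilating.2 ((vermaTwist c hΔ).injective ?_)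
    rw [vermaTwist_smul, map_zero]
    exact mem_annihilating.1 (twist_mem (S := annihilating _) h.positive ha)
  refine ⟨?_, ?_, fun a ha => key (Or.inl ha), key (Or.inr rfl)⟩
  · apply (vermaTwist c hΔ).injective
    rw [vermaTwist_smul, twist_topOp, twistGen, add_smul, smul_assoc, h.level, h.charge, map_smul,
      smul_smul, ← add_smul]
    congr 1
    rw [hΔ]
    push_cast
    ring
  · apply (vermaTwist c hΔ).injective
    rw [vermaTwist_smul, twist_topOp, twistGen, h.charge, map_smul]

lemma isNSSingular_vermaTwist (hΔ : Δ = -q / 2) {m : ℚ} {n : ℤ} {ψ : TopChiralVerma q c}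
    (h : IsClosed (m + n / 2) n ψ) (h0 : ¬ ∃ t : ℂ, ψ = t • topChiralHW q c) :
    IsNSSingular ∅ m n (vermaTwist c hΔ ψ) where
  level := by
    rw [← vermaTwist_untwist_smul, untwist_nsOp, untwistGen, sub_smul, smul_assoc, h.level,
      h.charge, ← map_smul]
    congr 1
    rw [hΔ]
    push_cast
    module
  charge := by rw [← vermaTwist_untwist_smul, untwist_nsOp, untwistGen, h.charge, map_smul]
  positive a ha := by
    rw [← vermaTwist_untwist_smul, mem_annihilating.1 (untwist_mem (S := annihilating ψ) ?_ ha),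
      map_zero]
    rintro b (hb | rfl)
    · exact h.positive b hb
    · exact h.g_closed
  extra a ha := ha.elim
  not_proportional := by
    rintro ⟨t, ht⟩
    rw [← vermaTwist_hw hΔ, ← map_smul] at ht
    exact h0 ⟨t, (vermaTwist c hΔ).injective ht⟩

lemma not_proportional_of_vermaTwist (hΔ : Δ = -q / 2) {ψ : TopChiralVerma q c}
    (h : ¬ ∃ t : ℂ, vermaTwist c hΔ ψ = t • nsHW Δ q c nsAntichiral) :
    ¬ ∃ t : ℂ, ψ = t • topChiralHW q c := by
  rintro ⟨t, rfl⟩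
  exact h ⟨t, by rw [map_smul, vermaTwist_hw]⟩

theorem nsSingularDim_antichiral (hc : c ≠ 3) (hΔ : Δ = -q / 2) (m : ℚ) (n : ℤ) :
    nsSingularDim Δ q c nsAntichiral ∅ m n = topGSingularDim q c (m + n / 2) n := by
  refine rank_span_eq (vermaTwist c hΔ) fun ψ => ⟨fun h => ?_, fun h => ?_⟩
  · exact (isClosed_of_vermaTwist hΔ h).isTopGSingular hc
      (not_proportional_of_vermaTwist hΔ h.not_proportional)
  · have h' := (TopGen.isTopGSingular_iff hc).1 h
    exact isNSSingular_vermaTwist hΔ h'.1 h'.2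

variable {N A : Set NSAlgebra} {m : ℚ} {n : ℤ}

lemma IsNSSingular.weaken {ψ : NSVerma Δ q c N} (h : IsNSSingular A m n ψ) :
    IsNSSingular ∅ m n ψ :=
  ⟨h.level, h.charge, h.positive, fun _ ha => ha.elim, h.not_proportional⟩

lemma nsSingularDim_le_empty : nsSingularDim Δ q c N A m n ≤ nsSingularDim Δ q c N ∅ m n :=
  Submodule.rank_mono (Submodule.span_mono fun _ h => IsNSSingular.weaken h)

lemma IsNSSingular.ne_zero {ψ : NSVerma Δ q c N} (h : IsNSSingular A m n ψ) : ψ ≠ 0 :=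
  fun h0 => h.not_proportional ⟨0, by rw [h0, zero_smul]⟩

theorem nsSingularDim_antichiral_le (hc : c ≠ 3) (hΔ : Δ = -q / 2) :
    nsSingularDim Δ q c nsAntichiral A m n ≤ if n = 0 ∨ n = 1 then 1 else 0 := by
  refine nsSingularDim_le_empty.trans ?_
  rw [nsSingularDim_antichiral hc hΔ]
  exact TopGen.topGSingularDim_le hc _ _

theorem IsNSSingular.antichiral_level_charge (hc : c ≠ 3) (hΔ : Δ = -q / 2)
    {ψ : NSVerma Δ q c nsAntichiral} (h : IsNSSingular A m n ψ) :
    (n = 0 ∨ n = 1) ∧ ∃ k : ℕ, 0 < k ∧ m + n / 2 = k := by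
  obtain ⟨φ, rfl⟩ := (vermaTwist c hΔ).surjective ψ
  exact (isClosed_of_vermaTwist hΔ h.weaken).charge_level hc
    (not_proportional_of_vermaTwist hΔ h.not_proportional)

/-- A relation between the weights of a vector annihilated by `G⁺_{k+1/2}` and `G⁻_{-k-1/2}`. -/
lemma IsNSSingular.weight_relation {ψ : NSVerma Δ q c N} (h : IsNSSingular A m n ψ) {k l : ℤ}
    (hkl : k + l + 1 = 0) (hk : k * (k + 1) = 0) (hp : nsOp (.Gp k) • ψ = 0)
    (hm : nsOp (.Gm l) • ψ = 0) : 2 * (Δ + m) + ((k : ℂ) - l) * (q + n) = 0 := by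
  have key := congrArg (· • ψ) (nsOp_GpGm k l)
  have hk' : (k : ℂ) * (k + 1) = 0 := by exact_mod_cast hk
  -- The condition `k (k + 1) = 0` means mode `±1/2`, exactly where the central term `r² - 1/4`
  -- vanishes.
  have hk'' : (((k : ℂ) + 1 / 2) ^ 2 - 1 / 4) / 3 = 0 := by linear_combination hk' / 3
  simp only [hkl, if_true, hk'', zero_smul, add_zero] at key
  rw [add_smul, mul_smul, mul_smul, hp, hm, smul_zero, smul_zero, add_zero, add_smul, smul_assoc,
    smul_assoc, h.level, h.charge, smul_smul, smul_smul, ← add_smul] at key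
  exact (smul_eq_zero.1 key.symm).resolve_right h.ne_zero

theorem IsNSSingular.antichiral_chiral (hΔ : Δ = -q / 2) {ψ : NSVerma Δ q c nsAntichiral}
    (h : IsNSSingular nsChiral m n ψ) : q = m - n / 2 := by
  have := h.weight_relation (k := -1) (l := 0) (by norm_num) (by norm_num) (h.extra _ rfl)
    (h.positive _ ⟨0, by simp⟩)
  rw [hΔ] at this
  push_cast at this
  linear_combination -this / 2

/-- Annihilation by `G⁺_{1/2}` and `G⁻_{-1/2}` forces the topological level `m + n/2` to vanish, but
it is positive for a singular vector. -/
theorem IsNSSingular.not_antichiral_antichiral (hc : c ≠ 3) (hΔ : Δ = -q / 2)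
    {ψ : NSVerma Δ q c nsAntichiral} : ¬ IsNSSingular nsAntichiral m n ψ := fun h => by
  have := h.weight_relation (k := 0) (l := -1) (by norm_num) (by norm_num)
    (h.positive _ ⟨0, by simp⟩) (h.extra _ rfl)
  obtain ⟨-, k, hk, hmn⟩ := h.antichiral_level_charge hc hΔ
  have hmn' : ((m + n / 2 : ℚ) : ℂ) = ((k : ℚ) : ℂ) := by rw [hmn]
  push_cast at hmn' this
  rw [hΔ] at this
  have hk0 : (k : ℂ) = 0 := by linear_combination this / 2 - hmn'
  exact hk.ne' (by exact_mod_cast hk0)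

end Antichiral

/-! ### Exchange of chiral and antichiral Verma modules. -/

section Mirror

variable {Δ q c : ℂ} {N N' A A' : Set NSAlgebra}

lemma mirror_mirror (a : NSAlgebra) : mirror (mirror a) = a := mirrorEquiv.apply_symm_apply a

lemma mirror_mem_ideal (hN : ∀ a ∈ N, mirror a ∈ N') (a : NSAlgebra) (ha : a ∈ nsIdeal Δ q c N) :
    mirror a ∈ nsIdeal Δ (-q) c N' := by
  refine map_mem_of_mem_span mirror (fun a ha => ?_) ha
  rcases ha with (ha | ha) | rfl | rfl | rfl
  · exact mirror_mem (nsPositive_subset Δ (-q) c _) ha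
  · exact Submodule.subset_span (Or.inl (Or.inr (hN a ha)))
  · rw [map_sub, AlgHom.commutes, mirror_nsOp]
    exact Submodule.subset_span (by simp [mirrorGen])
  · have hH : nsOp (.H 0) - algebraMap ℂ NSAlgebra (-q) ∈ nsIdeal Δ (-q) c N' :=
      Submodule.subset_span (by simp)
    rw [map_sub, AlgHom.commutes, mirror_nsOp]
    convert Submodule.neg_mem _ hH using 1
    rw [mirrorGen, map_neg]
    abel
  · rw [map_sub, AlgHom.commutes, mirror_nsOp]
    exact Submodule.subset_span (by simp [mirrorGen])

lemma mirror_mem_ideal' (hN : ∀ a ∈ N', mirror a ∈ N) (a : NSAlgebra)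
    (ha : a ∈ nsIdeal Δ (-q) c N') : mirror a ∈ nsIdeal Δ q c N := by
  simpa using mirror_mem_ideal hN a ha

/-- The mirror map of Verma modules. -/
def vermaMirror (Δ q c : ℂ) (hN : ∀ a ∈ N, mirror a ∈ N') (hN' : ∀ a ∈ N', mirror a ∈ N) :
    NSVerma Δ q c N ≃ₗ[ℂ] NSVerma Δ (-q) c N' :=
  quotientEquiv mirrorEquiv (mirror_mem_ideal hN) (mirror_mem_ideal' hN')

variable (hN : ∀ a ∈ N, mirror a ∈ N') (hN' : ∀ a ∈ N', mirror a ∈ N)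

lemma vermaMirror_smul (a : NSAlgebra) (ψ : NSVerma Δ q c N) :
    vermaMirror Δ q c hN hN' (a • ψ) = mirror a • vermaMirror Δ q c hN hN' ψ :=
  quotientEquiv_smul mirrorEquiv (mirror_mem_ideal hN) (mirror_mem_ideal' hN') a ψ

lemma vermaMirror_hw : vermaMirror Δ q c hN hN' (nsHW Δ q c N) = nsHW Δ (-q) c N' :=
  quotientEquiv_mk_one mirrorEquiv (mirror_mem_ideal hN) (mirror_mem_ideal' hN')

lemma smul_vermaMirror (a : NSAlgebra) (ψ : NSVerma Δ q c N) :
    a • vermaMirror Δ q c hN hN' ψ = vermaMirror Δ q c hN hN' (mirror a • ψ) := by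
  rw [vermaMirror_smul, mirror_mirror]

/-- The mirror fixes `L₀` and negates `H₀`, so levels persist and charges change sign, while the set
of positive modes is preserved up to signs. -/
theorem isNSSingular_vermaMirror (hA : ∀ a ∈ A, mirror a ∈ A') (hA' : ∀ a ∈ A', mirror a ∈ A)
    {m : ℚ} {n : ℤ} {ψ : NSVerma Δ q c N} :
    IsNSSingular A' m (-n) (vermaMirror Δ q c hN hN' ψ) ↔ IsNSSingular A m n ψ := by
  set f := vermaMirror Δ q c hN hN'
  have hpos : (∀ a ∈ nsPositive, a • f ψ = 0) ↔ ∀ a ∈ nsPositive, a • ψ = 0 := by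
    refine ⟨fun h a ha => f.injective ?_, fun h a ha => ?_⟩
    · rw [vermaMirror_smul, map_zero]
      exact mem_annihilating.1 (mirror_mem (S := annihilating (f ψ)) h ha)
    · rw [smul_vermaMirror, mem_annihilating.1 (mirror_mem (S := annihilating ψ) h ha), map_zero]
  have hext : (∀ a ∈ A', a • f ψ = 0) ↔ ∀ a ∈ A, a • ψ = 0 := by
    refine ⟨fun h a ha => f.injective ?_, fun h a ha => ?_⟩
    · rw [vermaMirror_smul, map_zero, h _ (hA a ha)]
    · rw [smul_vermaMirror, h _ (hA' a ha), map_zero]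
  have hprop : (∃ t : ℂ, f ψ = t • nsHW Δ (-q) c N') ↔ ∃ t : ℂ, ψ = t • nsHW Δ q c N := by
    refine exists_congr fun t => ?_
    rw [← vermaMirror_hw hN hN', ← map_smul]
    exact f.injective.eq_iff
  have hlev : nsOp (.L 0) • f ψ = (Δ + m) • f ψ ↔ nsOp (.L 0) • ψ = (Δ + m) • ψ := by
    rw [smul_vermaMirror, ← map_smul, f.injective.eq_iff, mirror_nsOp, mirrorGen]
  have hch : nsOp (.H 0) • f ψ = (-q + (-n : ℤ)) • f ψ ↔ nsOp (.H 0) • ψ = (q + n) • ψ := by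
    rw [smul_vermaMirror, ← map_smul, f.injective.eq_iff, mirror_nsOp, mirrorGen, neg_smul,
      show -q + ((-n : ℤ) : ℂ) = -(q + n) by push_cast; ring, neg_smul, neg_inj]
  exact ⟨fun h => ⟨hlev.1 h.level, hch.1 h.charge, hpos.1 h.positive, hext.1 h.extra,
      fun h' => h.not_proportional (hprop.2 h')⟩,
    fun h => ⟨hlev.2 h.level, hch.2 h.charge, hpos.2 h.positive, hext.2 h.extra,
      fun h' => h.not_proportional (hprop.1 h')⟩⟩

theorem nsSingularDim_mirror (hN : ∀ a ∈ N, mirror a ∈ N') (hN' : ∀ a ∈ N', mirror a ∈ N)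
    (hA : ∀ a ∈ A, mirror a ∈ A') (hA' : ∀ a ∈ A', mirror a ∈ A) (m : ℚ) (n : ℤ) :
    nsSingularDim Δ q c N A m n = nsSingularDim Δ (-q) c N' A' m (-n) :=
  (rank_span_eq (vermaMirror Δ q c hN hN') fun _ =>
    isNSSingular_vermaMirror hN hN' hA hA').symm

lemma mirror_chiral : ∀ a ∈ nsChiral, mirror a ∈ nsAntichiral := by
  rintro _ rfl
  rw [mirror_nsOp]
  rfl

lemma mirror_antichiral : ∀ a ∈ nsAntichiral, mirror a ∈ nsChiral := by
  rintro _ rfl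
  rw [mirror_nsOp]
  rfl

end Mirror

/-! ### The theorem. -/

theorem mainTheorem10 (q c : ℂ) (hc : c ≠ 3) (m : ℚ) (n : ℤ) :
    -- dimensions agree with those of the corresponding topological singular vectors
    nsSingularDim (q / 2) q c nsChiral ∅ m n = topGSingularDim (-q) c (m - n / 2) (-n) ∧
    nsSingularDim (-q / 2) q c nsAntichiral ∅ m n = topGSingularDim q c (m + n / 2) n ∧
    topGSingularDim q c m n ≤ (if n = 0 ∨ n = 1 then 1 else 0) ∧
    -- upper limits for all singular vectors, and for antichiral ones, in chiral Verma modules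
    nsSingularDim (q / 2) q c nsChiral ∅ m n ≤ (if n = -1 ∨ n = 0 then 1 else 0) ∧
    nsSingularDim (q / 2) q c nsChiral nsAntichiral m n ≤ (if n = -1 ∨ n = 0 then 1 else 0) ∧
    -- upper limits for all singular vectors, and for chiral ones, in antichiral Verma modules
    nsSingularDim (-q / 2) q c nsAntichiral ∅ m n ≤ (if n = 0 ∨ n = 1 then 1 else 0) ∧
    nsSingularDim (-q / 2) q c nsAntichiral nsChiral m n ≤ (if n = 0 ∨ n = 1 then 1 else 0) ∧
    -- charges and levels at which singular vectors can exist
    (∀ ψ : NSChiralVerma q c, IsNSSingular ∅ m n ψ →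
      (n = 0 ∧ ∃ k : ℕ, 0 < k ∧ m = k) ∨ (n = -1 ∧ ∃ k : ℕ, 0 < k ∧ m = k - 1 / 2)) ∧
    (∀ ψ : NSAntichiralVerma q c, IsNSSingular ∅ m n ψ →
      (n = 0 ∧ ∃ k : ℕ, 0 < k ∧ m = k) ∨ (n = 1 ∧ ∃ k : ℕ, 0 < k ∧ m = k - 1 / 2)) ∧
    -- the weight of antichiral (chiral) singular vectors in chiral (antichiral) Verma modules
    (∀ ψ : NSChiralVerma q c, IsNSSingular nsAntichiral m n ψ → q = -m - n / 2) ∧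
    (∀ ψ : NSAntichiralVerma q c, IsNSSingular nsChiral m n ψ → q = m - n / 2) ∧
    -- no chiral (antichiral) singular vectors in chiral (antichiral) Verma modules
    (¬ ∃ ψ : NSChiralVerma q c, IsNSSingular nsChiral m n ψ) ∧
    (¬ ∃ ψ : NSAntichiralVerma q c, IsNSSingular nsAntichiral m n ψ) := by
  -- The chiral condition for `q` is the antichiral condition for `-q`, so the chiral assertions
  -- follow from the antichiral ones applied to the mirror module.
  have hΔ : q / 2 = -(-q) / 2 := by ring
  have hempty : ∀ a ∈ (∅ : Set NSAlgebra), mirror a ∈ (∅ : Set NSAlgebra) := fun _ h => h.elim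
  have hdim : nsSingularDim (q / 2) q c nsChiral ∅ m n =
      nsSingularDim (q / 2) (-q) c nsAntichiral ∅ m (-n) :=
    nsSingularDim_mirror mirror_chiral mirror_antichiral hempty hempty m n
  have hle : nsSingularDim (q / 2) q c nsChiral ∅ m n ≤ if n = -1 ∨ n = 0 then 1 else 0 := by
    rw [hdim]
    refine (nsSingularDim_antichiral_le hc hΔ).trans_eq (if_congr ?_ rfl rfl)
    omega
  refine ⟨?_, nsSingularDim_antichiral hc rfl m n, TopGen.topGSingularDim_le hc m n, hle,
    nsSingularDim_le_empty.trans hle, nsSingularDim_antichiral_le hc rfl,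
    nsSingularDim_antichiral_le hc rfl, fun ψ h => ?_, fun ψ h => ?_, fun ψ h => ?_,
    fun ψ h => h.antichiral_chiral rfl, ?_, fun ⟨ψ, h⟩ => h.not_antichiral_antichiral hc rfl⟩
  · rw [hdim, nsSingularDim_antichiral hc hΔ]
    congr 1
    push_cast
    ring
  · obtain ⟨hn, k, hk, hmk⟩ := ((isNSSingular_vermaMirror mirror_chiral mirror_antichiral hempty
      hempty).2 h).antichiral_level_charge hc hΔ
    rcases hn with hn | hn
    · obtain rfl : n = 0 := by omega
      exact Or.inl ⟨rfl, k, hk, by simpa using hmk⟩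
    · obtain rfl : n = -1 := by omega
      refine Or.inr ⟨rfl, k, hk, ?_⟩
      rw [← hmk]
      push_cast
      ring
  · obtain ⟨hn, k, hk, hmk⟩ := h.antichiral_level_charge hc rfl
    rcases hn with rfl | rfl
    · exact Or.inl ⟨rfl, k, hk, by simpa using hmk⟩
    · refine Or.inr ⟨rfl, k, hk, ?_⟩
      rw [← hmk]
      push_cast
      ring
  · have := ((isNSSingular_vermaMirror mirror_chiral mirror_antichiral mirror_antichiral
      mirror_chiral).2 h).antichiral_chiral hΔ
    push_cast at this
    linear_combination -this
  · rintro ⟨ψ, h⟩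
    exact ((isNSSingular_vermaMirror mirror_chiral mirror_antichiral mirror_chiral
      mirror_antichiral).2 h).not_antichiral_antichiral hc hΔ

end
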